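/- **Setting.** Let $(X,\Phi,Y,\Phi^\vee)$ be a reduced root datum ($X$ a free abelian group of finite rank, $\Phi\subset X$ a finite set of roots, $\langle\ ,\ \rangle$ the pairing of $X$ with $Y$) with base $\Pi$; for example $X=X(T)$ and $\Phi$ the roots of a connected reductive complex group with respect to a maximal torus $T$, $\Pi$ being given by a Borel subgroup containing $T$. Let $W$ be its Weyl group, $S=\{s_\alpha\mid\alpha\in\Pi\}$, $W_{\rm ex}=\{t_\lambda w\mid\lambda\in X,\ w\in W\}\cong X\rtimes W$ the extended affine Weyl group, and $W_{\rm af}$ the subgroup generated by $W$ and the $t_\alpha$, $\alpha\in\Phi$. Let $S_{\rm af}=S\cup\{t_\beta s_\beta\mid \beta^\vee \text{ a maximal coroot}\}$ be the Coxeter generating set of $W_{\rm af}$ (maximal for the dominance order on $\Phi^\vee$, that is, the highest coroot of an irreducible component) and let $\Gamma$ be the normalizer of the set $S_{\rm af}$ in $W_{\rm ex}$, so that $W_{\rm ex}=W_{\rm af}\rtimes\Gamma$. The length function $\ell$ and the Bruhat order of $(W_{\rm af},S_{\rm af})$ are extended to $W_{\rm ex}$ by $\ell(y\gamma)=\ell(y)$,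 and $y\gamma\le y'\gamma'$ if and only if $\gamma=\gamma'$ and $y\le y'$. Let $A=\mathbb Z[v,v^{-1}]$. The extended affine Hecke algebra $\mathcal H$ is the $A$-algebra with generators $T_x$ ($x\in W_{\rm ex}$) and relations $T_1=1$, $T_xT_y=T_{xy}$ if $\ell(xy)=\ell(x)+\ell(y)$, and $T_s^2=v^2T_1+(v^2-1)T_s$ for $s\in S_{\rm af}$. The bar involution is the unique ring automorphism $h\mapsto\overline h$ of $\mathcal H$ with $\overline v=v^{-1}$ and $\overline{T_x}=T_{x^{-1}}^{-1}$ for $x\in W_{\rm ex}$; $h$ is called self-dual if $\overline h=h$. For $x\in W_{\rm ex}$ let $C_x$ and $C'_x$ be the unique self-dual elements of $\mathcal H$ of the form $$C_x=v^{-\ell(x)}T_x+\sum_{y<x}(-1)^{\ell(x)+\ell(y)}v^{\ell(x)-2\ell(y)}\,\overline{P_{y,x}}\,T_y,\qquad C'_x=v^{-\ell(x)}T_x+\sum_{y<x}v^{-\ell(x)}P_{y,x}T_y,$$ where each $P_{y,x}\in\mathbb Z[v]$ is a polynomial of degree at most $\ell(x)-\ell(y)-1$. Let $I,J\subseteq S$.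 Let $W_I$ be the subgroup generated by $I$ and $w_I$ its longest element (similarly for $J$). Put $\chi^{IJ}(h)=C_{w_I}hC_{w_J}$ for $h\in\mathcal H$ and $\mathcal H^{IJ}=C_{w_I}\mathcal HC_{w_J}=\chi^{IJ}(\mathcal H)$. Let $W^{IJ}$ be the set of minimal length $(W_I,W_J)$-double coset representatives in $W$. For $z\in W^{IJ}$ let $X_z^+$ be the set of $\lambda\in X$ with $\langle\lambda,\alpha^\vee\rangle\ge0$ for all $\alpha\in\Pi$ with $s_\alpha\in I\cap zJz^{-1}$, and for $\lambda\in X_z^+$ let $m_{\lambda,z}$ be the unique element of minimal length in $W_It_\lambda zW_J$, and let $C'_{\lambda,z}=C_{w_I}C'_{m_{\lambda,z}}C_{w_J}$. **Proposition.** The objects above are well defined: the bar involution, all $C_x$ and $C'_x$, the elements $w_I$ and $w_J$, and all $m_{\lambda,z}$ exist and are unique. The family $(C'_{\lambda,z})$, $z\in W^{IJ}$, $\lambda\in X_z^+$, consists of self-dual elements and is an $A$-basis of $\mathcal H^{IJ}$. For every $x\in W_{\rm ex}$, $$\chi^{IJ}(C'_x)=\begin{cases}C'_{\lambda,z}&\text{if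 }x=m_{\lambda,z}\text{ for some }z\in W^{IJ},\ \lambda\in X_z^+,\\0&\text{otherwise.}\end{cases}$$ Moreover $\mathcal H$ is the direct sum of the $A$-span of $\{C'_{m_{\lambda,z}}\mid z\in W^{IJ},\ \lambda\in X_z^+\}$ and the kernel of $\chi^{IJ}$, so that $\chi^{IJ}$ may be identified with a projection of $\mathcal H$ onto that span. -/

import Mathlib

noncomputable section

namespace AffHecke

variable {ι X Y : Type*} [AddCommGroup X] [AddCommGroup Y]

/-! ### The extended affine Weyl group of a root datum -/

/-- The action of the finite Weyl group on the character lattice `X`, as automorphisms of the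
multiplicative copy of `X`. -/
def weylAct (P : RootPairing ι ℤ X Y) : P.weylGroup →* MulAut (Multiplicative X) where
  toFun w := AddEquiv.toMultiplicative (DistribMulAction.toAddEquiv X w)
  map_one' := by
    ext x
    exact congrArg Multiplicative.ofAdd (one_smul P.weylGroup (Multiplicative.toAdd x))
  map_mul' w w' := by
    ext x
    exact congrArg Multiplicative.ofAdd (mul_smul w w' (Multiplicative.toAdd x))

/-- The extended affine Weyl group `X ⋊ W`. -/
abbrev ExtWeyl (P : RootPairing ι ℤ X Y) : Type _ :=
  Multiplicative X ⋊[weylAct P] P.weylGroup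

/-- The translation `t_lam`. -/
def transl (P : RootPairing ι ℤ X Y) (lam : X) : ExtWeyl P :=
  SemidirectProduct.inl (Multiplicative.ofAdd lam)

/-- The reflection `s_α` in the root `α` with index `i`. -/
def refl (P : RootPairing ι ℤ X Y) (i : ι) : ExtWeyl P :=
  SemidirectProduct.inr (RootPairing.weylGroup.ofIdx P i)

/-- The finite Weyl group `W`, as a subgroup of the extended affine Weyl group. -/
def finWeyl (P : RootPairing ι ℤ X Y) : Subgroup (ExtWeyl P) :=
  (SemidirectProduct.inr : P.weylGroup →* ExtWeyl P).range

/-- The affine Weyl group, generated by `W` and the translations by roots. -/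
def affWeyl (P : RootPairing ι ℤ X Y) : Subgroup (ExtWeyl P) :=
  Subgroup.closure ((finWeyl P : Set (ExtWeyl P)) ∪ Set.range fun i : ι => transl P (P.root i))

variable {P : RootPairing ι ℤ X Y} (b : P.Base)

/-- The set `S` of simple reflections. -/
def simpleRefl : Set (ExtWeyl P) := refl P '' (b.support : Set ι)

/-- The coroot with index `i` is maximal for the dominance order on coroots
(the highest coroot of an irreducible component). -/
def IsMaxCoroot (i : ι) : Prop :=
  ∀ j : ι, P.coroot j - P.coroot i ∈
    AddSubmonoid.closure (P.coroot '' (b.support : Set ι)) → j = i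

/-- The Coxeter generating set `S_af` of the affine Weyl group: the simple reflections, together
with the reflections `t_β s_β` in the affine hyperplanes `⟨x, β^∨⟩ = 1`, for `β^∨` a maximal
coroot. These are the reflections in the walls of the fundamental alcove. -/
def affRefl : Set (ExtWeyl P) :=
  simpleRefl b ∪ {x | ∃ i : ι, IsMaxCoroot b i ∧ x = transl P (P.root i) * refl P i}

/-- The complement `Γ` of the affine Weyl group in the extended one: the elements that permute
`S_af` by conjugation. -/
def Gam : Set (ExtWeyl P) :=
  {g | (fun s => g * s * g⁻¹) '' affRefl b = affRefl b}

/-- The length function: `len b (y * g)` is the length of `y` with respect to `S_af`,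
for `y` in the affine Weyl group and `g` in `Γ`. -/
def len (x : ExtWeyl P) : ℕ :=
  sInf {n | ∃ l : List (ExtWeyl P), l.length = n ∧ (∀ s ∈ l, s ∈ affRefl b) ∧
    ∃ g ∈ Gam b, x = l.prod * g}

/-- The strict Bruhat order: the transitive closure of `y < t * y` for reflections `t` of the
affine Weyl group with `len y < len (t * y)`. (Comparable elements have the same component
in `Γ`.) -/
def BruhatLT : ExtWeyl P → ExtWeyl P → Prop :=
  Relation.TransGen fun y x =>
    (∃ u ∈ affWeyl P, ∃ s ∈ affRefl b, x = u * s * u⁻¹ * y) ∧ len b y < len b x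

/-! ### The extended affine Hecke algebra -/

/-- The ring `A = ℤ[v, v⁻¹]`. -/
abbrev A : Type := LaurentPolynomial ℤ

/-- `v ^ n` in `A`, for an integer `n`. -/
abbrev vpow (n : ℤ) : A := LaurentPolynomial.T n

/-- The defining relations of the Hecke algebra. -/
inductive HeckeRel : FreeAlgebra A (ExtWeyl P) → FreeAlgebra A (ExtWeyl P) → Prop
  | one : HeckeRel (FreeAlgebra.ι A 1) 1
  | mul (x y : ExtWeyl P) (h : len b (x * y) = len b x + len b y) :
      HeckeRel (FreeAlgebra.ι A x * FreeAlgebra.ι A y) (FreeAlgebra.ι A (x * y))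
  | quad (s : ExtWeyl P) (h : s ∈ affRefl b) :
      HeckeRel (FreeAlgebra.ι A s * FreeAlgebra.ι A s)
        (vpow 2 • FreeAlgebra.ι A 1 + (vpow 2 - 1) • FreeAlgebra.ι A s)

/-- The extended affine Hecke algebra: the `A`-algebra with generators `T_x`, for `x` in the
extended affine Weyl group, and relations `T_1 = 1`, `T_x T_y = T_{xy}` if the lengths add, and
`T_s ^ 2 = v ^ 2 T_1 + (v ^ 2 - 1) T_s` for `s` in `S_af`. -/
abbrev Hecke : Type _ := RingQuot (HeckeRel b)

/-- The standard generator `T_x`. -/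
def T (x : ExtWeyl P) : Hecke b := RingQuot.mkAlgHom A (HeckeRel b) (FreeAlgebra.ι A x)

/-- `f` is the bar involution: the ring automorphism with `v ↦ v⁻¹` and `T_x ↦ (T_{x⁻¹})⁻¹`. -/
def IsBar (f : Hecke b ≃+* Hecke b) : Prop :=
  f (algebraMap A (Hecke b) (vpow 1)) = algebraMap A (Hecke b) (vpow (-1)) ∧
  ∀ x : ExtWeyl P, f (T b x) * T b x⁻¹ = 1 ∧ T b x⁻¹ * f (T b x) = 1

/-- The bar involution. -/
def bar : Hecke b ≃+* Hecke b :=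
  haveI : Nonempty (Hecke b ≃+* Hecke b) := ⟨RingEquiv.refl _⟩
  Classical.epsilon (IsBar b)

/-- `p y` is supported on `y < x` and is a polynomial in `v` of degree at most
`len x - len y - 1`. -/
def IsKLFamily (x : ExtWeyl P) (p : ExtWeyl P →₀ Polynomial ℤ) : Prop :=
  ∀ y ∈ p.support, BruhatLT b y x ∧ (p y).natDegree + 1 + len b y ≤ len b x

/-- The characterization of the Kazhdan-Lusztig element `C_x`. -/
def IsKLC (x : ExtWeyl P) (c : Hecke b) : Prop :=
  bar b c = c ∧ ∃ p : ExtWeyl P →₀ Polynomial ℤ, IsKLFamily b x p ∧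
    c = vpow (-(len b x : ℤ)) • T b x + p.sum fun y q =>
      ((-1) ^ (len b y + len b x) * vpow ((len b x : ℤ) - 2 * (len b y : ℤ)) *
        LaurentPolynomial.invert (Polynomial.toLaurent q)) • T b y

/-- The characterization of the Kazhdan-Lusztig element `C'_x`. -/
def IsKLC' (x : ExtWeyl P) (c : Hecke b) : Prop :=
  bar b c = c ∧ ∃ p : ExtWeyl P →₀ Polynomial ℤ, IsKLFamily b x p ∧
    c = vpow (-(len b x : ℤ)) • T b x + p.sum fun y q =>
      (vpow (-(len b x : ℤ)) * Polynomial.toLaurent q) • T b y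

/-- The Kazhdan-Lusztig basis element `C_x`. -/
def klC (x : ExtWeyl P) : Hecke b := Classical.epsilon (IsKLC b x)

/-- The Kazhdan-Lusztig basis element `C'_x`. -/
def klC' (x : ExtWeyl P) : Hecke b := Classical.epsilon (IsKLC' b x)

/-! ### Parabolic subgroups and double cosets -/

/-- The subgroup `W_I` generated by `I`. -/
def para (I : Set (ExtWeyl P)) : Subgroup (ExtWeyl P) := Subgroup.closure I

/-- `w` is an element of maximal length of `W_I`. -/
def IsLongest (I : Set (ExtWeyl P)) (w : ExtWeyl P) : Prop :=
  w ∈ para I ∧ ∀ u ∈ para I, len b u ≤ len b w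

/-- The longest element `w_I` of `W_I`. -/
def longest (I : Set (ExtWeyl P)) : ExtWeyl P := Classical.epsilon (IsLongest b I)

/-- `W^{IJ}`: the minimal length `(W_I, W_J)`-double coset representatives in `W`. -/
def minReps (I J : Set (ExtWeyl P)) : Set (ExtWeyl P) :=
  {z | z ∈ finWeyl P ∧ ∀ u ∈ para I, ∀ w ∈ para J, len b z ≤ len b (u * z * w)}

/-- `X_z^+`: the weights `lam` with `⟨lam, α^∨⟩ ≥ 0` for all simple roots `α` such that
`s_α` lies in `I ∩ z J z⁻¹`. -/
def domWeights (I J : Set (ExtWeyl P)) (z : ExtWeyl P) : Set X :=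
  {lam | ∀ i ∈ b.support, refl P i ∈ I → z⁻¹ * refl P i * z ∈ J →
    0 ≤ P.toLinearMap lam (P.coroot i)}

/-- The pairs `(lam, z)` with `z` in `W^{IJ}` and `lam` in `X_z^+`. -/
def Idx (I J : Set (ExtWeyl P)) : Type _ :=
  {p : X × ExtWeyl P // p.2 ∈ minReps b I J ∧ p.1 ∈ domWeights b I J p.2}

/-- `m` is an element of minimal length of the double coset `W_I x W_J`. -/
def IsMinIn (I J : Set (ExtWeyl P)) (x m : ExtWeyl P) : Prop :=
  (∃ u ∈ para I, ∃ w ∈ para J, m = u * x * w) ∧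
  ∀ u ∈ para I, ∀ w ∈ para J, len b m ≤ len b (u * x * w)

/-- The element `m_{lam, z}` of minimal length in the double coset `W_I t_lam z W_J`. -/
def minElt (I J : Set (ExtWeyl P)) (p : Idx b I J) : ExtWeyl P :=
  Classical.epsilon (IsMinIn b I J (transl P p.1.1 * p.1.2))

/-! ### The submodule `H^{IJ}` -/

/-- The map `χ^{IJ} : h ↦ C_{w_I} h C_{w_J}`. -/
def chi (I J : Set (ExtWeyl P)) : Hecke b →ₗ[A] Hecke b :=
  (LinearMap.mulLeft A (klC b (longest b I))).comp (LinearMap.mulRight A (klC b (longest b J)))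

/-- The `A`-submodule `H^{IJ} = C_{w_I} H C_{w_J}`. -/
def HIJ (I J : Set (ExtWeyl P)) : Submodule A (Hecke b) := LinearMap.range (chi b I J)

/-- The element `C'_{lam, z} = C_{w_I} C'_{m_{lam, z}} C_{w_J}`. -/
def klIJ (I J : Set (ExtWeyl P)) (p : Idx b I J) : Hecke b :=
  klC b (longest b I) * klC' b (minElt b I J p) * klC b (longest b J)

end AffHecke

end

/-! ### Heights and maximal coroots. -/

noncomputable section

namespace AffHecke

variable {ι X Y : Type*} [AddCommGroup X] [AddCommGroup Y]
variable {P : RootPairing ι ℤ X Y} (b : P.Base)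

/-! ### Integral root pairings -/

/-! The mechanism is a clash of eigenvalues. If s x < x for s in S_af, then T_s C'_x = v² C'_x
(`T_mul_klC'`), whereas C_{w_I} T_s = -C_{w_I} for s in I (`klC_longest_mul_T`). Evaluating C_{w_I}
T_s C'_x in two ways for such s in I gives (v² + 1) C_{w_I} C'_x = 0. The Hecke algebra is free over
the domain A, so C_{w_I} C'_x = 0. The same happens on the right with J. Hence χ^{IJ} kills C'_x
unless x has no left descent in I and no right descent in J.

Such x are the minimal elements of the double cosets of W_I and W_J, and pairs (λ, z) label them
bijectively (`exists_eq_minElt`, `minElt_injective`). Write x = t_λ g and replace g by the minimal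
element z of its double coset. Then λ remains free up to W_I ∩ z W_J z⁻¹, which by Kilmoyer's
theorem (`mem_closure_inter`) is generated by I ∩ z J z⁻¹. Each orbit of this group on X contains
exactly one dominant weight.

Since the C'_x span, the surviving images span H^{IJ}. Their independence is a triangularity in the
length of m = m_{λ,z}. The shorter terms T_y of C'_m contribute nothing to T_m, because the double
coset of m contains nothing shorter than m. The coefficient of T_m in C_{w_I} T_m C_{w_J} is nonzero
already at v = 1: there the algebra becomes a group ring, C_{w_I} becomes a nonzero multiple of a
signed sum, and u m w = m forces ℓ(u) + ℓ(w) to be even, so no cancellation occurs. The splitting of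
the algebra follows, and self-duality is inherited from the three factors.

The background is built from the root datum. Length is the number of affine inversions
(`len_eq_invCard`) and Γ consists of the elements of length zero (`mem_Gam_iff`), which yields the
axioms `IsExtCoxeter`. The standard basis comes from the regular representation (`exists_regular`),
the C'_x from the usual induction on length (`exists_isKL`), and the C_x from the C'_x by a twist
(`klC_eq`). -/

lemma pairingIn_int (P : RootPairing ι ℤ X Y) (i j : ι) : P.pairingIn ℤ i j = P.pairing i j :=
  P.algebraMap_pairingIn ℤ i j

lemma isAddTorsionFree_weight (P : RootPairing ι ℤ X Y) : IsAddTorsionFree X := by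
  have : Module.IsReflexive ℤ X := .of_isPerfPair P.toLinearMap
  exact .of_isTorsionFree ℤ X

lemma isReduced_flip (P : RootPairing ι ℤ X Y) [Finite ι] [P.IsReduced] : P.flip.IsReduced := by
  have : Module.IsReflexive ℤ X := .of_isPerfPair P.toLinearMap
  have : Module.IsReflexive ℤ Y := .of_isPerfPair P.flip.toLinearMap
  infer_instance

lemma coroot_sub_mem [Finite ι] {i j : ι} (h : 0 < P.pairing i j) (hij : j ≠ i) :
    ∃ k, P.coroot k = P.coroot j - P.coroot i := by
  have := P.flip.root_sub_root_mem_of_pairingIn_pos (i := j) (j := i)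
    (by rw [pairingIn_int]; exact h) hij
  exact this

lemma coroot_add_mem [Finite ι] {i j : ι} (h : P.pairing i j < 0)
    (hij : P.coroot j ≠ -P.coroot i) : ∃ k, P.coroot k = P.coroot j + P.coroot i := by
  have := P.flip.root_add_root_mem_of_pairingIn_neg (i := j) (j := i)
    (by rw [pairingIn_int]; exact h) hij
  exact this

lemma pairing_pos_comm (P : RootPairing ι ℤ X Y) [Finite ι] {i j : ι} :
    0 < P.pairing i j ↔ 0 < P.pairing j i := by
  have := P.zero_lt_pairingIn_iff' ℤ (i := i) (j := j)
  rwa [pairingIn_int, pairingIn_int] at this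

lemma exists_coroot_neg (P : RootPairing ι ℤ X Y) (i : ι) :
    ∃ j, P.coroot j = -P.coroot i ∧ P.root j = -P.root i :=
  ⟨P.reflectionPerm i i, by simp [P.coroot_reflectionPerm], by simp [P.root_reflectionPerm]⟩

lemma reflection_zsmul_sub (P : RootPairing ι ℤ X Y) (i : ι) (x : X) :
    P.reflection i x = x - P.toLinearMap x (P.coroot i) • P.root i := by
  rw [P.reflection_apply]; rfl

lemma coroot_reflectionPerm_eq (P : RootPairing ι ℤ X Y) (i j : ι) :
    P.coroot (P.reflectionPerm i j) = P.coroot j - P.pairing i j • P.coroot i := by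
  rw [P.coroot_reflectionPerm, P.coreflection_apply_coroot]

/-! ### The sum of the positive roots -/

open scoped Classical in
/-- The sum of the positive roots. -/
def twoRho [Finite ι] : X :=
  haveI := Fintype.ofFinite ι
  ∑ i : ι with b.IsPos i, P.root i

/-- A simple reflection negates its own root and permutes the other positive roots. -/
lemma reflection_twoRho [Finite ι] [P.IsReduced] {j : ι} (hj : j ∈ b.support) :
    P.reflection j (twoRho b) = twoRho b - (2 : ℤ) • P.root j := by
  classical
  have := Fintype.ofFinite ι
  have hpos : b.IsPos j := RootPairing.Base.isPos_of_mem_support hj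
  have key : P.reflection j (∑ i ∈ ({i | b.IsPos i} : Finset ι).erase j, P.root i)
      = ∑ i ∈ ({i | b.IsPos i} : Finset ι).erase j, P.root i := by
    rw [map_sum]
    simp_rw [← P.root_reflectionPerm]
    refine Finset.sum_nbij' (P.reflectionPerm j) (P.reflectionPerm j) ?_ ?_ (by simp) (by simp)
      (by simp)
    all_goals
      intro i hi
      simp only [Finset.mem_erase, Finset.mem_filter, Finset.mem_univ, true_and] at hi ⊢
      refine ⟨fun h => ?_, hi.2.reflectionPerm hj hi.1⟩
      have h1 : i = P.reflectionPerm j j :=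
        (P.reflectionPerm_self j i).symm.trans (congrArg _ h)
      have h2 := hi.2
      rw [h1] at h2
      exact (RootPairing.Base.IsPos.neg_iff_not b j).mp h2 hpos
  have h2 : twoRho b = P.root j + ∑ i ∈ ({i | b.IsPos i} : Finset ι).erase j, P.root i := by
    rw [Finset.add_sum_erase _ _ (by simpa using hpos)]
    unfold twoRho
    congr!
  rw [h2, map_add, key, P.reflection_apply_self]
  module

lemma twoRho_coroot [Finite ι] [P.IsReduced] {j : ι} (hj : j ∈ b.support) :
    P.toLinearMap (twoRho b) (P.coroot j) = 2 := by
  have h := reflection_twoRho b hj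
  rw [reflection_zsmul_sub] at h
  have h1 := sub_right_injective h
  have := isAddTorsionFree_weight P
  have h2 : (P.toLinearMap (twoRho b) (P.coroot j) - 2) • P.root j = 0 := by
    rw [sub_smul, sub_eq_zero]; exact h1
  rcases smul_eq_zero.mp h2 with h3 | h3
  · linarith
  · exact absurd h3 (P.ne_zero j)

/-- Twice the height of a coroot. -/
def ht [Finite ι] (i : ι) : ℤ := P.toLinearMap (twoRho b) (P.coroot i)

lemma ht_eq_height [Finite ι] [P.IsReduced] (i : ι) : ht b i = 2 * b.flip.height i := by
  obtain ⟨f, -, -, hf⟩ := b.flip.exists_root_eq_sum_int i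
  rw [RootPairing.Base.height_eq_sum hf]
  have hf' : P.coroot i = ∑ j ∈ b.support, f j • P.coroot j := hf
  rw [ht, hf', map_sum, Finset.mul_sum]
  refine Finset.sum_congr rfl fun j hj => ?_
  rw [map_zsmul, twoRho_coroot b hj, smul_eq_mul, mul_comm]

lemma ht_ne_zero [Finite ι] [P.IsReduced] (i : ι) : ht b i ≠ 0 := by
  rw [ht_eq_height]
  have := b.flip.height_ne_zero i
  lia

/-- The monoid of nonnegative combinations of simple coroots. -/
abbrev corootCone : AddSubmonoid Y := AddSubmonoid.closure (P.coroot '' (b.support : Set ι))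

lemma twoRho_nonneg_of_mem [Finite ι] [P.IsReduced] {y : Y} (hy : y ∈ corootCone b) :
    0 ≤ P.toLinearMap (twoRho b) y := by
  induction hy using AddSubmonoid.closure_induction with
  | mem x hx =>
    obtain ⟨j, hj, rfl⟩ := hx
    rw [twoRho_coroot b hj]; norm_num
  | zero => simp
  | add x y _ _ hx hy => rw [map_add]; exact add_nonneg hx hy

lemma coroot_mem_iff [Finite ι] [P.IsReduced] (i : ι) :
    P.coroot i ∈ corootCone b ↔ 0 < ht b i := by
  refine ⟨fun h => lt_of_le_of_ne (twoRho_nonneg_of_mem b h) (ht_ne_zero b i).symm, fun h => ?_⟩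
  rcases b.coroot_mem_or_neg_mem i with h1 | h1
  · exact h1
  · have := twoRho_nonneg_of_mem b h1
    rw [map_neg] at this
    rw [ht] at h
    lia

lemma neg_coroot_mem_iff [Finite ι] [P.IsReduced] (i : ι) :
    -P.coroot i ∈ corootCone b ↔ ht b i < 0 := by
  obtain ⟨j, hj, -⟩ := exists_coroot_neg P i
  rw [← hj, coroot_mem_iff, ht, hj, map_neg, ht, neg_pos]

lemma ht_reflectionPerm_pos [Finite ι] [P.IsReduced] {i j : ι} (hi : 0 < ht b i)
    (hj : j ∈ b.support) (hij : i ≠ j) : 0 < ht b (P.reflectionPerm j i) := by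
  have := isReduced_flip P
  have h1 : b.flip.IsPos i := by
    rw [RootPairing.Base.isPos_iff]; rw [ht_eq_height] at hi; lia
  have h2 := RootPairing.Base.IsPos.reflectionPerm h1 (j := j) hj hij
  rw [RootPairing.Base.isPos_iff] at h2
  rw [ht_eq_height]
  have h3 : P.flip.reflectionPerm j i = P.reflectionPerm j i := rfl
  rw [h3] at h2
  lia

/-- Every simple coroot pairs to 2 with `twoRho`, so the cone is pointed; this makes the dominance
order antisymmetric. -/
lemma eq_zero_or_twoRho_pos [Finite ι] [P.IsReduced] {z : Y} (hz : z ∈ corootCone b) :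
    z = 0 ∨ 0 < P.toLinearMap (twoRho b) z := by
  induction hz using AddSubmonoid.closure_induction with
  | mem x hx =>
    obtain ⟨j, hj, rfl⟩ := hx
    rw [twoRho_coroot b hj]; norm_num
  | zero => simp
  | add x y hx' hy' hx hy =>
    rcases hx with rfl | hx
    · simpa using hy
    · right
      rw [map_add]
      exact add_pos_of_pos_of_nonneg hx (twoRho_nonneg_of_mem b hy')

lemma corootCone_eq_zero [Finite ι] [P.IsReduced] {y : Y} (hy : y ∈ corootCone b)
    (hy' : -y ∈ corootCone b) : y = 0 := by
  rcases eq_zero_or_twoRho_pos b hy with h | h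
  · exact h
  · have := twoRho_nonneg_of_mem b hy'
    rw [map_neg] at this
    lia

/-! ### Maximal coroots -/

variable {b}

/-- A negative β^∨ would lie strictly below -β^∨, against maximality. -/
lemma IsMaxCoroot.pos [Finite ι] [P.IsReduced] {β : ι} (hβ : IsMaxCoroot b β) : 0 < ht b β := by
  by_contra h
  have h1 : ht b β < 0 := lt_of_le_of_ne (not_lt.mp h) (ht_ne_zero b β)
  have h2 := (neg_coroot_mem_iff b β).mpr h1
  obtain ⟨j, hj, -⟩ := exists_coroot_neg P β
  have h3 := hβ j (by rw [hj, sub_eq_add_neg]; exact add_mem h2 h2)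
  rw [h3] at hj
  have h4 : ht b β = -ht b β := by conv_lhs => rw [ht, hj, map_neg, ← ht]
  lia

/-- If the pairing were negative, β^∨ + α_j^∨ would be a larger coroot. -/
lemma IsMaxCoroot.dominant [Finite ι] [P.IsReduced] {β : ι} (hβ : IsMaxCoroot b β) {j : ι}
    (hj : j ∈ b.support) : 0 ≤ P.pairing j β := by
  by_contra! h
  have hjm : P.coroot j ∈ corootCone b := AddSubmonoid.subset_closure ⟨j, hj, rfl⟩
  by_cases hc : P.coroot β = -P.coroot j
  · have h1 := hβ.pos
    rw [← coroot_mem_iff, hc, neg_coroot_mem_iff] at h1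
    have := (coroot_mem_iff b j).mp hjm
    lia
  · obtain ⟨k, hk⟩ := coroot_add_mem h hc
    have := hβ k (by rw [hk]; simpa using hjm)
    rw [this] at hk
    have h0 : P.coroot j = 0 := by simpa using hk
    exact P.ne_zero' j h0

/-- The difference is zero or a coroot; a negative one would put α_i^∨ strictly above β^∨. -/
lemma IsMaxCoroot.sub_mem [Finite ι] [P.IsReduced] {β i : ι} (hβ : IsMaxCoroot b β)
    (h : 0 < P.pairing β i) : P.coroot β - P.coroot i ∈ corootCone b := by
  by_cases hi : β = i
  · simp [hi]
  · obtain ⟨k, hk⟩ := coroot_sub_mem (pairing_pos_comm P |>.mp h) hi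
    rw [← hk]
    rcases b.coroot_mem_or_neg_mem k with h1 | h1
    · exact h1
    · rw [hk, neg_sub] at h1
      exact absurd (hβ i h1).symm hi

/-- Let p be the pairing. The coroot -s_β(α_i^∨) = (p - 2) β^∨ + (β^∨ - α_i^∨) + β^∨ dominates β^∨,
so it equals β^∨ by maximality. Then α_i^∨ = (p - 1) β^∨, and pairing with β gives p = 2(p - 1). The
affine simple reflection needs this bound to make only its own root negative. -/
lemma IsMaxCoroot.eq_of_two_le [Finite ι] [P.IsReduced] {β i : ι} (hβ : IsMaxCoroot b β)
    (h : 2 ≤ P.pairing β i) : i = β := by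
  have h1 := hβ.sub_mem (i := i) (by lia)
  have h2 := (coroot_mem_iff b β).mpr hβ.pos
  obtain ⟨k, hk, -⟩ := exists_coroot_neg P (P.reflectionPerm β i)
  rw [coroot_reflectionPerm_eq] at hk
  have h3 : k = β := by
    refine hβ k ?_
    have : P.coroot k - P.coroot β =
        (P.pairing β i - 2).toNat • P.coroot β + (P.coroot β - P.coroot i) := by
      rw [← natCast_zsmul, Int.toNat_of_nonneg (by lia), hk]
      module
    rw [this]
    exact add_mem (nsmul_mem h2 _) h1
  subst h3
  have h4 : P.coroot i = (P.pairing k i - 1) • P.coroot k := by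
    rw [sub_smul, one_smul]
    nth_rewrite 2 [hk]
    module
  have h5 : P.pairing k i = (P.pairing k i - 1) * 2 := by
    conv_lhs => rw [← P.root_coroot_eq_pairing, h4, map_zsmul, P.root_coroot_eq_pairing]
    simp
  have h6 : P.pairing k i = 2 := by lia
  rw [h6] at h4
  exact P.coroot.injective (by simpa using h4)

lemma IsMaxCoroot.pairing_nonneg [Finite ι] [P.IsReduced] {β i : ι} (hβ : IsMaxCoroot b β)
    (hi : 0 < ht b i) : 0 ≤ P.pairing β i := by
  have h1 : ∀ y ∈ corootCone b, 0 ≤ P.toLinearMap (P.root β) y := by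
    intro y hy
    induction hy using AddSubmonoid.closure_induction with
    | mem x hx =>
      obtain ⟨j, hj, rfl⟩ := hx
      rw [P.root_coroot_eq_pairing]
      have h1 := hβ.dominant hj
      by_contra! h2
      have h3 : P.pairing j β < 0 := by
        have := P.pairingIn_lt_zero_iff ℤ (i := j) (j := β)
        rw [pairingIn_int, pairingIn_int] at this
        exact this.mpr h2
      lia
    | zero => simp
    | add x y _ _ hx hy => rw [map_add]; exact add_nonneg hx hy
  rw [← P.root_coroot_eq_pairing]
  exact h1 _ ((coroot_mem_iff b i).mpr hi)

/-- Among the coroots above the given one, one of greatest height is maximal. -/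
lemma exists_isMaxCoroot_ge [Finite ι] [P.IsReduced] (i : ι) :
    ∃ β, IsMaxCoroot b β ∧ P.coroot β - P.coroot i ∈ corootCone b := by
  have := Fintype.ofFinite ι
  obtain ⟨β, hβ, hmax⟩ := Set.exists_max_image {j | P.coroot j - P.coroot i ∈ corootCone b} (ht b)
    (Set.toFinite _) ⟨i, by simp⟩
  refine ⟨β, fun j hj => ?_, hβ⟩
  have h1 : P.coroot j - P.coroot i ∈ corootCone b := by
    have := add_mem hj hβ
    simpa using this
  have h2 := hmax j h1
  rcases eq_zero_or_twoRho_pos b hj with h3 | h3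
  · exact P.coroot.injective (sub_eq_zero.mp h3)
  · rw [map_sub] at h3
    simp only [ht] at h2
    lia

end AffHecke

end

/-! ### Affine roots, their reflections and their signs. -/

noncomputable section

namespace AffHecke

variable {ι X Y : Type*} [AddCommGroup X] [AddCommGroup Y]
variable {P : RootPairing ι ℤ X Y} (b : P.Base)

/-! ### The action of the extended affine Weyl group on the weight lattice -/

lemma weylGroup_smul_coroot (w : P.weylGroup) (x : X) (i : ι) :
    P.toLinearMap (w • x) (P.coroot (P.weylGroupToPerm w i)) = P.toLinearMap x (P.coroot i) := by
  obtain ⟨w, hw⟩ := w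
  induction hw using RootPairing.weylGroup.induction generalizing x i with
  | mem j =>
    change P.toLinearMap (P.reflection j x) (P.coroot (P.reflectionPerm j i)) = _
    rw [coroot_reflectionPerm_eq, reflection_zsmul_sub]
    simp only [map_sub, map_zsmul, LinearMap.sub_apply, LinearMap.smul_apply,
      P.root_coroot_eq_pairing, P.pairing_same, smul_eq_mul]
    ring
  | one => rfl
  | mul u v hu hv hu' hv' => exact (hu' (v • x) _).trans (hv' x i)

/-- The affine action of the extended affine Weyl group on the weight lattice. -/
def pt (g : ExtWeyl P) (x : X) : X := g.right • x + Multiplicative.toAdd g.left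

@[simp] lemma pt_one (x : X) : pt (1 : ExtWeyl P) x = x := by simp [pt]

lemma pt_mul (g h : ExtWeyl P) (x : X) : pt (g * h) x = pt g (pt h x) := by
  simp only [pt, SemidirectProduct.mul_right, SemidirectProduct.mul_left, mul_smul, smul_add,
    toAdd_mul]
  have : Multiplicative.toAdd ((weylAct P g.right) h.left)
    = g.right • Multiplicative.toAdd h.left := rfl
  rw [this]
  abel

@[simp] lemma pt_inv_pt (g : ExtWeyl P) (x : X) : pt g⁻¹ (pt g x) = x := by
  rw [← pt_mul, inv_mul_cancel, pt_one]

@[simp] lemma pt_pt_inv (g : ExtWeyl P) (x : X) : pt g (pt g⁻¹ x) = x := by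
  rw [← pt_mul, mul_inv_cancel, pt_one]

lemma weylGroup_ext {w w' : P.weylGroup} (h : ∀ x : X, w • x = w' • x) : w = w' := by
  apply Subtype.ext
  apply RootPairing.Equiv.weightHom_injective P
  ext x
  exact h x

/-- Faithfulness of the affine action: identities in the group are checked on points of X. -/
lemma pt_injective {g h : ExtWeyl P} (H : ∀ x, pt g x = pt h x) : g = h := by
  have h0 : g.left = h.left := by
    have := H 0
    simp only [pt, smul_zero, zero_add] at this
    exact Multiplicative.toAdd.injective this
  refine SemidirectProduct.ext h0 (weylGroup_ext fun x => ?_)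
  have := H x
  rw [pt, pt, h0] at this
  exact add_right_cancel this

@[simp] lemma pt_transl (lam x : X) : pt (transl P lam) x = x + lam := by
  simp [pt, transl]

@[simp] lemma pt_refl (i : ι) (x : X) : pt (refl P i) x = P.reflection i x := by
  simp [pt, refl]

/-! ### Affine roots -/

/-- The affine root `x ↦ ⟨x, α^∨⟩ + k`. -/
def aroot (P : RootPairing ι ℤ X Y) (i : ι) (k : ℤ) : X → ℤ :=
  fun x => P.toLinearMap x (P.coroot i) + k

/-- The reflection in the hyperplane on which the affine root `aroot P i k` vanishes. -/
def arefl (P : RootPairing ι ℤ X Y) (i : ι) (k : ℤ) : ExtWeyl P :=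
  transl P (-(k • P.root i)) * refl P i

/-- The linear action of the extended affine Weyl group on functions on the weight lattice. -/
def act (g : ExtWeyl P) : (X → ℤ) →ₗ[ℤ] (X → ℤ) := LinearMap.funLeft ℤ ℤ (pt g⁻¹)

lemma act_apply (g : ExtWeyl P) (f : X → ℤ) (x : X) : act g f x = f (pt g⁻¹ x) := rfl

@[simp] lemma act_one (f : X → ℤ) : act (1 : ExtWeyl P) f = f := by
  ext x; simp [act_apply]

lemma act_mul (g h : ExtWeyl P) (f : X → ℤ) : act (g * h) f = act g (act h f) := by
  ext x; simp [act_apply, pt_mul]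

@[simp] lemma act_inv_act (g : ExtWeyl P) (f : X → ℤ) : act g⁻¹ (act g f) = f := by
  rw [← act_mul, inv_mul_cancel, act_one]

@[simp] lemma act_injective (g : ExtWeyl P) : Function.Injective (act g) :=
  Function.LeftInverse.injective (act_inv_act g)

@[simp] lemma act_const (g : ExtWeyl P) (c : ℤ) :
    act g (fun _ => c) = fun _ => c := rfl

@[simp] lemma pt_arefl (i : ι) (k : ℤ) (x : X) :
    pt (arefl P i k) x = x - aroot P i k x • P.root i := by
  rw [arefl, pt_mul, pt_refl, pt_transl, reflection_zsmul_sub, aroot]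
  module

lemma aroot_sub_zsmul (j : ι) (m : ℤ) (x y : X) (c : ℤ) :
    aroot P j m (x - c • y) = aroot P j m x - c * P.toLinearMap y (P.coroot j) := by
  simp [aroot]; ring

@[simp] lemma arefl_mul_self (i : ι) (k : ℤ) : arefl P i k * arefl P i k = 1 := by
  refine pt_injective fun x => ?_
  rw [pt_mul, pt_arefl, pt_arefl, aroot_sub_zsmul, P.root_coroot_eq_pairing, P.pairing_same, pt_one]
  module

@[simp] lemma arefl_inv (i : ι) (k : ℤ) : (arefl P i k)⁻¹ = arefl P i k :=
  inv_eq_of_mul_eq_one_right (arefl_mul_self i k)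

lemma refl_eq_arefl (i : ι) : refl P i = arefl P i 0 := by
  refine pt_injective fun x => ?_
  simp [aroot, reflection_zsmul_sub]

lemma act_aroot (g : ExtWeyl P) (i : ι) (k : ℤ) :
    act g (aroot P i k) = aroot P (P.weylGroupToPerm g.right i)
      (k - P.toLinearMap (Multiplicative.toAdd g.left)
        (P.coroot (P.weylGroupToPerm g.right i))) := by
  ext x
  obtain ⟨y, rfl⟩ : ∃ y, x = pt g y := ⟨pt g⁻¹ x, by simp⟩
  rw [act_apply, pt_inv_pt, aroot, aroot, pt, map_add, LinearMap.add_apply, weylGroup_smul_coroot]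
  ring

lemma exists_act_aroot (g : ExtWeyl P) (i : ι) (k : ℤ) :
    ∃ j m, act g (aroot P i k) = aroot P j m ∧ g * arefl P i k * g⁻¹ = arefl P j m := by
  refine ⟨_, _, act_aroot g i k, pt_injective fun x => ?_⟩
  rw [pt_arefl, ← act_aroot, pt_mul, pt_mul, pt_arefl, act_apply, ← P.weylGroup_apply_root]
  obtain ⟨y, rfl⟩ : ∃ y, x = pt g y := ⟨pt g⁻¹ x, by simp⟩
  simp only [pt_inv_pt]
  simp only [pt]
  rw [smul_sub, smul_comm]
  abel

lemma aroot_injective {i j : ι} {k m : ℤ} (h : aroot P i k = aroot P j m) : i = j ∧ k = m := by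
  have hk : k = m := by simpa [aroot] using congrFun h 0
  subst hk
  refine ⟨P.coroot.injective ?_, rfl⟩
  refine P.flip.toPerfPair.injective ?_
  ext x
  have := congrFun h x
  exact add_right_cancel this

/-- `f` is an affine root, with reflection `t`. -/
def IsARoot (P : RootPairing ι ℤ X Y) (f : X → ℤ) (t : ExtWeyl P) : Prop :=
  ∃ i k, f = aroot P i k ∧ t = arefl P i k

lemma isARoot_aroot (i : ι) (k : ℤ) : IsARoot P (aroot P i k) (arefl P i k) := ⟨i, k, rfl, rfl⟩

lemma IsARoot.act {f : X → ℤ} {t : ExtWeyl P} (h : IsARoot P f t) (g : ExtWeyl P) :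
    IsARoot P (act g f) (g * t * g⁻¹) := by
  obtain ⟨i, k, rfl, rfl⟩ := h
  obtain ⟨j, m, h1, h2⟩ := exists_act_aroot g i k
  exact ⟨j, m, h1, h2⟩

lemma IsARoot.unique {f : X → ℤ} {t t' : ExtWeyl P} (h : IsARoot P f t) (h' : IsARoot P f t') :
    t = t' := by
  obtain ⟨i, k, rfl, rfl⟩ := h
  obtain ⟨j, m, h1, rfl⟩ := h'
  obtain ⟨rfl, rfl⟩ := aroot_injective h1
  rfl

/-- Opposite affine roots share a reflection, so every reflection has a positive root. -/
lemma IsARoot.neg {f : X → ℤ} {t : ExtWeyl P} (h : IsARoot P f t) : IsARoot P (-f) t := by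
  obtain ⟨i, k, rfl, rfl⟩ := h
  obtain ⟨j, hj, hj'⟩ := exists_coroot_neg P i
  have h1 : -aroot P i k = aroot P j (-k) := by
    ext x
    simp [aroot, hj]; ring
  refine ⟨j, -k, h1, pt_injective fun x => ?_⟩
  rw [pt_arefl, pt_arefl, hj', ← h1]
  simp

lemma IsARoot.mul_self {f : X → ℤ} {t : ExtWeyl P} (h : IsARoot P f t) : t * t = 1 := by
  obtain ⟨i, k, rfl, rfl⟩ := h
  exact arefl_mul_self i k

lemma IsARoot.inv_eq {f : X → ℤ} {t : ExtWeyl P} (h : IsARoot P f t) : t⁻¹ = t :=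
  inv_eq_of_mul_eq_one_right h.mul_self

lemma act_arefl (i : ι) (k : ℤ) (j : ι) (m : ℤ) :
    act (arefl P i k) (aroot P j m) = aroot P j m - P.pairing i j • aroot P i k := by
  ext x
  rw [act_apply, arefl_inv, pt_arefl, aroot_sub_zsmul, P.root_coroot_eq_pairing]
  simp [mul_comm]

lemma IsARoot.exists_act_eq {f f' : X → ℤ} {t t' : ExtWeyl P} (h : IsARoot P f t)
    (h' : IsARoot P f' t') : ∃ c : ℤ, AffHecke.act t f' = f' - c • f := by
  obtain ⟨i, k, rfl, rfl⟩ := h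
  obtain ⟨j, m, rfl, rfl⟩ := h'
  exact ⟨_, act_arefl i k j m⟩

lemma IsARoot.act_self {f : X → ℤ} {t : ExtWeyl P} (h : IsARoot P f t) :
    AffHecke.act t f = -f := by
  obtain ⟨i, k, rfl, rfl⟩ := h
  rw [act_arefl, P.pairing_same]
  module

lemma IsARoot.act_act_self {f : X → ℤ} {t : ExtWeyl P} (h : IsARoot P f t) (f' : X → ℤ) :
    AffHecke.act t (AffHecke.act t f') = f' := by
  rw [← act_mul, h.mul_self, act_one]

/-! ### Positive affine roots -/

section Pos

variable [Finite ι]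

/-- A bound for the heights of the coroots. -/
def htBound : ℤ :=
  haveI := Fintype.ofFinite ι
  1 + ∑ i, |ht b i|

lemma abs_ht_lt (i : ι) : |ht b i| < htBound b := by
  have := Fintype.ofFinite ι
  have h := Finset.single_le_sum (f := fun i => |ht b i|) (fun i _ => abs_nonneg _)
    (Finset.mem_univ i)
  have h2 : htBound b = 1 + ∑ i, |ht b i| := by unfold htBound; congr!
  rw [h2]
  lia

lemma htBound_pos : 0 < htBound b := by
  have := Fintype.ofFinite ι
  have h2 : htBound b = 1 + ∑ i, |ht b i| := by unfold htBound; congr!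
  have : 0 ≤ ∑ i, |ht b i| := Finset.sum_nonneg fun i _ => abs_nonneg _
  lia

/-- A linear functional on functions on the weight lattice, which is a positive multiple of the
evaluation at a point of the fundamental alcove on affine functions. -/
def phi : (X → ℤ) →ₗ[ℤ] ℤ :=
  LinearMap.proj (twoRho b) + (htBound b - 1) • LinearMap.proj (0 : X)

lemma phi_apply (f : X → ℤ) : phi b f = f (twoRho b) + (htBound b - 1) * f 0 := rfl

lemma phi_aroot (i : ι) (k : ℤ) : phi b (aroot P i k) = ht b i + htBound b * k := by
  rw [phi_apply, aroot, aroot, ht]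
  simp; ring

lemma phi_const (c : ℤ) : phi b (fun _ => c) = htBound b * c := by
  rw [phi_apply]; ring

/-- On affine functions `phi b` is `htBound b` times the value at the rational point `twoRho b` /
`htBound b`. Heights are smaller than `htBound b` in absolute value, so k decides the sign and the
finite part only breaks the tie k = 0. -/
lemma phi_aroot_pos_iff (i : ι) (k : ℤ) :
    0 < phi b (aroot P i k) ↔ 0 < k ∨ k = 0 ∧ 0 < ht b i := by
  rw [phi_aroot]
  have h1 := abs_lt.mp (abs_ht_lt b i)
  have h2 := htBound_pos b
  rcases lt_trichotomy k 0 with hk | rfl | hk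
  · have : htBound b * k ≤ -htBound b := by nlinarith
    constructor
    · intro h; lia
    · intro h; lia
  · simp
  · have : htBound b ≤ htBound b * k := by nlinarith
    constructor
    · intro h; exact Or.inl hk
    · intro h; lia

variable [P.IsReduced]

lemma IsARoot.phi_ne_zero {f : X → ℤ} {t : ExtWeyl P} (h : IsARoot P f t) : phi b f ≠ 0 := by
  obtain ⟨i, k, rfl, rfl⟩ := h
  rw [phi_aroot]
  have h1 := abs_lt.mp (abs_ht_lt b i)
  have h2 := htBound_pos b
  rcases lt_trichotomy k 0 with hk | rfl | hk
  · have : htBound b * k ≤ -htBound b := by nlinarith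
    lia
  · simpa using ht_ne_zero b i
  · have : htBound b ≤ htBound b * k := by nlinarith
    lia

/-- `f` is a simple affine root, with reflection `s`. -/
def IsSimple (f : X → ℤ) (s : ExtWeyl P) : Prop :=
  (∃ i ∈ b.support, f = aroot P i 0 ∧ s = refl P i) ∨
  ∃ i, IsMaxCoroot b i ∧ f = -aroot P i (-1) ∧ s = transl P (P.root i) * refl P i

variable {b}

omit [Finite ι] [P.IsReduced] in
lemma transl_mul_refl_eq (i : ι) : transl P (P.root i) * refl P i = arefl P i (-1) := by
  simp [arefl]

omit [Finite ι] [P.IsReduced] in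
lemma IsSimple.isARoot {f : X → ℤ} {s : ExtWeyl P} (h : IsSimple b f s) : IsARoot P f s := by
  rcases h with ⟨i, -, rfl, rfl⟩ | ⟨i, -, rfl, rfl⟩
  · rw [refl_eq_arefl]
    exact isARoot_aroot i 0
  · rw [transl_mul_refl_eq]
    exact (isARoot_aroot i (-1)).neg

omit [Finite ι] [P.IsReduced] in
lemma mem_affRefl_iff {s : ExtWeyl P} : s ∈ affRefl b ↔ ∃ f, IsSimple b f s := by
  constructor
  · rintro (⟨i, hi, rfl⟩ | ⟨i, hi, rfl⟩)
    · exact ⟨_, Or.inl ⟨i, hi, rfl, rfl⟩⟩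
    · exact ⟨_, Or.inr ⟨i, hi, rfl, rfl⟩⟩
  · rintro ⟨f, ⟨i, hi, -, rfl⟩ | ⟨i, hi, -, rfl⟩⟩
    · exact Or.inl ⟨i, hi, rfl⟩
    · exact Or.inr ⟨i, hi, rfl⟩

lemma IsSimple.phi_pos {f : X → ℤ} {s : ExtWeyl P} (h : IsSimple b f s) : 0 < phi b f := by
  rcases h with ⟨i, hi, rfl, rfl⟩ | ⟨i, hi, rfl, rfl⟩
  · rw [phi_aroot_pos_iff, ← coroot_mem_iff]
    exact Or.inr ⟨rfl, AddSubmonoid.subset_closure ⟨i, hi, rfl⟩⟩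
  · rw [map_neg, phi_aroot]
    have h1 := abs_lt.mp (abs_ht_lt b i)
    lia

/-- The heart of the Coxeter structure: the only positive affine root made negative by a simple
reflection is its own. For the affine reflection this rests on `IsMaxCoroot.eq_of_two_le`. -/
lemma IsSimple.phi_act_pos {f f' : X → ℤ} {s t : ExtWeyl P} (h : IsSimple b f s)
    (h' : IsARoot P f' t) (hpos : 0 < phi b f') (hne : f' ≠ f) : 0 < phi b (act s f') := by
  obtain ⟨i, k, rfl, rfl⟩ := h'
  rcases h with ⟨j, hj, rfl, rfl⟩ | ⟨β, hβ, rfl, rfl⟩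
  · rw [phi_aroot_pos_iff] at hpos
    have h1 : act (refl P j) (aroot P i k) = aroot P (P.reflectionPerm j i) k := by
      rw [refl_eq_arefl, act_arefl]
      ext x
      simp only [aroot, coroot_reflectionPerm_eq, map_sub, map_zsmul, Pi.sub_apply, Pi.smul_apply,
        smul_eq_mul]
      ring
    rw [h1, phi_aroot_pos_iff]
    rcases hpos with hk | ⟨rfl, hk⟩
    · exact Or.inl hk
    · refine Or.inr ⟨rfl, ht_reflectionPerm_pos b hk hj ?_⟩
      rintro rfl
      exact hne rfl
  · rw [transl_mul_refl_eq]
    have h1 : act (arefl P β (-1)) (aroot P i k) =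
        aroot P (P.reflectionPerm β i) (k + P.pairing β i) := by
      rw [act_arefl]
      ext x
      simp only [aroot, coroot_reflectionPerm_eq, map_sub, map_zsmul, Pi.sub_apply, Pi.smul_apply,
        smul_eq_mul]
      ring
    rw [phi_aroot_pos_iff] at hpos
    rw [h1, phi_aroot_pos_iff]
    -- Passing to the opposite index n writes the root as k - α_n^∨, comparable with the simple root
    -- 1 - β^∨.
    obtain ⟨n, hn, -⟩ := exists_coroot_neg P i
    have hpn : P.pairing β n = -P.pairing β i := by
      rw [← P.root_coroot_eq_pairing, hn, map_neg, P.root_coroot_eq_pairing]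
    have htn : ht b n = -ht b i := by rw [ht, hn, map_neg, ht]
    have hhr : ht b (P.reflectionPerm β i) = ht b i - P.pairing β i * ht b β := by
      rw [ht, coroot_reflectionPerm_eq, map_sub, map_zsmul]; rfl
    by_cases hnβ : n = β
    -- The root is k - β^∨ with k ≥ 2, and its image is (k - 2) + β^∨.
    · subst hnβ
      rw [P.pairing_same] at hpn
      have hk1 : k ≠ 1 := by
        rintro rfl
        apply hne
        ext x
        simp [aroot, hn]; ring
      have hp := hβ.pos
      rw [hhr]
      have : P.pairing n i = -2 := by lia
      rw [this]
      rcases hpos with hk | ⟨rfl, hk⟩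
      · rcases eq_or_lt_of_le (show 2 ≤ k by lia) with rfl | h3
        · right; constructor
          · norm_num
          · lia
        · left; lia
      · lia
    -- The constant term drops by at most 1. If it drops from 1 to 0, the new finite part is β^∨ -
    -- α_n^∨, which is positive.
    · have hp1 : -1 ≤ P.pairing β i := by
        by_contra! hlt
        exact hnβ (hβ.eq_of_two_le (i := n) (by lia))
      rcases hpos with hk | ⟨rfl, hk⟩
      · by_cases h2 : 0 < k + P.pairing β i
        · exact Or.inl h2
        · have hk1 : k = 1 := by lia
          have hpi : P.pairing β i = -1 := by lia
          refine Or.inr ⟨by lia, ?_⟩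
          have h3 := hβ.sub_mem (i := n) (by lia)
          rcases eq_zero_or_twoRho_pos b h3 with h4 | h4
          · exact absurd (P.coroot.injective (sub_eq_zero.mp h4)).symm hnβ
          · rw [map_sub] at h4
            rw [hhr, hpi]
            simp only [ht] at *
            lia
      · have h3 := hβ.pairing_nonneg hk
        rcases eq_or_lt_of_le h3 with h4 | h4
        · right
          rw [hhr, ← h4]
          simpa using hk
        · left; lia

end Pos

end AffHecke

end

/-! ### Length as the number of affine inversions. -/

noncomputable section

namespace AffHecke

variable {ι X Y : Type*} [AddCommGroup X] [AddCommGroup Y]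
variable {P : RootPairing ι ℤ X Y} (b : P.Base)

section Inversions

variable [Finite ι]

/-- The positive affine roots `f` such that `x⁻¹ f` is negative. -/
def inv (x : ExtWeyl P) : Set (X → ℤ) :=
  {f | (∃ t, IsARoot P f t) ∧ 0 < phi b f ∧ phi b (act x⁻¹ f) < 0}

/-- The number of inversions. -/
def invCard (x : ExtWeyl P) : ℕ := (inv b x).ncard

/-- There are finitely many gradients, and for each one the two sign conditions confine the constant
term to an interval. -/
lemma inv_finite (x : ExtWeyl P) : (inv b x).Finite := by
  refine Set.Finite.subset (Set.finite_iUnion (ι := ι) (f := fun i => aroot P i ''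
    (Set.Icc 0 (P.toLinearMap (Multiplicative.toAdd (x⁻¹).left)
        (P.coroot (P.weylGroupToPerm (x⁻¹).right i))))) fun i => (Set.finite_Icc _ _).image _) ?_
  rintro f ⟨⟨t, i, k, rfl, rfl⟩, h1, h2⟩
  refine Set.mem_iUnion.mpr ⟨i, k, ⟨?_, ?_⟩, rfl⟩
  · rcases (phi_aroot_pos_iff b i k).mp h1 with h | h
    · exact h.le
    · exact h.1.ge
  · by_contra! h
    have h3 : 0 < phi b (act x⁻¹ (aroot P i k)) := by
      rw [act_aroot, phi_aroot_pos_iff]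
      left; lia
    lia

variable [P.IsReduced]

omit [P.IsReduced] in
lemma invCard_one : invCard b (1 : ExtWeyl P) = 0 := by
  rw [invCard, Set.ncard_eq_zero (inv_finite b 1), Set.eq_empty_iff_forall_notMem]
  rintro f ⟨-, h1, h2⟩
  rw [inv_one, act_one] at h2
  lia

omit [P.IsReduced] in
-- The map f ↦ -x⁻¹ f carries inversions of x to inversions of x⁻¹.
lemma invCard_inv (x : ExtWeyl P) : invCard b x⁻¹ = invCard b x := by
  suffices ∀ x : ExtWeyl P, invCard b x ≤ invCard b x⁻¹ from
    le_antisymm (by simpa using this x⁻¹) (this x)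
  intro x
  refine Set.ncard_le_ncard_of_injOn (fun f => -act x⁻¹ f) ?_ ?_ (inv_finite b _)
  · rintro f ⟨⟨t, ht⟩, h1, h2⟩
    refine ⟨⟨_, (ht.act x⁻¹).neg⟩, ?_, ?_⟩
    · rw [map_neg]; lia
    · rw [map_neg, map_neg, act_inv_act]; lia
  · intro f _ f' _ h
    exact act_injective x⁻¹ (neg_injective h)

variable {b}

lemma IsARoot.phi_neg_or_pos {f : X → ℤ} {t : ExtWeyl P} (h : IsARoot P f t) :
    phi b f < 0 ∨ 0 < phi b f := lt_or_gt_of_ne (h.phi_ne_zero b)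

/-- Inversions χ of t x inject into those of x other than f, by χ ↦ t χ if t χ is positive and χ ↦ χ
otherwise. In the second case χ = t χ + c f with c > 0, and x⁻¹ makes both summands negative. -/
lemma IsARoot.invCard_mul_lt {f : X → ℤ} {t : ExtWeyl P} (h : IsARoot P f t) (hf : 0 < phi b f)
    {x : ExtWeyl P} (hx : phi b (AffHecke.act x⁻¹ f) < 0) : invCard b (t * x) < invCard b x := by
  classical
  have hmem : f ∈ inv b x := ⟨⟨t, h⟩, hf, hx⟩
  refine lt_of_le_of_lt ?_ (Set.ncard_sdiff_singleton_lt_of_mem hmem (inv_finite b x))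
  have hact : ∀ χ, AffHecke.act (t * x)⁻¹ χ = AffHecke.act x⁻¹ (AffHecke.act t χ) := fun χ => by
    rw [mul_inv_rev, act_mul, h.inv_eq]
  refine Set.ncard_le_ncard_of_injOn
    (fun χ => if 0 < phi b (AffHecke.act t χ) then AffHecke.act t χ else χ) ?_ ?_
    ((inv_finite b x).subset Set.sdiff_subset)
  · rintro χ ⟨⟨r, hr⟩, h1, h2⟩
    rw [hact] at h2
    split_ifs with h3
    · refine ⟨⟨⟨_, hr.act t⟩, h3, h2⟩, ?_⟩
      rintro rfl
      have h5 := h.act_self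
      rw [h.act_act_self] at h5
      rw [h5, map_neg] at h1
      lia
    · have h3' : phi b (AffHecke.act t χ) < 0 :=
        ((hr.act t).phi_neg_or_pos).resolve_right h3
      obtain ⟨c, hc⟩ := h.exists_act_eq hr
      have h4 := h3'
      rw [hc, map_sub, map_zsmul, smul_eq_mul] at h4
      have hcpos : 0 < c := by
        by_contra! hc0
        nlinarith
      refine ⟨⟨⟨r, hr⟩, h1, ?_⟩, ?_⟩
      · have h5 : χ = AffHecke.act t χ + c • f := by rw [hc]; simp
        rw [h5, map_add, map_add, map_zsmul, map_zsmul, smul_eq_mul]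
        nlinarith
      · intro h6
        rw [Set.mem_singleton_iff] at h6
        rw [h6, h.act_self, map_neg, map_neg] at h2
        lia
  · rintro χ ⟨-, h1, -⟩ χ' ⟨-, h1', -⟩ heq
    dsimp only at heq
    split_ifs at heq with h3 h4 h4
    · exact act_injective t heq
    · rw [← heq, h.act_act_self] at h4
      exact absurd h1 h4
    · rw [heq, h.act_act_self] at h3
      exact absurd h1' h3
    · exact heq

/-- If x⁻¹ f is positive, the strict inequality applied to t x goes the other way. -/
lemma IsARoot.invCard_mul_lt_iff {f : X → ℤ} {t : ExtWeyl P} (h : IsARoot P f t)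
    (hf : 0 < phi b f) (x : ExtWeyl P) :
    invCard b (t * x) < invCard b x ↔ phi b (AffHecke.act x⁻¹ f) < 0 := by
  refine ⟨fun hlt => ?_, h.invCard_mul_lt hf⟩
  rcases (h.act x⁻¹).phi_neg_or_pos (b := b) with h1 | h1
  · exact h1
  · have h2 := h.invCard_mul_lt hf (x := t * x) (by
      rw [mul_inv_rev, act_mul, h.inv_eq, h.act_self, map_neg, map_neg]; lia)
    rw [← mul_assoc, h.mul_self, one_mul] at h2
    lia

/-- By `IsSimple.phi_act_pos`, f is the only possible inversion of s x that does not come from one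
of x. -/
lemma IsSimple.invCard_mul_le {f : X → ℤ} {s : ExtWeyl P} (h : IsSimple b f s)
    (x : ExtWeyl P) : invCard b (s * x) ≤ invCard b x + 1 := by
  have hsub : inv b (s * x) ⊆ insert f (act s '' inv b x) := by
    rintro χ ⟨⟨r, hr⟩, h1, h2⟩
    by_cases hχ : χ = f
    · exact Or.inl hχ
    · right
      rw [mul_inv_rev, act_mul, h.isARoot.inv_eq] at h2
      exact ⟨act s χ, ⟨⟨_, hr.act s⟩, h.phi_act_pos hr h1 hχ, h2⟩, h.isARoot.act_act_self χ⟩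
  refine (Set.ncard_le_ncard hsub (((inv_finite b x).image _).insert _)).trans ?_
  refine (Set.ncard_insert_le _ _).trans ?_
  exact Nat.add_le_add_right (Set.ncard_image_le (inv_finite b x)) 1

lemma IsSimple.invCard_mul {f : X → ℤ} {s : ExtWeyl P} (h : IsSimple b f s) (x : ExtWeyl P) :
    invCard b (s * x) = invCard b x + 1 ∨ invCard b (s * x) + 1 = invCard b x := by
  have h1 := h.invCard_mul_le x
  have h2 := h.invCard_mul_le (s * x)
  rw [← mul_assoc, h.isARoot.mul_self, one_mul] at h2
  have h3 : invCard b (s * x) ≠ invCard b x := by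
    intro heq
    have h4 := h.isARoot.invCard_mul_lt_iff h.phi_pos x
    have h5 := h.isARoot.invCard_mul_lt_iff h.phi_pos (s * x)
    rw [mul_inv_rev, act_mul, h.isARoot.inv_eq, h.isARoot.act_self, map_neg, map_neg,
      ← mul_assoc, h.isARoot.mul_self, one_mul] at h5
    rcases (h.isARoot.act x⁻¹).phi_neg_or_pos (b := b) with h6 | h6
    · have := h4.mpr h6; lia
    · have := h5.mpr (by lia); lia
  lia

lemma IsSimple.invCard_eq {f : X → ℤ} {s : ExtWeyl P} (h : IsSimple b f s) : invCard b s = 1 := by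
  have h1 := h.invCard_mul 1
  rw [mul_one, invCard_one] at h1
  lia

lemma IsSimple.eq_of_mem_inv {f f' : X → ℤ} {s t : ExtWeyl P} (h : IsSimple b f s)
    (h' : IsARoot P f' t) (hpos : 0 < phi b f') (hneg : phi b (act s f') < 0) : f' = f := by
  by_contra hne
  have := h.phi_act_pos h' hpos hne
  lia

/-- Positive affine roots are nonnegative combinations of simple ones and constants. For k > 0,
α_i^∨ + k = (1 - β^∨) + (β^∨ - α_n^∨) + (k - 1), where α_n^∨ = -α_i^∨ and β^∨ is a maximal coroot
above it. -/
lemma phi_act_pos_of_simple {g : ExtWeyl P}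
    (hg : ∀ f s, IsSimple b f s → 0 < phi b (act g f)) {f : X → ℤ} {t : ExtWeyl P}
    (h : IsARoot P f t) (hpos : 0 < phi b f) : 0 < phi b (act g f) := by
  have hcone : ∀ y ∈ corootCone b, 0 ≤ phi b (act g fun x => P.toLinearMap x y) := by
    intro y hy
    induction hy using AddSubmonoid.closure_induction with
    | mem y hy =>
      obtain ⟨j, hj, rfl⟩ := hy
      have := hg _ _ (Or.inl ⟨j, hj, rfl, rfl⟩)
      have h2 : (fun x => P.toLinearMap x (P.coroot j)) = aroot P j 0 := by
        ext x; simp [aroot]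
      rw [h2]
      exact this.le
    | zero =>
      have : (fun x => P.toLinearMap x (0 : Y)) = 0 := by ext x; simp
      rw [this, map_zero, map_zero]
    | add y z _ _ hy hz =>
      have : (fun x => P.toLinearMap x (y + z)) =
          (fun x => P.toLinearMap x y) + fun x => P.toLinearMap x z := by ext x; simp
      rw [this, map_add, map_add]
      exact add_nonneg hy hz
  obtain ⟨i, k, rfl, rfl⟩ := h
  rcases (phi_aroot_pos_iff b i k).mp hpos with hk | ⟨rfl, hk⟩
  · obtain ⟨n, hn, -⟩ := exists_coroot_neg P i
    obtain ⟨β, hβ, hβn⟩ := exists_isMaxCoroot_ge (b := b) n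
    have h1 : aroot P i k = -aroot P β (-1) +
        (fun x => P.toLinearMap x (P.coroot β - P.coroot n)) + (fun _ => k - 1) := by
      ext x
      simp [aroot, hn]; ring
    rw [h1, map_add, map_add, map_add, map_add, act_const, phi_const]
    have h2 := hg _ _ (Or.inr ⟨β, hβ, rfl, rfl⟩)
    have h3 := hcone _ hβn
    have h4 : 0 ≤ htBound b * (k - 1) := mul_nonneg (htBound_pos b).le (by lia)
    lia
  · have h1 := hcone _ ((coroot_mem_iff b i).mpr hk)
    have h2 : (fun x => P.toLinearMap x (P.coroot i)) = aroot P i 0 := by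
      ext x; simp [aroot]
    rw [h2] at h1
    have h3 := ((isARoot_aroot i 0).act g).phi_ne_zero b
    lia

lemma exists_simple_of_invCard_pos {x : ExtWeyl P} (hx : 0 < invCard b x) :
    ∃ f s, IsSimple b f s ∧ phi b (act x⁻¹ f) < 0 := by
  by_contra! h
  obtain ⟨f, ⟨t, ht⟩, h1, h2⟩ := (Set.ncard_pos (inv_finite b x)).mp hx
  have := phi_act_pos_of_simple (g := x⁻¹) (fun f s hs =>
    lt_of_le_of_ne (h f s hs) ((hs.isARoot.act x⁻¹).phi_ne_zero b).symm) ht h1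
  lia

lemma phi_act_inv_pos {g : ExtWeyl P} (hg : invCard b g = 0) {f : X → ℤ} {t : ExtWeyl P}
    (h : IsARoot P f t) (hpos : 0 < phi b f) : 0 < phi b (act g⁻¹ f) := by
  rcases (h.act g⁻¹).phi_neg_or_pos (b := b) with h1 | h1
  · rw [invCard, Set.ncard_eq_zero (inv_finite b g)] at hg
    exact absurd (show f ∈ inv b g from ⟨⟨t, h⟩, hpos, h1⟩) (by simp [hg])
  · exact h1

lemma invCard_mul_of_eq_zero {g : ExtWeyl P} (hg : invCard b g = 0) (x : ExtWeyl P) :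
    invCard b (g * x) = invCard b x := by
  have key : ∀ g : ExtWeyl P, invCard b g = 0 → ∀ x, invCard b (g * x) ≤ invCard b x := by
    intro g hg x
    refine Set.ncard_le_ncard_of_injOn (act g⁻¹) ?_ (act_injective _).injOn (inv_finite b x)
    rintro f ⟨⟨t, ht⟩, h1, h2⟩
    rw [mul_inv_rev, act_mul] at h2
    exact ⟨⟨_, ht.act g⁻¹⟩, phi_act_inv_pos hg ht h1, h2⟩
  refine le_antisymm (key g hg x) ?_
  have := key g⁻¹ (by rwa [invCard_inv]) (g * x)
  rwa [inv_mul_cancel_left] at this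

/-- The conjugate has a single inversion. Both g f and some simple affine root are inversions of it,
so g f is simple. -/
lemma conj_mem_affRefl {g : ExtWeyl P} (hg : invCard b g = 0) {s : ExtWeyl P}
    (hs : s ∈ affRefl b) : g * s * g⁻¹ ∈ affRefl b := by
  obtain ⟨f, hf⟩ := mem_affRefl_iff.mp hs
  have hr := hf.isARoot.act g
  have hg' : invCard b g⁻¹ = 0 := by rwa [invCard_inv]
  have hpos : 0 < phi b (act g f) := by
    simpa using phi_act_inv_pos hg' hf.isARoot hf.phi_pos
  have hcard : invCard b (g * s * g⁻¹) = 1 := by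
    rw [mul_assoc, invCard_mul_of_eq_zero hg, ← invCard_inv, mul_inv_rev, inv_inv,
      invCard_mul_of_eq_zero hg, invCard_inv, hf.invCard_eq]
  obtain ⟨f', s', hf', hneg⟩ := exists_simple_of_invCard_pos (b := b) (x := g * s * g⁻¹) (by lia)
  obtain ⟨a, ha⟩ := Set.ncard_eq_one.mp hcard
  have h1 : act g f ∈ inv b (g * s * g⁻¹) :=
    ⟨⟨_, hr⟩, hpos, by rw [hr.inv_eq, hr.act_self, map_neg]; lia⟩
  have h2 : f' ∈ inv b (g * s * g⁻¹) := ⟨⟨_, hf'.isARoot⟩, hf'.phi_pos, hneg⟩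
  rw [ha, Set.mem_singleton_iff] at h1 h2
  rw [h1, ← h2] at hr
  rw [hr.unique hf'.isARoot]
  exact mem_affRefl_iff.mpr ⟨f', hf'⟩

/-! ### The elements normalizing the Coxeter generators -/

/-- Were both pairings positive, each of the two values of `phi b` would exceed the other, since
each reflection keeps the other root positive. -/
lemma pairing_nonpos_of_simple {i j : ι} {k m : ℤ} (h : IsSimple b (aroot P i k) (arefl P i k))
    (h' : IsSimple b (aroot P j m) (arefl P j m)) (hne : aroot P i k ≠ aroot P j m) :
    P.pairing i j ≤ 0 := by
  by_contra! hp
  have hp' := (pairing_pos_comm P).mp hp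
  have h1 := h.phi_act_pos h'.isARoot h'.phi_pos hne.symm
  have h2 := h'.phi_act_pos h.isARoot h.phi_pos hne
  rw [act_arefl, map_sub, map_zsmul, smul_eq_mul] at h1 h2
  have h3 := h.phi_pos
  have h4 := h'.phi_pos
  nlinarith

/-- Conjugation fixes g f only up to sign. Showing that the sign is always positive is the content
of `invCard_eq_zero_of_mem_Gam`. -/
lemma exists_simple_act_eq {g : ExtWeyl P} (hg : g ∈ Gam b) {f : X → ℤ} {s : ExtWeyl P}
    (h : IsSimple b f s) : ∃ f', IsSimple b f' (g * s * g⁻¹) ∧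
      (0 < phi b (act g f) → act g f = f') ∧ (phi b (act g f) < 0 → act g f = -f') := by
  have hmem : g * s * g⁻¹ ∈ affRefl b := by
    have : g * s * g⁻¹ ∈ (fun s => g * s * g⁻¹) '' affRefl b := ⟨s, mem_affRefl_iff.mpr ⟨f, h⟩, rfl⟩
    rwa [show (fun s => g * s * g⁻¹) '' affRefl b = affRefl b from hg] at this
  obtain ⟨f', hf'⟩ := mem_affRefl_iff.mp hmem
  have hr := h.isARoot.act g
  refine ⟨f', hf', fun hpos => ?_, fun hneg => ?_⟩
  · exact hf'.eq_of_mem_inv hr hpos (by rw [hr.act_self, map_neg]; lia)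
  · rw [← neg_eq_iff_eq_neg]
    exact hf'.eq_of_mem_inv hr.neg (by rw [map_neg]; lia)
      (by rw [hr.neg.act_self, neg_neg]; exact hneg)

/-- Say g sends the two roots to -f and f', f and f' simple. Computing g s_i on the second root in
two ways gives f' + p f = f' - p' f, with p and p' the pairings before and after. Hence p + p' = 0,
while both are nonpositive. -/
lemma pairing_eq_zero_of_mem_Gam {g : ExtWeyl P} (hg : g ∈ Gam b) {i j : ι} {k m : ℤ}
    (h : IsSimple b (aroot P i k) (arefl P i k)) (h' : IsSimple b (aroot P j m) (arefl P j m))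
    (hneg : phi b (act g (aroot P i k)) < 0) (hpos : 0 < phi b (act g (aroot P j m))) :
    P.pairing i j = 0 := by
  obtain ⟨f, hf, -, h1⟩ := exists_simple_act_eq hg h
  obtain ⟨f', hf', h2, -⟩ := exists_simple_act_eq hg h'
  replace h1 := h1 hneg
  replace h2 := h2 hpos
  have hne : aroot P i k ≠ aroot P j m := by
    intro heq
    rw [heq] at hneg
    lia
  have e1 : act g (act (arefl P i k) (aroot P j m)) = f' + P.pairing i j • f := by
    rw [act_arefl, map_sub, map_zsmul, h1, h2]
    module
  have e2 : act g (act (arefl P i k) (aroot P j m)) = act (g * arefl P i k * g⁻¹) f' := by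
    rw [← h2, ← act_mul, ← act_mul, inv_mul_cancel_right]
  obtain ⟨i', k', rfl, hs⟩ := hf.isARoot
  obtain ⟨j', m', rfl, hs'⟩ := hf'.isARoot
  rw [hs] at hf
  rw [hs'] at hf'
  have hne' : aroot P i' k' ≠ aroot P j' m' := by
    intro heq
    rw [heq, ← h2, ← map_neg] at h1
    have h3 := act_injective g h1
    have h4 := h.phi_pos
    have h5 := h'.phi_pos
    rw [h3, map_neg] at h4
    lia
  have p1 := pairing_nonpos_of_simple h h' hne
  have p2 := pairing_nonpos_of_simple hf hf' hne'
  rw [e1, hs, act_arefl] at e2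
  have e3 : (P.pairing i j + P.pairing i' j') • aroot P i' k' = 0 := by
    rw [add_smul, ← sub_eq_zero.mpr e2]
    abel
  have e4 := congrArg (phi b) e3
  rw [map_zsmul, map_zero, smul_eq_mul] at e4
  have h6 := hf.phi_pos
  rcases mul_eq_zero.mp e4 with h7 | h7 <;> lia

/-- The part u of β^∨ supported on p is killed by every simple root, hence by `twoRho`. Since
`twoRho` is positive on each simple coroot and the coefficients are nonnegative, u has no terms.
This replaces the decomposition into irreducible components. -/
lemma coeff_eq_zero_of_orthogonal {β : ι} {c : ι → ℤ} (hc : ∀ j, 0 ≤ c j)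
    (hβ : P.coroot β = ∑ j ∈ b.support, c j • P.coroot j) (p : ι → Prop)
    (h1 : ∀ i ∈ b.support, ∀ j ∈ b.support, p i → ¬p j → P.pairing i j = 0 ∧ P.pairing j i = 0)
    (h2 : ∀ i ∈ b.support, p i → P.pairing i β = 0) :
    ∀ j ∈ b.support, p j → c j = 0 := by
  classical
  set u := ∑ j ∈ b.support with p j, c j • P.coroot j with hu
  set u' := ∑ j ∈ b.support with ¬p j, c j • P.coroot j with hu'
  have hsum : P.coroot β = u + u' := by
    rw [hβ, hu, hu', Finset.sum_filter_add_sum_filter_not]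
  have horth : ∀ i ∈ b.support, P.toLinearMap (P.root i) u = 0 := by
    intro i hi
    by_cases hpi : p i
    · have h3 := h2 i hi hpi
      rw [← P.root_coroot_eq_pairing, hsum, map_add] at h3
      have h4 : P.toLinearMap (P.root i) u' = 0 := by
        rw [hu', map_sum]
        refine Finset.sum_eq_zero fun j hj => ?_
        rw [Finset.mem_filter] at hj
        rw [map_zsmul, P.root_coroot_eq_pairing, (h1 i hi j hj.1 hpi hj.2).1, smul_zero]
      lia
    · rw [hu, map_sum]
      refine Finset.sum_eq_zero fun j hj => ?_
      rw [Finset.mem_filter] at hj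
      rw [map_zsmul, P.root_coroot_eq_pairing, (h1 j hj.1 i hi hj.2 hpi).2, smul_zero]
  have hroot : ∀ x ∈ Submodule.span ℤ (P.root '' (b.support : Set ι)), P.toLinearMap x u = 0 := by
    intro x hx
    induction hx using Submodule.span_induction with
    | mem x hx =>
      obtain ⟨i, hi, rfl⟩ := hx
      exact horth i hi
    | zero => simp
    | add x y _ _ hx hy => rw [map_add, LinearMap.add_apply, hx, hy, add_zero]
    | smul a x _ hx => rw [map_smul, LinearMap.smul_apply, hx, smul_zero]
  have hrho : P.toLinearMap (twoRho b) u = 0 := by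
    refine hroot _ (Submodule.sum_mem _ fun i _ => b.root_mem_span_int i)
  rw [hu, map_sum] at hrho
  intro j hj hpj
  have h3 := (Finset.sum_eq_zero_iff_of_nonneg (fun i hi => by
    rw [Finset.mem_filter] at hi
    rw [map_zsmul, twoRho_coroot b hi.1, smul_eq_mul]
    have := hc i; lia)).mp hrho j (by simpa using ⟨hj, hpj⟩)
  rw [map_zsmul, twoRho_coroot b hj, smul_eq_mul] at h3
  lia

omit [Finite ι] [P.IsReduced] in
lemma exists_coeff_of_mem_corootCone {y : Y} (hy : y ∈ corootCone b) :
    ∃ c : ι → ℤ, (∀ j, 0 ≤ c j) ∧ y = ∑ j ∈ b.support, c j • P.coroot j := by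
  classical
  induction hy using AddSubmonoid.closure_induction with
  | mem x hx =>
    obtain ⟨j, hj, rfl⟩ := hx
    refine ⟨fun i => if i = j then 1 else 0, fun i => by dsimp only; split_ifs <;> lia, ?_⟩
    rw [Finset.sum_eq_single_of_mem j hj (by intro i _ hij; simp [hij])]
    simp
  | zero => exact ⟨0, by simp, by simp⟩
  | add x y _ _ hx hy =>
    obtain ⟨c, hc, rfl⟩ := hx
    obtain ⟨d, hd, rfl⟩ := hy
    exact ⟨c + d, fun j => add_nonneg (hc j) (hd j), by simp [add_smul, Finset.sum_add_distrib]⟩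

/-- Simple affine roots whose sign g flips are orthogonal to those whose sign it keeps. If some 1 -
β^∨ is flipped, so is every simple root occurring in β^∨; but 1 = (1 - β^∨) + Σ c_j α_j^∨ is fixed
by g, a contradiction. If no 1 - β^∨ is flipped, a flipped α_j^∨ could not occur in a maximal coroot
above it. -/
lemma invCard_eq_zero_of_mem_Gam {g : ExtWeyl P} (hg : g ∈ Gam b) : invCard b g = 0 := by
  by_contra hN
  obtain ⟨f₀, s₀, hf₀, hneg₀⟩ := exists_simple_of_invCard_pos (b := b) (x := g⁻¹)
    (by rw [invCard_inv]; lia)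
  rw [inv_inv] at hneg₀
  have hsimp : ∀ i ∈ b.support, IsSimple b (aroot P i 0) (arefl P i 0) := fun i hi =>
    Or.inl ⟨i, hi, rfl, (refl_eq_arefl i).symm⟩
  have hzero : ∀ {i j : ι}, P.pairing i j = 0 → P.pairing j i = 0 := fun {i j} h =>
    P.pairing_eq_zero_iff'.mp h
  have hmax : ∀ β, IsMaxCoroot b β → ∃ n, IsSimple b (aroot P n 1) (arefl P n 1) ∧
      -aroot P β (-1) = aroot P n 1 ∧ ∀ j, P.pairing n j = -P.pairing β j := by
    intro β hβ
    obtain ⟨n, hn, hn'⟩ := exists_coroot_neg P β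
    have h1 : -aroot P β (-1) = aroot P n 1 := by ext x; simp [aroot, hn]; ring
    have h2 : IsSimple b (aroot P n 1) (transl P (P.root β) * refl P β) :=
      Or.inr ⟨β, hβ, h1.symm, rfl⟩
    refine ⟨n, ?_, h1, fun j => by
      rw [← P.root_coroot_eq_pairing, hn', map_neg, LinearMap.neg_apply, P.root_coroot_eq_pairing]⟩
    rwa [h2.isARoot.unique (isARoot_aroot n 1)] at h2
  have hor : ∀ {i j : ι}, i ∈ b.support → j ∈ b.support → phi b (act g (aroot P i 0)) < 0 →
      ¬phi b (act g (aroot P j 0)) < 0 → P.pairing i j = 0 := fun {i j} hi hj h1 h2 =>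
    pairing_eq_zero_of_mem_Gam hg (hsimp i hi) (hsimp j hj) h1
      (((hsimp j hj).isARoot.act g).phi_neg_or_pos.resolve_left h2)
  by_cases hall : ∃ β, IsMaxCoroot b β ∧ phi b (act g (-aroot P β (-1))) < 0
  · obtain ⟨β, hβ, hβneg⟩ := hall
    obtain ⟨n, hn, hn1, hn2⟩ := hmax β hβ
    obtain ⟨c, hc, hcβ⟩ := exists_coeff_of_mem_corootCone ((coroot_mem_iff b β).mpr hβ.pos)
    have h0 := coeff_eq_zero_of_orthogonal hc hcβ
      (fun j => ¬phi b (act g (aroot P j 0)) < 0) (fun i hi j hj h1 h2 => by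
        have := hor hj hi (not_not.mp h2) h1
        exact ⟨hzero this, this⟩) (fun i hi h1 => by
        have h2 := pairing_eq_zero_of_mem_Gam hg hn (hsimp i hi) (by rwa [← hn1])
          (((hsimp i hi).isARoot.act g).phi_neg_or_pos.resolve_left h1)
        rw [hn2, neg_eq_zero] at h2
        exact hzero h2)
    have hone : (fun _ => 1 : X → ℤ) = -aroot P β (-1) + ∑ j ∈ b.support, c j • aroot P j 0 := by
      ext x
      simp [aroot, hcβ]
    have h1 := congrArg (phi b) (act_const g 1)
    rw [phi_const] at h1
    nth_rewrite 1 [hone] at h1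
    rw [map_add, map_add, map_sum, map_sum] at h1
    have h2 : ∑ j ∈ b.support, phi b (act g (c j • aroot P j 0)) ≤ 0 := by
      refine Finset.sum_nonpos fun j hj => ?_
      rw [map_zsmul, map_zsmul, smul_eq_mul]
      by_cases h3 : phi b (act g (aroot P j 0)) < 0
      · exact mul_nonpos_of_nonneg_of_nonpos (hc j) h3.le
      · rw [h0 j hj h3, zero_mul]
    have h3 := htBound_pos b
    lia
  · push Not at hall
    rcases hf₀ with ⟨j₀, hj₀, rfl, rfl⟩ | ⟨β, hβ, rfl, rfl⟩
    · obtain ⟨β, hβ, hle⟩ := exists_isMaxCoroot_ge (b := b) j₀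
      classical
      obtain ⟨c, hc, hcβ⟩ := exists_coeff_of_mem_corootCone hle
      have hcβ' : P.coroot β = ∑ j ∈ b.support, (c + Pi.single j₀ 1 : ι → ℤ) j • P.coroot j := by
        simp only [Pi.add_apply, add_smul, Finset.sum_add_distrib]
        rw [← hcβ, Finset.sum_eq_single_of_mem j₀ hj₀ (by intro i _ hij; simp [hij])]
        simp
      obtain ⟨n, hn, hn1, hn2⟩ := hmax β hβ
      have hc' : ∀ j, 0 ≤ (c + Pi.single j₀ 1 : ι → ℤ) j := fun j =>
        add_nonneg (hc j) (by rw [Pi.single_apply]; split_ifs <;> lia)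
      have h0 := coeff_eq_zero_of_orthogonal hc' hcβ'
        (fun j => phi b (act g (aroot P j 0)) < 0) (fun i hi j hj h1 h2 => by
          have := hor hi hj h1 h2
          exact ⟨this, hzero this⟩) (fun i hi h1 => by
          have h2 := pairing_eq_zero_of_mem_Gam hg (hsimp i hi) hn h1 (by
            have h3 := (hn.isARoot.act g).phi_ne_zero b
            have h4 := hall β hβ
            rw [hn1] at h4
            lia)
          have h3 := hzero h2
          rw [hn2, neg_eq_zero] at h3
          exact hzero h3) j₀ hj₀ hneg₀
      have h1 := hc j₀
      simp at h0
      lia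
    · have := hall β hβ
      lia

lemma mem_Gam_iff {g : ExtWeyl P} : g ∈ Gam b ↔ invCard b g = 0 := by
  refine ⟨invCard_eq_zero_of_mem_Gam, fun h => ?_⟩
  apply Set.Subset.antisymm
  · rintro _ ⟨s, hs, rfl⟩
    exact conj_mem_affRefl h hs
  · intro s hs
    refine ⟨g⁻¹ * s * g, ?_, by group⟩
    simpa using conj_mem_affRefl (g := g⁻¹) (by rwa [invCard_inv]) hs

/-- Removing descents yields a word with `invCard` letters, and each letter of any word raises the
count by at most one. -/
lemma len_eq_invCard (x : ExtWeyl P) : len b x = invCard b x := by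
  have hword : ∀ n (x : ExtWeyl P), invCard b x = n → ∃ l : List (ExtWeyl P), l.length = n ∧
      (∀ s ∈ l, s ∈ affRefl b) ∧ ∃ g ∈ Gam b, x = l.prod * g := by
    intro n
    induction n with
    | zero => exact fun x hx => ⟨[], rfl, by simp, x, mem_Gam_iff.mpr hx, by simp⟩
    | succ n ih =>
      intro x hx
      obtain ⟨f, s, hs, hneg⟩ := exists_simple_of_invCard_pos (b := b) (x := x) (by lia)
      have h1 := hs.isARoot.invCard_mul_lt hs.phi_pos hneg
      have h2 := hs.invCard_mul x
      obtain ⟨l, hl, hl', g, hg, hx'⟩ := ih (s * x) (by lia)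
      refine ⟨s :: l, by simp [hl], ?_, g, hg, ?_⟩
      · simpa using ⟨mem_affRefl_iff.mpr ⟨f, hs⟩, hl'⟩
      · rw [List.prod_cons, mul_assoc, ← hx', ← mul_assoc, hs.isARoot.mul_self, one_mul]
  refine le_antisymm (Nat.sInf_le (hword _ x rfl)) (le_csInf ⟨_, hword _ x rfl⟩ ?_)
  rintro n ⟨l, rfl, hl, g, hg, rfl⟩
  induction l with
  | nil => simp [mem_Gam_iff.mp hg]
  | cons s l ih =>
    obtain ⟨f, hs⟩ := mem_affRefl_iff.mp (hl s (by simp))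
    have h1 := ih fun t ht => hl t (by simp [ht])
    have h2 := hs.invCard_mul_le (l.prod * g)
    rw [List.prod_cons, mul_assoc, List.length_cons]
    lia

end Inversions

end AffHecke

end

/-! ### Abstract Coxeter combinatorics from a length function. -/

namespace AffHecke

/-! ### Groups with a Coxeter-type length function -/

/-- The conjugates of the elements of `S`. -/
def IsReflIn {G : Type*} [Group G] (S : Set G) (t : G) : Prop := ∃ u, ∃ s ∈ S, t = u * s * u⁻¹

/-- The properties of the length function of an extended Coxeter group, that is, of a semidirect
product of a Coxeter group and a group of automorphisms of its Coxeter graph. -/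
structure IsExtCoxeter {G : Type*} [Group G] (S : Set G) (ℓ : G → ℕ) : Prop where
  sq : ∀ s ∈ S, s * s = 1
  len_one : ℓ 1 = 0
  len_inv : ∀ x, ℓ x⁻¹ = ℓ x
  len_mul : ∀ s ∈ S, ∀ x, ℓ (s * x) = ℓ x + 1 ∨ ℓ (s * x) + 1 = ℓ x
  exists_descent : ∀ x, 0 < ℓ x → ∃ s ∈ S, ℓ (s * x) < ℓ x
  len_zero_mul : ∀ g, ℓ g = 0 → ∀ x, ℓ (g * x) = ℓ x
  conj_mem : ∀ g, ℓ g = 0 → ∀ s ∈ S, g * s * g⁻¹ ∈ S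
  -- Here s * t * x is the conjugate reflection s t s⁻¹ applied to s x: apart from s itself, s
  -- conjugates the inversions of x to those of s x.
  reflect : ∀ s ∈ S, ∀ t, IsReflIn S t → t ≠ s → ∀ x, ℓ (t * x) < ℓ x ↔ ℓ (s * t * x) < ℓ (s * x)

namespace IsExtCoxeter

variable {G : Type*} [Group G] {S : Set G} {ℓ : G → ℕ} (h : IsExtCoxeter S ℓ)

include h

lemma mul_mul_self {s : G} (hs : s ∈ S) (x : G) : s * (s * x) = x := by
  rw [← mul_assoc, h.sq s hs, one_mul]

lemma mul_self_mul {s : G} (hs : s ∈ S) (x : G) : x * s * s = x := by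
  rw [mul_assoc, h.sq s hs, mul_one]

lemma inv_eq {s : G} (hs : s ∈ S) : s⁻¹ = s := inv_eq_of_mul_eq_one_right (h.sq s hs)

lemma len_simple {s : G} (hs : s ∈ S) : ℓ s = 1 := by
  have := h.len_mul s hs 1
  rw [mul_one, h.len_one] at this
  lia

lemma len_mul_right {s : G} (hs : s ∈ S) (x : G) :
    ℓ (x * s) = ℓ x + 1 ∨ ℓ (x * s) + 1 = ℓ x := by
  have := h.len_mul s hs x⁻¹
  rwa [← h.len_inv (s * x⁻¹), mul_inv_rev, inv_inv, h.inv_eq hs, h.len_inv] at this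

lemma len_mul_zero {g : G} (hg : ℓ g = 0) (x : G) : ℓ (x * g) = ℓ x := by
  rw [← h.len_inv, mul_inv_rev, h.len_zero_mul _ (by rwa [h.len_inv]), h.len_inv]

lemma even_len_mul (x y : G) : Even (ℓ (x * y) + ℓ x + ℓ y) := by
  induction hn : ℓ x using Nat.strong_induction_on generalizing x with
  | _ n ih =>
    rcases Nat.eq_zero_or_pos (ℓ x) with h0 | h0
    · rw [h.len_zero_mul x h0, ← hn, h0]
      simp
    · obtain ⟨s, hs, hlt⟩ := h.exists_descent x h0
      have h1 := ih _ (by lia) (s * x) rfl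
      rw [mul_assoc] at h1
      have h2 := h.len_mul s hs x
      have h3 := h.len_mul s hs (x * y)
      rw [Nat.even_iff] at *
      lia

lemma neg_one_pow_len_mul {R : Type*} [Ring R] (x y : G) :
    (-1 : R) ^ ℓ (x * y) = (-1) ^ ℓ x * (-1) ^ ℓ y := by
  have h1 := h.even_len_mul x y
  rw [← pow_add]
  rcases Nat.even_or_odd (ℓ (x * y)) with h2 | h2
  · rw [h2.neg_one_pow, Even.neg_one_pow]
    rw [Nat.even_iff] at *; lia
  · rw [h2.neg_one_pow, Odd.neg_one_pow]
    rw [Nat.even_iff] at h1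
    rw [Nat.odd_iff] at *; lia

lemma len_refl_mul_ne {t : G} (ht : IsReflIn S t) (x : G) : ℓ (t * x) ≠ ℓ x := by
  obtain ⟨u, s, hs, rfl⟩ := ht
  have h1 := h.even_len_mul (u * s * u⁻¹) x
  have h2 := h.even_len_mul (u * s) u⁻¹
  have h3 := h.even_len_mul u s
  rw [h.len_simple hs] at h3
  rw [h.len_inv] at h2
  rw [Nat.even_iff] at *
  lia

omit h in
lemma isReflIn_conj {t : G} (ht : IsReflIn S t) (y : G) : IsReflIn S (y * t * y⁻¹) := by
  obtain ⟨u, s, hs, rfl⟩ := ht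
  exact ⟨y * u, s, hs, by group⟩

omit h in
lemma isReflIn_conj' {t : G} (ht : IsReflIn S t) (y : G) : IsReflIn S (y⁻¹ * t * y) := by
  simpa using isReflIn_conj ht y⁻¹

omit h in
lemma isReflIn_simple {s : G} (hs : s ∈ S) : IsReflIn S s := ⟨1, s, hs, by simp⟩

/-- The inverting reflections of s y are the s-conjugates of those of y, with s toggled. This is the
one-letter case of the cocycle rule; the negated equivalence is an exclusive or. -/
lemma len_refl_simple_mul {s t : G} (hs : s ∈ S) (ht : IsReflIn S t) (y : G) :
    ℓ (t * (s * y)) < ℓ (s * y) ↔ ¬(t = s ↔ ℓ (s⁻¹ * t * s * y) < ℓ y) := by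
  by_cases hts : t = s
  · subst hts
    rw [h.mul_mul_self hs, inv_mul_cancel, one_mul]
    have := h.len_mul t hs y
    simp only [true_iff, not_lt]
    lia
  · rw [h.reflect s hs t ht hts, h.mul_mul_self hs, h.inv_eq hs]
    simp [hts, mul_assoc]

/-- The cocycle property of the inversion sets. -/
lemma len_refl_mul {t : G} (ht : IsReflIn S t) (y x : G) :
    ℓ (t * (y * x)) < ℓ (y * x) ↔ ¬(ℓ (t * y) < ℓ y ↔ ℓ (y⁻¹ * t * y * x) < ℓ x) := by
  induction hn : ℓ y using Nat.strong_induction_on generalizing y t with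
  | _ n ih =>
    rw [← hn]
    rcases Nat.eq_zero_or_pos (ℓ y) with h0 | h0
    · have h1 : t * (y * x) = y * (y⁻¹ * t * y * x) := by group
      rw [h1, h.len_zero_mul y h0, h.len_zero_mul y h0, h0]
      simp
    · obtain ⟨s, hs, hlt⟩ := h.exists_descent y h0
      obtain ⟨y', rfl⟩ : ∃ y', y = s * y' := ⟨s * y, (h.mul_mul_self hs y).symm⟩
      rw [h.mul_mul_self hs] at hlt
      have h1 := ih _ (by lia) (isReflIn_conj' ht s) y' rfl
      rw [mul_assoc, h.len_refl_simple_mul hs ht, h.len_refl_simple_mul hs ht]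
      rw [show (s * y')⁻¹ * t * (s * y') * x = y'⁻¹ * (s⁻¹ * t * s) * y' * x by group]
      rw [h1]
      tauto

/-- The strong exchange property. -/
lemma exchange {t : G} (ht : IsReflIn S t) (l : List G) (hl : ∀ s ∈ l, s ∈ S)
    (hlt : ℓ (t * l.prod) < ℓ l.prod) :
    ∃ l' : List G, l'.length + 1 = l.length ∧ (∀ s ∈ l', s ∈ l) ∧ t * l.prod = l'.prod := by
  induction l generalizing t with
  | nil => simp [h.len_one] at hlt
  | cons s l ih =>
    have hs := hl s (by simp)
    rw [List.prod_cons, h.len_refl_simple_mul hs ht] at hlt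
    by_cases hts : t = s
    · subst hts
      exact ⟨l, by simp, by simp +contextual, by rw [List.prod_cons, h.mul_mul_self hs]⟩
    · simp only [hts, false_iff, not_not] at hlt
      obtain ⟨l', h1, h2, h3⟩ := ih (isReflIn_conj' ht s) (fun s hs => hl s (by simp [hs])) hlt
      refine ⟨s :: l', by simp [h1], ?_, ?_⟩
      · intro r hr
        rcases List.mem_cons.mp hr with rfl | hr
        · simp
        · simp [h2 r hr]
      · rw [List.prod_cons, List.prod_cons, ← h3]
        group

/-! ### Parabolic subgroups -/

variable {I J : Set G} (hI : I ⊆ S) (hJ : J ⊆ S)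

include hI in
lemma exists_word {u : G} (hu : u ∈ Subgroup.closure I) :
    ∃ l : List G, (∀ s ∈ l, s ∈ I) ∧ l.prod = u := by
  induction hu using Subgroup.closure_induction with
  | mem s hs => exact ⟨[s], by simpa using hs, by simp⟩
  | one => exact ⟨[], by simp, rfl⟩
  | mul x y _ _ hx hy =>
    obtain ⟨l, hl, rfl⟩ := hx
    obtain ⟨m, hm, rfl⟩ := hy
    refine ⟨l ++ m, fun s hs => ?_, by simp⟩
    rcases List.mem_append.mp hs with h1 | h1
    · exact hl s h1
    · exact hm s h1
  | inv x _ hx =>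
    obtain ⟨l, hl, rfl⟩ := hx
    refine ⟨l.reverse, by simpa using hl, ?_⟩
    rw [List.prod_inv_reverse, List.map_congr_left fun s hs => h.inv_eq (hI (hl s hs)), List.map_id']

omit h in
lemma prod_mem_closure {l : List G} (hl : ∀ s ∈ l, s ∈ I) : l.prod ∈ Subgroup.closure I :=
  Subgroup.list_prod_mem _ fun s hs => Subgroup.subset_closure (hl s hs)

include hI in
-- Exchange shortens a nonreduced word without introducing new letters, so the length inside W_I
-- agrees with the ambient one.
lemma exists_reduced_word {u : G} (hu : u ∈ Subgroup.closure I) :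
    ∃ l : List G, (∀ s ∈ l, s ∈ I) ∧ l.prod = u ∧ l.length = ℓ u := by
  suffices ∀ n, ∀ l : List G, l.length = n → (∀ s ∈ l, s ∈ I) →
      ∃ l' : List G, (∀ s ∈ l', s ∈ I) ∧ l'.prod = l.prod ∧ l'.length = ℓ l.prod by
    obtain ⟨l, hl, rfl⟩ := h.exists_word hI hu
    exact this _ l rfl hl
  intro n
  induction n using Nat.strong_induction_on with
  | _ n ih =>
    rintro (_ | ⟨s, l⟩) hn hl
    · exact ⟨[], by simp, rfl, by simp [h.len_one]⟩
    · rw [List.length_cons] at hn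
      have hs := hl s (by simp)
      have hl' : ∀ r ∈ l, r ∈ I := fun r hr => hl r (by simp [hr])
      obtain ⟨m, hm, hml, hmlen⟩ := ih _ (by lia) l rfl hl'
      rcases h.len_mul s (hI hs) l.prod with h1 | h1
      · refine ⟨s :: m, ?_, by simp [hml], by simp [hmlen, h1]⟩
        simpa using ⟨hs, hm⟩
      · obtain ⟨m', hm', hsub, hprod⟩ := h.exchange (isReflIn_simple (hI hs)) m
          (fun r hr => hI (hm r hr)) (by rw [hml]; lia)
        refine ⟨m', fun r hr => hm r (hsub r hr), by rw [← hprod, hml, List.prod_cons], ?_⟩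
        rw [List.prod_cons]
        lia

include hI in
lemma eq_one_of_len_eq_zero {u : G} (hu : u ∈ Subgroup.closure I) (h0 : ℓ u = 0) : u = 1 := by
  obtain ⟨l, -, rfl, hl⟩ := h.exists_reduced_word hI hu
  rw [h0, List.length_eq_zero_iff] at hl
  simp [hl]

include hI in
lemma exists_descent_mem {u : G} (hu : u ∈ Subgroup.closure I) (h1 : u ≠ 1) :
    ∃ s ∈ I, ℓ (s * u) < ℓ u := by
  obtain ⟨l, hl, hprod, hlen⟩ := h.exists_reduced_word hI hu
  rcases l with _ | ⟨s, l⟩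
  · exact absurd hprod.symm h1
  · refine ⟨s, hl s (by simp), ?_⟩
    have hs := hI (hl s (by simp))
    have hle : ∀ l : List G, (∀ r ∈ l, r ∈ S) → ℓ l.prod ≤ l.length := by
      intro l hl
      induction l with
      | nil => simp [h.len_one]
      | cons r l ih =>
        have h2 := h.len_mul r (hl r (by simp)) l.prod
        have h3 := ih fun r hr => hl r (by simp [hr])
        rw [List.prod_cons, List.length_cons]
        lia
    have := hle l fun r hr => hI (hl r (by simp [hr]))
    rw [← hprod, List.prod_cons, h.mul_mul_self hs, ← List.prod_cons, hprod, ← hlen,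
      List.length_cons]
    lia

include hI in
lemma mem_closure_of_refl_mul {t u : G} (ht : IsReflIn S t) (hu : u ∈ Subgroup.closure I)
    (hlt : ℓ (t * u) < ℓ u) : t * u ∈ Subgroup.closure I := by
  obtain ⟨l, hl, rfl⟩ := h.exists_word hI hu
  obtain ⟨l', -, hsub, hprod⟩ := h.exchange ht l (fun s hs => hI (hl s hs)) hlt
  rw [hprod]
  exact prod_mem_closure fun s hs => hl s (hsub s hs)

include hI in
-- By the cocycle rule, s lowers u x exactly when it lowers u, because the conjugate u⁻¹ s u does
-- not lower x.
lemma len_mul_of_forall_not_lt {x : G}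
    (hx : ∀ t ∈ Subgroup.closure I, IsReflIn S t → ¬ℓ (t * x) < ℓ x) {u : G}
    (hu : u ∈ Subgroup.closure I) : ℓ (u * x) = ℓ u + ℓ x := by
  obtain ⟨l, hl, rfl⟩ := h.exists_word hI hu
  clear hu
  induction l with
  | nil => simp [h.len_one]
  | cons s l ih =>
    have hs := hl s (by simp)
    have hl' : ∀ r ∈ l, r ∈ I := fun r hr => hl r (by simp [hr])
    have h1 := ih hl'
    have hmem := prod_mem_closure hl'
    have h2 := h.len_refl_mul (isReflIn_simple (hI hs)) l.prod x
    have h3 := hx (l.prod⁻¹ * s * l.prod)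
      (mul_mem (mul_mem (inv_mem hmem) (Subgroup.subset_closure hs)) hmem)
      (isReflIn_conj' (isReflIn_simple (hI hs)) _)
    simp only [h3, iff_false, not_not] at h2
    have h4 := h.len_mul s (hI hs) l.prod
    have h5 := h.len_mul s (hI hs) (l.prod * x)
    rw [List.prod_cons, mul_assoc]
    lia

include hI in
-- Dual situation: every reflection of W_I lowers x, so s lowers u x exactly when it raises u.
lemma len_mul_of_forall_lt {x : G}
    (hx : ∀ t ∈ Subgroup.closure I, IsReflIn S t → ℓ (t * x) < ℓ x) {u : G}
    (hu : u ∈ Subgroup.closure I) : ℓ (u * x) + ℓ u = ℓ x := by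
  obtain ⟨l, hl, rfl⟩ := h.exists_word hI hu
  clear hu
  induction l with
  | nil => simp [h.len_one]
  | cons s l ih =>
    have hs := hl s (by simp)
    have hl' : ∀ r ∈ l, r ∈ I := fun r hr => hl r (by simp [hr])
    have h1 := ih hl'
    have hmem := prod_mem_closure hl'
    have h2 := h.len_refl_mul (isReflIn_simple (hI hs)) l.prod x
    have h3 := hx (l.prod⁻¹ * s * l.prod)
      (mul_mem (mul_mem (inv_mem hmem) (Subgroup.subset_closure hs)) hmem)
      (isReflIn_conj' (isReflIn_simple (hI hs)) _)
    simp only [h3, iff_true] at h2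
    have h4 := h.len_mul s (hI hs) l.prod
    have h5 := h.len_mul s (hI hs) (l.prod * x)
    rw [List.prod_cons, mul_assoc]
    lia

include hI in
-- Lengths add over a shortest element v x of the coset W_I x. If v ≠ 1, a first letter s of v⁻¹
-- would give s x shorter than x = v⁻¹ (v x).
lemma len_mul_of_min {x : G} (hx : ∀ s ∈ I, ℓ x < ℓ (s * x)) {u : G}
    (hu : u ∈ Subgroup.closure I) : ℓ (u * x) = ℓ u + ℓ x := by
  obtain ⟨v, hv, hmin⟩ := exists_minimalFor_of_wellFoundedLT (· ∈ Subgroup.closure I)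
    (fun v => ℓ (v * x)) ⟨1, one_mem _⟩
  have hmin' : ∀ u ∈ Subgroup.closure I, ℓ (v * x) ≤ ℓ (u * x) := fun u hu => by
    rcases le_total (ℓ (v * x)) (ℓ (u * x)) with h1 | h1
    · exact h1
    · exact hmin hu h1
  have hv' : ∀ t ∈ Subgroup.closure I, IsReflIn S t → ¬ℓ (t * (v * x)) < ℓ (v * x) :=
    fun t ht _ => by rw [not_lt, ← mul_assoc]; exact hmin' _ (mul_mem ht hv)
  have hadd := fun {u} (hu : u ∈ Subgroup.closure I) => h.len_mul_of_forall_not_lt hI hv' hu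
  have hv1 : v = 1 := by
    by_contra hne
    obtain ⟨s, hs, hlt⟩ := h.exists_descent_mem hI (inv_mem hv) (inv_ne_one.mpr hne)
    have h1 := hx s hs
    have h2 := hadd (inv_mem hv)
    have h3 := hadd (mul_mem (Subgroup.subset_closure hs) (inv_mem hv))
    rw [inv_mul_cancel_left] at h2
    rw [mul_assoc, inv_mul_cancel_left] at h3
    lia
  subst hv1
  simpa using hadd hu

/-- Otherwise x t x⁻¹ differs from s, so x t < x exactly when s x t < s x. The given inequalities
and the unit steps of length force x t > x and s x t < s x. -/
lemma mul_eq_mul_of_len {s t x : G} (hs : s ∈ S) (ht : t ∈ S) (h1 : ℓ x < ℓ (s * x))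
    (h2 : ℓ (s * x * t) < ℓ (x * t)) : s * x = x * t := by
  by_contra hne
  have hr : IsReflIn S (x * t * x⁻¹) := ⟨x, t, ht, rfl⟩
  have hrs : x * t * x⁻¹ ≠ s := by
    rintro rfl
    exact hne (by group)
  have h3 := h.reflect s hs _ hr hrs x
  rw [inv_mul_cancel_right, show s * (x * t * x⁻¹) * x = s * x * t by group] at h3
  have h4 := h.len_mul s hs x
  have h5 := h.len_mul s hs (x * t)
  rw [← mul_assoc] at h5
  have h6 := h.len_mul_right ht x
  have h7 := h.len_mul_right ht (s * x)
  lia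

include hI hJ in
/-- A reduction step of Deodhar's lemma, iterated. -/
lemma exists_mul_eq_mul_of_min {x : G} (hx : ∀ s ∈ I, ℓ x < ℓ (s * x)) {w : G}
    (hw : w ∈ Subgroup.closure J) : ∃ u ∈ Subgroup.closure I, ∃ w' ∈ Subgroup.closure J,
      x * w = u * (x * w') ∧ ∀ s ∈ I, ℓ (x * w') < ℓ (s * (x * w')) := by
  obtain ⟨l, hl, rfl⟩ := h.exists_word hJ hw
  clear hw
  induction l using List.reverseRecOn with
  | nil => exact ⟨1, one_mem _, 1, one_mem _, by simp, by simpa using hx⟩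
  | append_singleton l t ih =>
    obtain ⟨u, hu, w, hw, h1, h2⟩ := ih fun r hr => hl r (by simp [hr])
    have ht := hl t (by simp)
    rw [List.prod_append, List.prod_singleton, ← mul_assoc, h1]
    by_cases hm : ∀ s ∈ I, ℓ (x * w * t) < ℓ (s * (x * w * t))
    · exact ⟨u, hu, w * t, mul_mem hw (Subgroup.subset_closure ht), by group,
        by simpa [mul_assoc] using hm⟩
    · push Not at hm
      obtain ⟨s, hs, hle⟩ := hm
      have h3 := h.len_mul s (hI hs) (x * w * t)
      -- If appending t creates a left descent s in I, the letter t passes through as s and is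
      -- absorbed into u.
      have h4 := h.mul_eq_mul_of_len (hI hs) (hJ ht) (h2 s hs) (by
        rw [mul_assoc s]; lia)
      exact ⟨u * s, mul_mem hu (Subgroup.subset_closure hs), w, hw, by
        rw [mul_assoc u, ← h4]; group, h2⟩

include hI hJ in
-- Writing x w = v (x w') gives ℓ(u x w) = ℓ(u v) + ℓ(w') + ℓ(x). So local minimality on both sides
-- is global, and the minimal element is unique.
lemma eq_of_min_doubleCoset {x : G} (hx : ∀ s ∈ I, ℓ x < ℓ (s * x))
    (hx' : ∀ t ∈ J, ℓ x < ℓ (x * t)) {u w : G} (hu : u ∈ Subgroup.closure I)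
    (hw : w ∈ Subgroup.closure J) : ℓ x ≤ ℓ (u * x * w) ∧ (ℓ (u * x * w) ≤ ℓ x → u * x * w = x) := by
  obtain ⟨v, hv, w', hw', h1, h2⟩ := h.exists_mul_eq_mul_of_min hI hJ hx hw
  have h3 : ∀ {w}, w ∈ Subgroup.closure J → ℓ (x * w) = ℓ w + ℓ x := fun {w} hw => by
    have := h.len_mul_of_min hJ (x := x⁻¹) (fun s hs => by
      have := hx' s hs
      rw [h.len_inv, ← h.len_inv (s * x⁻¹)]
      simpa [h.inv_eq (hJ hs)] using this) (inv_mem hw)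
    rw [← h.len_inv (w⁻¹ * x⁻¹)] at this
    simpa [h.len_inv] using this
  have h4 := h.len_mul_of_min hI h2 (mul_mem hu hv)
  have h5 := h3 hw'
  rw [mul_assoc u v, ← h1, ← mul_assoc] at h4
  refine ⟨by lia, fun hle => ?_⟩
  have h6 := h.eq_one_of_len_eq_zero hI (mul_mem hu hv) (by lia)
  have h7 := h.eq_one_of_len_eq_zero hJ hw' (by lia)
  rw [mul_assoc, h1, h7, mul_one, ← mul_assoc, h6, one_mul]

include hI in
-- All reflections of W_I lower a longest w, hence ℓ(v) + ℓ(v w⁻¹) = ℓ(w) on W_I. A second longest v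
-- then has ℓ(v w⁻¹) = 0.
lemma existsUnique_longest (hbd : ∃ N, ∀ u ∈ Subgroup.closure I, ℓ u ≤ N) :
    ∃! w, w ∈ Subgroup.closure I ∧ ∀ u ∈ Subgroup.closure I, ℓ u ≤ ℓ w := by
  obtain ⟨N, hN⟩ := hbd
  obtain ⟨w, hw, hmax⟩ : ∃ w ∈ Subgroup.closure I, ∀ u ∈ Subgroup.closure I, ℓ u ≤ ℓ w := by
    obtain ⟨w, hw, hmin⟩ := exists_minimalFor_of_wellFoundedLT (· ∈ Subgroup.closure I)
      (fun v => N - ℓ v) ⟨1, one_mem _⟩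
    refine ⟨w, hw, fun u hu => ?_⟩
    by_contra! hlt
    have h1 := hmin hu (by dsimp only; lia)
    have h2 := hN u hu
    dsimp only at h1
    lia
  refine ⟨w, ⟨hw, hmax⟩, fun v ⟨hv, hv'⟩ => ?_⟩
  have h1 := h.len_mul_of_forall_lt hI (x := w) (fun t ht hr =>
    lt_of_le_of_ne (hmax _ (mul_mem ht hw)) (h.len_refl_mul_ne hr w)) (mul_mem hv (inv_mem hw))
  rw [inv_mul_cancel_right] at h1
  have h2 := hv' w hw
  exact mul_inv_eq_one.mp (h.eq_one_of_len_eq_zero hI (mul_mem hv (inv_mem hw)) (by lia))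

include hI hJ in
/-- Kilmoyer's theorem: the intersection of `W_I` and `z W_J z⁻¹`, for `z` minimal in its double
coset, is generated by the intersection of `I` and `z J z⁻¹`. -/
lemma mem_closure_inter {z : G} (hz : ∀ s ∈ I, ℓ z < ℓ (s * z)) (hz' : ∀ t ∈ J, ℓ z < ℓ (z * t))
    {u : G} (hu : u ∈ Subgroup.closure I) (hu' : z⁻¹ * u * z ∈ Subgroup.closure J) :
    u ∈ Subgroup.closure {s | s ∈ I ∧ z⁻¹ * s * z ∈ J} := by
  have hadd : ∀ {w}, w ∈ Subgroup.closure J → ℓ (z * w) = ℓ w + ℓ z := fun {w} hw => by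
    have := h.len_mul_of_min hJ (x := z⁻¹) (fun s hs => by
      have := hz' s hs
      rw [h.len_inv, ← h.len_inv (s * z⁻¹)]
      simpa [h.inv_eq (hJ hs)] using this) (inv_mem hw)
    rw [← h.len_inv (w⁻¹ * z⁻¹)] at this
    simpa [h.len_inv] using this
  induction hn : ℓ u using Nat.strong_induction_on generalizing u with
  | _ n ih =>
    by_cases h1 : u = 1
    · rw [h1]; exact one_mem _
    obtain ⟨s, hs, hlt⟩ := h.exists_descent_mem hI hu h1
    have h2 := h.len_mul_of_min hI hz hu
    have h3 := h.len_mul_of_min hI hz (mul_mem (Subgroup.subset_closure hs) hu)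
    -- Since s lowers u z but not z, the conjugate z⁻¹ s z lowers z⁻¹ u z, and exchange places it in
    -- W_J.
    have h4 := h.len_refl_mul (isReflIn_simple (hI hs)) z (z⁻¹ * u * z)
    rw [show z * (z⁻¹ * u * z) = u * z by group, ← mul_assoc] at h4
    have h5 : ℓ (z⁻¹ * s * z * (z⁻¹ * u * z)) < ℓ (z⁻¹ * u * z) := by
      by_contra hc
      have h6 := hz s hs
      have := h4.mp (by lia)
      apply this
      constructor
      · intro; lia
      · intro h7; exact absurd h7 hc
    have h6 := h.mem_closure_of_refl_mul hJ (isReflIn_conj' (isReflIn_simple (hI hs)) z) hu' h5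
    have h7 : z⁻¹ * s * z ∈ Subgroup.closure J := (Subgroup.mul_mem_cancel_right _ hu').mp h6
    -- Additivity over z now says that z⁻¹ s z has length one, so it is a letter of J.
    have h8 := hadd h7
    rw [show z * (z⁻¹ * s * z) = s * z by group] at h8
    have h9 := h.len_mul s (hI hs) z
    have h10 := hz s hs
    have h11 : z⁻¹ * s * z ≠ 1 := by
      intro hc
      rw [hc, h.len_one] at h8
      lia
    obtain ⟨t, ht, hlt'⟩ := h.exists_descent_mem hJ h7 h11
    have h12 := h.eq_one_of_len_eq_zero hJ (mul_mem (Subgroup.subset_closure ht) h7) (by lia)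
    have h13 : z⁻¹ * s * z = t := by
      rw [← h.inv_eq (hJ ht)]
      exact eq_inv_of_mul_eq_one_right h12
    have h14 : s ∈ Subgroup.closure {s | s ∈ I ∧ z⁻¹ * s * z ∈ J} :=
      Subgroup.subset_closure ⟨hs, h13 ▸ ht⟩
    have h15 := ih _ (by lia) (mul_mem (Subgroup.subset_closure hs) hu) (by
      rw [show z⁻¹ * (s * u) * z = z⁻¹ * s * z * (z⁻¹ * u * z) by group]
      exact h6) rfl
    exact (Subgroup.mul_mem_cancel_left _ h14).mp h15

lemma exists_mul_len_eq_zero (x : G) : ∃ u ∈ Subgroup.closure S, ∃ g, ℓ g = 0 ∧ x = u * g := by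
  induction hn : ℓ x using Nat.strong_induction_on generalizing x with
  | _ n ih =>
    rcases Nat.eq_zero_or_pos (ℓ x) with h0 | h0
    · exact ⟨1, one_mem _, x, h0, by simp⟩
    · obtain ⟨s, hs, hlt⟩ := h.exists_descent x h0
      obtain ⟨u, hu, g, hg, hx⟩ := ih _ (by lia) (s * x) rfl
      refine ⟨s * u, mul_mem (Subgroup.subset_closure hs) hu, g, hg, ?_⟩
      rw [mul_assoc, ← hx, h.mul_mul_self hs]

/-- A factor of length zero permutes S by conjugation and can be absorbed into the letter s. -/
lemma exists_conj_of_isReflIn {t : G} (ht : IsReflIn S t) :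
    ∃ u ∈ Subgroup.closure S, ∃ s ∈ S, t = u * s * u⁻¹ := by
  obtain ⟨x, s, hs, rfl⟩ := ht
  obtain ⟨u, hu, g, hg, rfl⟩ := h.exists_mul_len_eq_zero x
  exact ⟨u, hu, _, h.conj_mem g hg s hs, by group⟩

/-! ### The Bruhat order -/

omit [Group G] h in
lemma lt_of_transGen {r : G → G → Prop} (hr : ∀ y x, r y x → ℓ y < ℓ x) {y x : G}
    (hyx : Relation.TransGen r y x) : ℓ y < ℓ x := by
  induction hyx with
  | single h1 => exact hr _ _ h1
  | tail _ h1 ih => exact ih.trans (hr _ _ h1)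

/-- The lifting property of a single step of the Bruhat order. -/
lemma lifting {s t y : G} (hs : s ∈ S) (ht : IsReflIn S t) (hlt : ℓ y < ℓ (t * y)) :
    ℓ (s * y) < ℓ (s * (t * y)) ∨ s * y = t * y := by
  by_cases hts : t = s
  · exact Or.inr (by rw [hts])
  · left
    have h1 := h.reflect s hs t ht hts y
    have h2 : ¬ℓ (s * t * y) < ℓ (s * y) := fun h3 => by
      have := h1.mpr h3
      lia
    have h3 := h.len_refl_mul_ne (isReflIn_conj ht s) (s * y)
    rw [show s * t * s⁻¹ * (s * y) = s * t * y by group] at h3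
    rw [← mul_assoc]
    lia

end IsExtCoxeter

end AffHecke

/-! ### Bruhat order and the labelling of double cosets. -/

noncomputable section

namespace AffHecke

variable {ι X Y : Type*} [AddCommGroup X] [AddCommGroup Y]
variable {P : RootPairing ι ℤ X Y} (b : P.Base)

section Coxeter

variable [Finite ι] [P.IsReduced]

/-- The extended affine Weyl group is an extended Coxeter group. -/
theorem isExtCoxeter : IsExtCoxeter (affRefl b) (len b) where
  sq s hs := by
    obtain ⟨f, hf⟩ := mem_affRefl_iff.mp hs
    exact hf.isARoot.mul_self
  len_one := by rw [len_eq_invCard, invCard_one]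
  len_inv x := by rw [len_eq_invCard, len_eq_invCard, invCard_inv]
  len_mul s hs x := by
    obtain ⟨f, hf⟩ := mem_affRefl_iff.mp hs
    simpa only [len_eq_invCard] using hf.invCard_mul x
  exists_descent x hx := by
    rw [len_eq_invCard] at hx
    obtain ⟨f, s, hf, hneg⟩ := exists_simple_of_invCard_pos hx
    refine ⟨s, mem_affRefl_iff.mpr ⟨f, hf⟩, ?_⟩
    simpa only [len_eq_invCard] using hf.isARoot.invCard_mul_lt hf.phi_pos hneg
  len_zero_mul g hg x := by
    rw [len_eq_invCard] at *
    rw [len_eq_invCard, invCard_mul_of_eq_zero hg]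
  conj_mem g hg s hs := by
    rw [len_eq_invCard] at hg
    exact conj_mem_affRefl hg hs
  reflect := by
    rintro s hs t ⟨u, r, hr, ht⟩ hts x
    obtain ⟨f, hf⟩ := mem_affRefl_iff.mp hs
    obtain ⟨f₁, hf₁⟩ := mem_affRefl_iff.mp hr
    obtain ⟨f', hf', hpos⟩ : ∃ f', IsARoot P f' t ∧ 0 < phi b f' := by
      have h1 := hf₁.isARoot.act u
      rw [← ht] at h1
      rcases h1.phi_neg_or_pos (b := b) with h2 | h2
      · exact ⟨_, h1.neg, by rw [map_neg]; lia⟩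
      · exact ⟨_, h1, h2⟩
    have hne : f' ≠ f := by
      rintro rfl
      exact hts (hf'.unique hf.isARoot)
    have h1 := hf'.invCard_mul_lt_iff hpos x
    have h2 := (hf'.act s).invCard_mul_lt_iff (hf.phi_act_pos hf' hpos hne) (s * x)
    rw [mul_inv_rev, act_mul, act_inv_act, ← mul_assoc, inv_mul_cancel_right] at h2
    rw [len_eq_invCard, len_eq_invCard, len_eq_invCard, len_eq_invCard, h1, h2]

omit [Finite ι] [P.IsReduced] in
lemma affRefl_subset_affWeyl : affRefl b ⊆ affWeyl P := by
  have h1 : ∀ i, refl P i ∈ affWeyl P := fun i =>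
    Subgroup.subset_closure (Or.inl ⟨_, rfl⟩)
  rintro s (⟨i, -, rfl⟩ | ⟨i, -, rfl⟩)
  · exact h1 i
  · exact mul_mem (Subgroup.subset_closure (Or.inr ⟨i, rfl⟩)) (h1 i)

variable {b}

/-- Reconciles arbitrary conjugates with the affine Weyl conjugates used in `BruhatLT`. -/
lemma isReflIn_iff {t : ExtWeyl P} : IsReflIn (affRefl b) t ↔
    ∃ u ∈ affWeyl P, ∃ s ∈ affRefl b, t = u * s * u⁻¹ := by
  refine ⟨fun ht => ?_, fun ⟨u, _, s, hs, ht⟩ => ⟨u, s, hs, ht⟩⟩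
  obtain ⟨u, hu, s, hs, rfl⟩ := (isExtCoxeter b).exists_conj_of_isReflIn ht
  exact ⟨u, (Subgroup.closure_le _).mpr (affRefl_subset_affWeyl b) hu, s, hs, rfl⟩

lemma IsReflIn.mul_self {t : ExtWeyl P} (ht : IsReflIn (affRefl b) t) : t * t = 1 := by
  obtain ⟨u, s, hs, rfl⟩ := ht
  rw [show u * s * u⁻¹ * (u * s * u⁻¹) = u * (s * s) * u⁻¹ by group, (isExtCoxeter b).sq s hs]
  group

/-! ### The Bruhat order -/

omit [Finite ι] [P.IsReduced] in
lemma BruhatLT.len_lt {y x : ExtWeyl P} (h : BruhatLT b y x) : len b y < len b x :=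
  IsExtCoxeter.lt_of_transGen (fun _ _ h => h.2) h

omit [Finite ι] [P.IsReduced] in
lemma BruhatLT.trans {x y z : ExtWeyl P} (h : BruhatLT b x y) (h' : BruhatLT b y z) :
    BruhatLT b x z := Relation.TransGen.trans h h'

lemma bruhatLT_of_refl {t y : ExtWeyl P} (ht : IsReflIn (affRefl b) t)
    (hlt : len b y < len b (t * y)) : BruhatLT b y (t * y) := by
  obtain ⟨u, hu, s, hs, rfl⟩ := isReflIn_iff.mp ht
  exact Relation.TransGen.single ⟨⟨u, hu, s, hs, rfl⟩, hlt⟩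

omit [Finite ι] [P.IsReduced] in
lemma BruhatLT.induction {p : ExtWeyl P → ExtWeyl P → Prop}
    (step : ∀ y t, IsReflIn (affRefl b) t → len b y < len b (t * y) → p y (t * y))
    (trans : ∀ x y z, BruhatLT b x y → BruhatLT b y z → p x y → p y z → p x z)
    {y x : ExtWeyl P} (h : BruhatLT b y x) : p y x := by
  induction h using Relation.TransGen.trans_induction_on with
  | single h =>
    obtain ⟨⟨u, hu, s, hs, rfl⟩, hlt⟩ := h
    exact step _ _ ⟨u, s, hs, rfl⟩ hlt
  | trans h1 h2 ih1 ih2 => exact trans _ _ _ h1 h2 ih1 ih2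

/-- A Bruhat step by s itself yields s y = x instead of s y < s x; the three alternatives together
are stable under concatenation. -/
lemma BruhatLT.simple_mul_aux {s y x : ExtWeyl P} (hs : s ∈ affRefl b) (h : BruhatLT b y x) :
    BruhatLT b (s * y) (s * x) ∨ s * y = x ∨ BruhatLT b (s * y) x := by
  refine BruhatLT.induction (p := fun y x => BruhatLT b (s * y) (s * x) ∨ s * y = x ∨
    BruhatLT b (s * y) x) ?_ ?_ h
  · intro y t ht hlt
    rcases (isExtCoxeter b).lifting hs ht hlt with h1 | h1
    · left
      have h2 := bruhatLT_of_refl (y := s * y) (IsExtCoxeter.isReflIn_conj ht s)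
      rw [show s * t * s⁻¹ * (s * y) = s * (t * y) by group] at h2
      exact h2 h1
    · exact Or.inr (Or.inl h1)
  · intro x y z h1 h2 h3 h4
    rcases h3 with h3 | rfl | h3
    · rcases h4 with h4 | h4 | h4
      · exact Or.inl (h3.trans h4)
      · exact Or.inr (Or.inr (h4 ▸ h3))
      · exact Or.inr (Or.inr (h3.trans h4))
    · exact Or.inr (Or.inr h2)
    · exact Or.inr (Or.inr (h3.trans h2))

lemma bruhatLT_simple_mul {s x : ExtWeyl P} (hs : s ∈ affRefl b) (hx : len b x < len b (s * x)) :
    BruhatLT b x (s * x) := bruhatLT_of_refl (IsExtCoxeter.isReflIn_simple hs) hx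

lemma BruhatLT.simple_mul {s y x : ExtWeyl P} (hs : s ∈ affRefl b) (h : BruhatLT b y x)
    (hx : len b x < len b (s * x)) : BruhatLT b (s * y) (s * x) := by
  rcases h.simple_mul_aux hs with h1 | rfl | h1
  · exact h1
  · exact bruhatLT_simple_mul hs hx
  · exact h1.trans (bruhatLT_simple_mul hs hx)

lemma BruhatLT.inv {y x : ExtWeyl P} (h : BruhatLT b y x) : BruhatLT b y⁻¹ x⁻¹ := by
  refine BruhatLT.induction (p := fun y x => BruhatLT b y⁻¹ x⁻¹) ?_ ?_ h
  · intro y t ht hlt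
    have h1 := bruhatLT_of_refl (y := y⁻¹) (IsExtCoxeter.isReflIn_conj' ht y)
    have h2 : y⁻¹ * t * y * y⁻¹ = (t * y)⁻¹ := by
      rw [mul_inv_rev, inv_eq_of_mul_eq_one_right ht.mul_self]
      group
    rw [h2] at h1
    exact h1 (by rwa [(isExtCoxeter b).len_inv, (isExtCoxeter b).len_inv])
  · intro x y z _ _ h1 h2
    exact h1.trans h2

lemma BruhatLT.mem_para {I : Set (ExtWeyl P)} (hI : I ⊆ affRefl b) {y x : ExtWeyl P}
    (h : BruhatLT b y x) (hx : x ∈ para I) : y ∈ para I := by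
  revert hx
  refine BruhatLT.induction (p := fun y x => x ∈ para I → y ∈ para I) ?_ ?_ h
  · intro y t ht hlt hx
    have h1 : t * (t * y) = y := by rw [← mul_assoc, ht.mul_self, one_mul]
    have h2 := (isExtCoxeter b).mem_closure_of_refl_mul hI ht hx (by rwa [h1])
    rwa [h1] at h2
  · exact fun x y z _ _ h1 h2 hz => h1 (h2 hz)

end Coxeter

/-! ### Dominant weights -/

section Dominant

variable [Finite ι] [P.IsReduced] {b}

omit [Finite ι] [P.IsReduced] in
lemma act_inr_aroot (w : P.weylGroup) (i : ι) (k : ℤ) :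
    act (SemidirectProduct.inr w : ExtWeyl P) (aroot P i k) =
      aroot P (P.weylGroupToPerm w i) k := by
  rw [act_aroot]
  simp

/-- A finite Weyl element keeps constant terms, so it inverts only roots with constant term 0. This
bound makes `longest` exist. -/
lemma len_inr_le (w : P.weylGroup) : len b (SemidirectProduct.inr w : ExtWeyl P) ≤ Nat.card ι := by
  have := Fintype.ofFinite ι
  rw [len_eq_invCard, invCard]
  refine (Set.ncard_le_ncard (t := Set.range fun i => aroot P i 0) ?_ (Set.finite_range _)).trans ?_
  · rintro f ⟨⟨t, i, k, rfl, rfl⟩, h1, h2⟩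
    rw [← map_inv, act_inr_aroot] at h2
    have h3 : ¬ 0 < phi b (aroot P (P.weylGroupToPerm w⁻¹ i) k) := by lia
    rw [phi_aroot_pos_iff] at h1 h3
    have : k = 0 := by lia
    exact ⟨i, by rw [this]⟩
  · rw [← Set.image_univ, ← Set.ncard_univ]
    exact Set.ncard_image_le (Set.toFinite _)

omit [Finite ι] [P.IsReduced] in
lemma simpleRefl_subset : simpleRefl b ⊆ affRefl b := Set.subset_union_left

omit [Finite ι] [P.IsReduced] in
lemma para_le_finWeyl {I : Set (ExtWeyl P)} (hI : I ⊆ simpleRefl b) : para I ≤ finWeyl P := by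
  refine (Subgroup.closure_le _).mpr fun s hs => ?_
  obtain ⟨i, -, rfl⟩ := hI hs
  exact ⟨_, rfl⟩

lemma existsUnique_isLongest {I : Set (ExtWeyl P)} (hI : I ⊆ simpleRefl b) :
    ∃! w, IsLongest b I w := by
  refine (isExtCoxeter b).existsUnique_longest (hI.trans simpleRefl_subset)
    ⟨Nat.card ι, fun u hu => ?_⟩
  obtain ⟨w, rfl⟩ := para_le_finWeyl hI hu
  exact len_inr_le w

/-- Positivity of a root and of its coroot agree on simple roots, flip together under negation and
are preserved by the same simple reflections. -/
lemma isPos_iff_ht_pos (i : ι) : b.IsPos i ↔ 0 < ht b i := by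
  have hneg : ∀ j, (b.IsPos j ↔ 0 < ht b j) →
      (b.IsPos (P.reflectionPerm j j) ↔ 0 < ht b (P.reflectionPerm j j)) := by
    intro j hj
    have h1 : b.IsPos (P.reflectionPerm j j) ↔ ¬b.IsPos j :=
      RootPairing.Base.IsPos.neg_iff_not b j
    have h2 : ht b (P.reflectionPerm j j) = -ht b j := by
      rw [ht, coroot_reflectionPerm_eq, P.pairing_same, ht, map_sub, map_zsmul, smul_eq_mul]
      ring
    have h3 := ht_ne_zero b j
    rw [h1, h2, hj]
    lia
  have hsimp : ∀ j ∈ b.support, (b.IsPos j ↔ 0 < ht b j) := fun j hj => by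
    rw [ht, twoRho_coroot b hj]
    simpa using RootPairing.Base.isPos_of_mem_support hj
  refine b.induction_reflect i hneg hsimp ?_
  intro i j hi hj
  by_cases h1 : i = j
  · subst h1
    exact hneg i hi
  by_cases h2 : P.reflectionPerm j i = j
  · rw [h2]
    exact hsimp j hj
  have h3 : P.reflectionPerm j (P.reflectionPerm j i) = i := P.reflectionPerm_self j i
  constructor
  · intro h4
    have h5 := h4.reflectionPerm hj h2
    rw [h3] at h5
    exact ht_reflectionPerm_pos b (hi.mp h5) hj h1
  · intro h4
    have h5 := ht_reflectionPerm_pos b h4 hj h2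
    rw [h3] at h5
    exact (hi.mpr h5).reflectionPerm hj h1

lemma root_mem_of_ht_pos {i : ι} (hi : 0 < ht b i) : P.root i ∈ corootCone b.flip := by
  have := isReduced_flip P
  have h1 := (isPos_iff_ht_pos i).mpr hi
  rw [RootPairing.Base.isPos_iff] at h1
  refine (coroot_mem_iff b.flip i).mpr ?_
  have h2 := ht_eq_height b.flip i
  have h3 : b.flip.flip.height i = b.height i := rfl
  rw [h3] at h2
  lia

omit [Finite ι] [P.IsReduced] in
lemma pt_inr (w : P.weylGroup) (x : X) : pt (SemidirectProduct.inr w : ExtWeyl P) x = w • x := by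
  simp [pt]

/-- A weight that is dominant for the simple reflections in `K` is the largest one in its orbit
under the group generated by `K`. -/
lemma sub_pt_mem {K : Set (ExtWeyl P)} (hK : K ⊆ simpleRefl b) {lam : X}
    (hlam : ∀ i ∈ b.support, refl P i ∈ K → 0 ≤ P.toLinearMap lam (P.coroot i)) {u : ExtWeyl P}
    (hu : u ∈ Subgroup.closure K) : lam - pt u lam ∈ corootCone b.flip := by
  have hE := isExtCoxeter b
  induction hn : len b u using Nat.strong_induction_on generalizing u with
  | _ n ih =>
    by_cases h1 : u = 1
    · simp [h1]
    obtain ⟨s, hs, hlt⟩ := hE.exists_descent_mem (hK.trans simpleRefl_subset) (inv_mem hu)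
      (inv_ne_one.mpr h1)
    have hsS := simpleRefl_subset (hK hs)
    obtain ⟨i, hi, rfl⟩ := hK hs
    obtain ⟨u', rfl⟩ : ∃ u', u = u' * refl P i := ⟨u * refl P i, by rw [hE.mul_self_mul hsS]⟩
    have hu' : u' ∈ Subgroup.closure K :=
      (Subgroup.mul_mem_cancel_right _ (Subgroup.subset_closure hs)).mp hu
    rw [mul_inv_rev, hE.inv_eq hsS, hE.mul_mul_self hsS] at hlt
    have h2 := ih _ (by
      rw [← hn, ← hE.len_inv u', ← hE.len_inv (u' * _), mul_inv_rev, hE.inv_eq hsS]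
      exact hlt) hu' rfl
    have hsimp : IsSimple b (aroot P i 0) (refl P i) := Or.inl ⟨i, hi, rfl, rfl⟩
    -- With u = u' s_i longer than u', the root u' α_i is positive, and u λ = u' λ - ⟨λ, α_i^∨⟩ u'
    -- α_i only goes down.
    have h3 : 0 < phi b (act u' (aroot P i 0)) := by
      rcases (hsimp.isARoot.act u').phi_neg_or_pos (b := b) with h4 | h4
      · rw [len_eq_invCard, len_eq_invCard] at hlt
        have := (hsimp.isARoot.invCard_mul_lt_iff hsimp.phi_pos u'⁻¹).mpr (by rwa [inv_inv])
        lia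
      · exact h4
    obtain ⟨w, rfl⟩ := para_le_finWeyl hK hu'
    rw [act_inr_aroot, phi_aroot_pos_iff] at h3
    have h4 := root_mem_of_ht_pos (b := b) (h3.resolve_left (by lia)).2
    have h5 : lam - pt (SemidirectProduct.inr w * refl P i : ExtWeyl P) lam =
        (lam - pt (SemidirectProduct.inr w : ExtWeyl P) lam) +
          (P.toLinearMap lam (P.coroot i)).toNat • P.root (P.weylGroupToPerm w i) := by
      rw [pt_mul, pt_refl, reflection_zsmul_sub, pt_inr, pt_inr, smul_sub, smul_comm,
        ← natCast_zsmul, Int.toNat_of_nonneg (hlam i hi hs), P.weylGroup_apply_root]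
      abel
    rw [h5]
    exact add_mem h2 (nsmul_mem h4 _)

/-- Maximize the pairing of u λ with the sum of the positive coroots. It is bounded because the Weyl
group permutes the coroots, and a negative ⟨u λ, α_i^∨⟩ would let s_i increase it. -/
lemma exists_dominant {K : Set (ExtWeyl P)} (hK : K ⊆ simpleRefl b) (lam : X) :
    ∃ u ∈ Subgroup.closure K, ∀ i ∈ b.support, refl P i ∈ K →
      0 ≤ P.toLinearMap (pt u lam) (P.coroot i) := by
  have := Fintype.ofFinite ι
  have := isReduced_flip P
  have hbd : ∀ u ∈ Subgroup.closure K, P.toLinearMap (pt u lam) (twoRho b.flip) ≤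
      ∑ i, |P.toLinearMap lam (P.coroot i)| := by
    intro u hu
    obtain ⟨w, rfl⟩ := para_le_finWeyl hK hu
    classical
    have h1 : ∃ s : Finset ι, twoRho b.flip = ∑ i ∈ s, P.coroot i := ⟨_, rfl⟩
    obtain ⟨s, hs⟩ := h1
    rw [hs, map_sum, ← Equiv.sum_comp (P.weylGroupToPerm w⁻¹)]
    calc _ ≤ ∑ i ∈ s, |P.toLinearMap (pt (SemidirectProduct.inr w : ExtWeyl P) lam) (P.coroot i)| :=
          Finset.sum_le_sum fun i _ => le_abs_self _
      _ ≤ ∑ i, |P.toLinearMap (pt (SemidirectProduct.inr w : ExtWeyl P) lam) (P.coroot i)| :=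
          Finset.sum_le_sum_of_subset_of_nonneg (Finset.subset_univ s)
            fun i _ _ => abs_nonneg _
      _ = _ := by
          refine Finset.sum_congr rfl fun i _ => ?_
          rw [← weylGroup_smul_coroot w⁻¹ (pt _ lam) i, pt_inr, inv_smul_smul]
  obtain ⟨u, hu, hmin⟩ := exists_minimalFor_of_wellFoundedLT (· ∈ Subgroup.closure K)
    (fun u => (∑ i, |P.toLinearMap lam (P.coroot i)| -
      P.toLinearMap (pt u lam) (twoRho b.flip)).toNat) ⟨1, one_mem _⟩
  refine ⟨u, hu, fun i hi hiK => ?_⟩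
  by_contra! hneg
  have hmem := mul_mem (Subgroup.subset_closure hiK) hu
  have h1 := hbd u hu
  have h2 := hbd _ hmem
  have h3 : P.toLinearMap (pt (refl P i * u) lam) (twoRho b.flip) =
      P.toLinearMap (pt u lam) (twoRho b.flip) - P.toLinearMap (pt u lam) (P.coroot i) * 2 := by
    have h4 : P.toLinearMap (P.root i) (twoRho b.flip) = 2 := twoRho_coroot b.flip hi
    rw [pt_mul, pt_refl, reflection_zsmul_sub, map_sub, LinearMap.sub_apply, map_zsmul,
      LinearMap.smul_apply, h4, smul_eq_mul]
  have h4 := hmin hmem (by dsimp only; lia)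
  dsimp only at h4
  lia

end Dominant

/-! ### Double cosets -/

section DoubleCosets

variable [Finite ι] [P.IsReduced] {b} {I J : Set (ExtWeyl P)}

lemma IsMinIn.left {x m : ExtWeyl P} (hI : I ⊆ simpleRefl b) (h : IsMinIn b I J x m)
    {s : ExtWeyl P} (hs : s ∈ I) : len b m < len b (s * m) := by
  obtain ⟨⟨u, hu, w, hw, rfl⟩, hmin⟩ := h
  have h1 := hmin (s * u) (mul_mem (Subgroup.subset_closure hs) hu) w hw
  have h2 := (isExtCoxeter b).len_mul s (simpleRefl_subset (hI hs)) (u * x * w)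
  rw [show s * u * x * w = s * (u * x * w) by group] at h1
  lia

lemma IsMinIn.right {x m : ExtWeyl P} (hJ : J ⊆ simpleRefl b) (h : IsMinIn b I J x m)
    {t : ExtWeyl P} (ht : t ∈ J) : len b m < len b (m * t) := by
  obtain ⟨⟨u, hu, w, hw, rfl⟩, hmin⟩ := h
  have h1 := hmin u hu (w * t) (mul_mem hw (Subgroup.subset_closure ht))
  have h2 := (isExtCoxeter b).len_mul_right (simpleRefl_subset (hJ ht)) (u * x * w)
  rw [show u * x * (w * t) = u * x * w * t by group] at h1
  lia

lemma eq_of_min {x u w : ExtWeyl P} (hI : I ⊆ simpleRefl b) (hJ : J ⊆ simpleRefl b)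
    (hx : ∀ s ∈ I, len b x < len b (s * x)) (hx' : ∀ t ∈ J, len b x < len b (x * t))
    (hu : u ∈ para I) (hw : w ∈ para J) : len b x ≤ len b (u * x * w) ∧
      (len b (u * x * w) ≤ len b x → u * x * w = x) :=
  (isExtCoxeter b).eq_of_min_doubleCoset (hI.trans simpleRefl_subset)
    (hJ.trans simpleRefl_subset) hx hx' hu hw

lemma existsUnique_isMinIn (hI : I ⊆ simpleRefl b) (hJ : J ⊆ simpleRefl b) (x : ExtWeyl P) :
    ∃! m, IsMinIn b I J x m := by
  obtain ⟨m, ⟨u, hu, w, hw, rfl⟩, hmin⟩ := exists_minimalFor_of_wellFoundedLT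
    (fun m => ∃ u ∈ para I, ∃ w ∈ para J, m = u * x * w) (len b) ⟨x, 1, one_mem _, 1, one_mem _,
      by simp⟩
  have hm : IsMinIn b I J x (u * x * w) := by
    refine ⟨⟨u, hu, w, hw, rfl⟩, fun u' hu' w' hw' => ?_⟩
    rcases le_total (len b (u * x * w)) (len b (u' * x * w')) with h1 | h1
    · exact h1
    · exact hmin ⟨u', hu', w', hw', rfl⟩ h1
  refine ⟨_, hm, fun m' hm' => ?_⟩
  obtain ⟨u', hu', w', hw', rfl⟩ := hm'.1
  have h1 := (eq_of_min hI hJ (fun s hs => hm.left hI hs) (fun t ht => hm.right hJ ht)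
    (mul_mem hu' (inv_mem hu)) (mul_mem (inv_mem hw) hw')).2
  rw [show u' * u⁻¹ * (u * x * w) * (w⁻¹ * w') = u' * x * w' by group] at h1
  exact h1 (hm'.2 u hu w hw)

lemma isMinIn_minElt (hI : I ⊆ simpleRefl b) (hJ : J ⊆ simpleRefl b) (p : Idx b I J) :
    IsMinIn b I J (transl P p.1.1 * p.1.2) (minElt b I J p) :=
  Classical.epsilon_spec (existsUnique_isMinIn hI hJ _).exists

omit [Finite ι] [P.IsReduced] in
lemma mul_transl {u : ExtWeyl P} (hu : u ∈ finWeyl P) (lam : X) :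
    u * transl P lam = transl P (pt u lam) * u := by
  obtain ⟨w, rfl⟩ := hu
  refine pt_injective fun x => ?_
  rw [pt_mul, pt_mul, pt_transl, pt_transl, pt_inr, pt_inr, pt_inr, smul_add]

omit [Finite ι] [P.IsReduced] in
lemma transl_mul_injective {g g' : ExtWeyl P} (hg : g ∈ finWeyl P) (hg' : g' ∈ finWeyl P)
    {lam lam' : X} (h : transl P lam * g = transl P lam' * g') : lam = lam' ∧ g = g' := by
  have h1 : lam = lam' := by
    obtain ⟨w, rfl⟩ := hg
    obtain ⟨w', rfl⟩ := hg'
    have := congrArg (fun g => pt g 0) h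
    simpa [pt_mul, pt_inr] using this
  subst h1
  exact ⟨rfl, mul_left_cancel h⟩

omit [Finite ι] [P.IsReduced] in
lemma exists_eq_transl_mul (x : ExtWeyl P) : ∃ lam, ∃ g ∈ finWeyl P, x = transl P lam * g :=
  ⟨Multiplicative.toAdd x.left, SemidirectProduct.inr x.right, ⟨_, rfl⟩,
    (SemidirectProduct.inl_left_mul_inr_right x).symm⟩

omit [Finite ι] [P.IsReduced] in
lemma closure_inter_le {z : ExtWeyl P} {u : ExtWeyl P}
    (hu : u ∈ Subgroup.closure {s | s ∈ I ∧ z⁻¹ * s * z ∈ J}) :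
    u ∈ para I ∧ z⁻¹ * u * z ∈ para J := by
  induction hu using Subgroup.closure_induction with
  | mem s hs => exact ⟨Subgroup.subset_closure hs.1, Subgroup.subset_closure hs.2⟩
  | one => exact ⟨one_mem _, by simp [one_mem]⟩
  | mul x y _ _ hx hy =>
    refine ⟨mul_mem hx.1 hy.1, ?_⟩
    rw [show z⁻¹ * (x * y) * z = z⁻¹ * x * z * (z⁻¹ * y * z) by group]
    exact mul_mem hx.2 hy.2
  | inv x _ hx =>
    refine ⟨inv_mem hx.1, ?_⟩
    rw [show z⁻¹ * x⁻¹ * z = (z⁻¹ * x * z)⁻¹ by group]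
    exact inv_mem hx.2

/-- With x = t_λ g, shrink g to the minimal z = u g w. Then make u λ dominant by some v generated by
I ∩ z J z⁻¹; v passes through z into W_J, so z is unchanged. -/
lemma exists_eq_minElt (hI : I ⊆ simpleRefl b) (hJ : J ⊆ simpleRefl b) {x : ExtWeyl P}
    (hx : ∀ s ∈ I, len b x < len b (s * x)) (hx' : ∀ t ∈ J, len b x < len b (x * t)) :
    ∃ p : Idx b I J, x = minElt b I J p := by
  obtain ⟨lam, g, hg, rfl⟩ := exists_eq_transl_mul x
  obtain ⟨z, hz, -⟩ := existsUnique_isMinIn hI hJ g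
  obtain ⟨⟨u, hu, w, hw, rfl⟩, hmin⟩ := hz
  set z := u * g * w with hzdef
  have huW := para_le_finWeyl hI hu
  have hwW := para_le_finWeyl hJ hw
  have hzW : z ∈ finWeyl P := mul_mem (mul_mem huW hg) hwW
  have hzmin : z ∈ minReps b I J := by
    refine ⟨hzW, fun u' hu' w' hw' => ?_⟩
    have := hmin (u' * u) (mul_mem hu' hu) (w * w') (mul_mem hw hw')
    rwa [show u' * u * g * (w * w') = u' * z * w' by rw [hzdef]; group] at this
  obtain ⟨v, hv, hdom⟩ := exists_dominant (b := b)
    (K := {s | s ∈ I ∧ z⁻¹ * s * z ∈ J}) (fun s hs => hI hs.1) (pt u lam)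
  obtain ⟨hvI, hvJ⟩ := closure_inter_le hv
  have hvW := para_le_finWeyl hI hvI
  let p : Idx b I J := ⟨(pt v (pt u lam), z), hzmin, fun i hi h1 h2 => hdom i hi ⟨h1, h2⟩⟩
  refine ⟨p, ?_⟩
  have heq : transl P (pt v (pt u lam)) * z =
      v * u * (transl P lam * g) * (w * (z⁻¹ * v * z)⁻¹) := by
    rw [← pt_mul, ← mul_assoc (v * u), mul_transl (mul_mem hvW huW), hzdef]
    group
  refine (existsUnique_isMinIn hI hJ (transl P p.1.1 * p.1.2)).unique ?_
    (isMinIn_minElt hI hJ p)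
  change IsMinIn b I J (transl P (pt v (pt u lam)) * z) _
  rw [heq]
  refine ⟨⟨(v * u)⁻¹, inv_mem (mul_mem hvI hu), (w * (z⁻¹ * v * z)⁻¹)⁻¹,
    inv_mem (mul_mem hw (inv_mem hvJ)), by group⟩, fun u' hu' w' hw' => ?_⟩
  have := (eq_of_min hI hJ hx hx' (mul_mem hu' (mul_mem hvI hu))
    (mul_mem (mul_mem hw (inv_mem hvJ)) hw')).1
  rwa [show u' * (v * u * (transl P lam * g) * (w * (z⁻¹ * v * z)⁻¹)) * w' =
    u' * (v * u) * (transl P lam * g) * (w * (z⁻¹ * v * z)⁻¹ * w') by group]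

lemma minReps_left (hI : I ⊆ simpleRefl b) {z : ExtWeyl P} (hz : z ∈ minReps b I J)
    {s : ExtWeyl P} (hs : s ∈ I) : len b z < len b (s * z) := by
  have h1 := hz.2 s (Subgroup.subset_closure hs) 1 (one_mem _)
  have h2 := (isExtCoxeter b).len_mul s (simpleRefl_subset (hI hs)) z
  rw [mul_one] at h1
  lia

lemma minReps_right (hJ : J ⊆ simpleRefl b) {z : ExtWeyl P} (hz : z ∈ minReps b I J)
    {t : ExtWeyl P} (ht : t ∈ J) : len b z < len b (z * t) := by
  have h1 := hz.2 1 (one_mem _) t (Subgroup.subset_closure ht)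
  have h2 := (isExtCoxeter b).len_mul_right (simpleRefl_subset (hJ ht)) z
  rw [one_mul] at h1
  lia

/-- Equality of double cosets gives t_λ' z' = t_{a λ} (a z c) with a in W_I and c in W_J. Comparing
finite parts and using minimality, z' = z = a z c. By Kilmoyer's theorem a is generated by I ∩ z J
z⁻¹, and the dominant weights λ and λ' = a λ each dominate the other. -/
lemma minElt_injective (hI : I ⊆ simpleRefl b) (hJ : J ⊆ simpleRefl b) :
    Function.Injective (minElt b I J) := by
  have := isReduced_flip P
  rintro ⟨⟨lam, z⟩, hz, hlam⟩ ⟨⟨lam', z'⟩, hz', hlam'⟩ heq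
  obtain ⟨u, hu, w, hw, h1⟩ := (isMinIn_minElt hI hJ ⟨(lam, z), hz, hlam⟩).1
  obtain ⟨u', hu', w', hw', h2⟩ := (isMinIn_minElt hI hJ ⟨(lam', z'), hz', hlam'⟩).1
  rw [heq, h2] at h1
  dsimp only at h1 hz hz' hlam hlam'
  clear h2 heq
  have ha := mul_mem (inv_mem hu') hu
  have hc := mul_mem hw (inv_mem hw')
  set a := u'⁻¹ * u with hadef
  set c := w * w'⁻¹ with hcdef
  have haW := para_le_finWeyl hI ha
  have hcW := para_le_finWeyl hJ hc
  have h3 : transl P lam' * z' = transl P (pt a lam) * (a * z * c) := by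
    rw [show transl P (pt a lam) * (a * z * c) = (transl P (pt a lam) * a) * z * c by group,
      ← mul_transl haW]
    have h4 : transl P lam' * z' = u'⁻¹ * (u' * (transl P lam' * z') * w') * w'⁻¹ := by group
    rw [h4, h1, hadef, hcdef]
    group
  obtain ⟨h4, h5⟩ := transl_mul_injective hz'.1 (mul_mem (mul_mem haW hz.1) hcW) h3
  have h6 : a * z * c = z := by
    refine (eq_of_min hI hJ (fun s hs => minReps_left hI hz hs)
      (fun t ht => minReps_right hJ hz ht) ha hc).2 ?_
    rw [← h5]
    have := hz'.2 a⁻¹ (inv_mem ha) c⁻¹ (inv_mem hc)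
    rwa [h5, show a⁻¹ * (a * z * c) * c⁻¹ = z by group, ← h5] at this
  have h7 : z' = z := h5.trans h6
  subst h7
  have h8 : a ∈ Subgroup.closure {s | s ∈ I ∧ z'⁻¹ * s * z' ∈ J} := by
    refine (isExtCoxeter b).mem_closure_inter (hI.trans simpleRefl_subset)
      (hJ.trans simpleRefl_subset) (fun s hs => minReps_left hI hz hs)
      (fun t ht => minReps_right hJ hz ht) ha ?_
    have h9 : z'⁻¹ * a * z' = c⁻¹ := by
      nth_rewrite 1 [← h6]
      group
    rw [h9]
    exact inv_mem hc
  have h9 : {s | s ∈ I ∧ z'⁻¹ * s * z' ∈ J} ⊆ simpleRefl b := fun s hs => hI hs.1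
  have h10 := sub_pt_mem h9 (lam := lam) (fun i hi hiK => hlam i hi hiK.1 hiK.2) h8
  have h11 := sub_pt_mem h9 (lam := lam') (fun i hi hiK => hlam' i hi hiK.1 hiK.2) (inv_mem h8)
  rw [h4, pt_inv_pt, ← neg_sub] at h11
  have h12 := corootCone_eq_zero b.flip h10 h11
  have h13 : lam = lam' := by rw [h4]; exact sub_eq_zero.mp h12
  subst h13
  rfl

end DoubleCosets

end AffHecke

end

/-! ### The standard basis of the Hecke algebra. -/

noncomputable section

namespace AffHecke

lemma IsExtCoxeter.len_mul_le {G : Type*} [Group G] {S : Set G} {ℓ : G → ℕ}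
    (h : IsExtCoxeter S ℓ) (x y : G) : ℓ (x * y) ≤ ℓ x + ℓ y := by
  induction hn : ℓ x using Nat.strong_induction_on generalizing x with
  | _ n ih =>
    rcases Nat.eq_zero_or_pos (ℓ x) with h0 | h0
    · rw [h.len_zero_mul x h0]; lia
    · obtain ⟨s, hs, hlt⟩ := h.exists_descent x h0
      have h1 := ih _ (by lia) (s * x) rfl
      have h2 := h.len_mul s hs x
      have h3 := h.len_mul s hs (s * x * y)
      rw [mul_assoc s x y, h.mul_mul_self hs] at h3
      rw [mul_assoc] at h1
      lia

lemma IsExtCoxeter.exists_right_descent {G : Type*} [Group G] {S : Set G} {ℓ : G → ℕ}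
    (h : IsExtCoxeter S ℓ) {x : G} (hx : 0 < ℓ x) : ∃ s ∈ S, ℓ (x * s) < ℓ x := by
  obtain ⟨s, hs, hlt⟩ := h.exists_descent x⁻¹ (by rwa [h.len_inv])
  refine ⟨s, hs, ?_⟩
  rw [← h.len_inv, mul_inv_rev, h.inv_eq hs]
  rwa [h.len_inv x] at hlt

variable {ι X Y : Type*} [AddCommGroup X] [AddCommGroup Y]
variable {P : RootPairing ι ℤ X Y} (b : P.Base)

/-! ### Ring homomorphisms from the Hecke algebra -/

section Lift

variable {b}

/-- Allowing a central coefficient map σ covers the regular representation, the semilinear bar and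
twist, the opposite algebra and the specialization at v = 1. -/
lemma exists_lift {R : Type*} [Ring R] (σ : A →+* R) (hσ : ∀ a r, σ a * r = r * σ a)
    (φ : ExtWeyl P → R) (one : φ 1 = 1)
    (mul : ∀ x y, len b (x * y) = len b x + len b y → φ x * φ y = φ (x * y))
    (quad : ∀ s ∈ affRefl b, φ s * φ s = σ (vpow 2) + σ (vpow 2 - 1) * φ s) :
    ∃ F : Hecke b →+* R, (∀ a h, F (a • h) = σ a * F h) ∧ ∀ x, F (T b x) = φ x := by
  let _ : Algebra A R := σ.toAlgebra' hσ
  let f : FreeAlgebra A (ExtWeyl P) →ₐ[A] R := FreeAlgebra.lift A φ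
  have hf : ∀ ⦃x y⦄, HeckeRel b x y → f x = f y := by
    intro x y hxy
    cases hxy with
    | one => simp [f, one]
    | mul x y hlen => simp [f, mul x y hlen]
    | quad s hs =>
      simp only [f, map_mul, map_add, map_smul, FreeAlgebra.lift_ι_apply, quad s hs, one]
      rw [Algebra.smul_def, Algebra.smul_def, mul_one]
      rfl
  refine ⟨(RingQuot.liftAlgHom A ⟨f, hf⟩ : Hecke b →ₐ[A] R).toRingHom, fun a h => ?_, fun x => ?_⟩
  · change (RingQuot.liftAlgHom A ⟨f, hf⟩ : Hecke b →ₐ[A] R) (a • h) = _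
    rw [map_smul, Algebra.smul_def]
    rfl
  · change (RingQuot.liftAlgHom A ⟨f, hf⟩ : Hecke b →ₐ[A] R) (RingQuot.mkAlgHom A _ _) = _
    rw [RingQuot.liftAlgHom_mkAlgHom_apply]
    simp [f]

end Lift

lemma T_one : T b (1 : ExtWeyl P) = 1 := by
  rw [T, RingQuot.mkAlgHom_rel A HeckeRel.one, map_one]

lemma T_mul {x y : ExtWeyl P} (h : len b (x * y) = len b x + len b y) :
    T b x * T b y = T b (x * y) := by
  rw [T, T, T, ← map_mul, RingQuot.mkAlgHom_rel A (HeckeRel.mul x y h)]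

lemma T_sq {s : ExtWeyl P} (hs : s ∈ affRefl b) :
    T b s * T b s = vpow 2 • (1 : Hecke b) + (vpow 2 - 1) • T b s := by
  rw [← T_one, T, T, ← map_mul, RingQuot.mkAlgHom_rel A (HeckeRel.quad s hs), map_add, map_smul,
    map_smul]

section

variable [Finite ι] [P.IsReduced]

lemma T_simple_mul {s x : ExtWeyl P} (hs : s ∈ affRefl b) (h : len b x < len b (s * x)) :
    T b s * T b x = T b (s * x) := by
  have h1 := (isExtCoxeter b).len_mul s hs x
  refine T_mul b ?_
  rw [(isExtCoxeter b).len_simple hs]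
  lia

lemma T_simple_mul_of_lt {s x : ExtWeyl P} (hs : s ∈ affRefl b) (h : len b (s * x) < len b x) :
    T b s * T b x = vpow 2 • T b (s * x) + (vpow 2 - 1) • T b x := by
  have h1 : T b s * T b (s * x) = T b x := by
    rw [T_simple_mul b hs, (isExtCoxeter b).mul_mul_self hs]
    rwa [(isExtCoxeter b).mul_mul_self hs]
  conv_lhs => rw [← h1, ← mul_assoc, T_sq b hs, add_mul, smul_mul_assoc, smul_mul_assoc, one_mul, h1]

lemma T_zero_mul {g : ExtWeyl P} (hg : len b g = 0) (x : ExtWeyl P) :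
    T b g * T b x = T b (g * x) :=
  T_mul b (by rw [hg, (isExtCoxeter b).len_zero_mul g hg, zero_add])

lemma T_induction {p : ExtWeyl P → Prop} (zero : ∀ g, len b g = 0 → p g)
    (step : ∀ s ∈ affRefl b, ∀ x, len b x < len b (s * x) → p x → p (s * x)) (x : ExtWeyl P) :
    p x := by
  induction hn : len b x using Nat.strong_induction_on generalizing x with
  | _ n ih =>
    rcases Nat.eq_zero_or_pos (len b x) with h0 | h0
    · exact zero x h0
    · obtain ⟨s, hs, hlt⟩ := (isExtCoxeter b).exists_descent x h0
      have h1 := step s hs (s * x)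
      rw [(isExtCoxeter b).mul_mul_self hs] at h1
      exact h1 hlt (ih _ (by lia) _ rfl)

lemma T_right_induction {p : ExtWeyl P → Prop} (zero : ∀ g, len b g = 0 → p g)
    (step : ∀ s ∈ affRefl b, ∀ x, len b x < len b (x * s) → p x → p (x * s)) (x : ExtWeyl P) :
    p x := by
  induction hn : len b x using Nat.strong_induction_on generalizing x with
  | _ n ih =>
    rcases Nat.eq_zero_or_pos (len b x) with h0 | h0
    · exact zero x h0
    · obtain ⟨s, hs, hlt⟩ := (isExtCoxeter b).exists_right_descent h0
      have h1 := step s hs (x * s)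
      rw [(isExtCoxeter b).mul_self_mul hs] at h1
      exact h1 hlt (ih _ (by lia) _ rfl)

/-! ### The regular representation -/

open Finsupp in
/-- The action of a standard generator `T_s` on the left of the regular module. -/
def leftOp (s : ExtWeyl P) : Module.End A (ExtWeyl P →₀ A) :=
  linearCombination A fun x => if len b x < len b (s * x) then single (s * x) 1
    else vpow 2 • single (s * x) 1 + (vpow 2 - 1) • single x 1

open Finsupp in
/-- The action of a standard generator `T_s` on the right of the regular module. -/
def rightOp (s : ExtWeyl P) : Module.End A (ExtWeyl P →₀ A) :=
  linearCombination A fun x => if len b x < len b (x * s) then single (x * s) 1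
    else vpow 2 • single (x * s) 1 + (vpow 2 - 1) • single x 1

/-- Left translation on the regular module. -/
def leftTr (g : ExtWeyl P) : Module.End A (ExtWeyl P →₀ A) := Finsupp.lmapDomain A A (g * ·)

/-- Right translation on the regular module. -/
def rightTr (g : ExtWeyl P) : Module.End A (ExtWeyl P →₀ A) := Finsupp.lmapDomain A A (· * g)

omit [Finite ι] [P.IsReduced] in
lemma leftOp_single (s x : ExtWeyl P) : leftOp b s (Finsupp.single x 1) =
    if len b x < len b (s * x) then Finsupp.single (s * x) 1
    else vpow 2 • Finsupp.single (s * x) 1 + (vpow 2 - 1) • Finsupp.single x 1 := by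
  rw [leftOp, Finsupp.linearCombination_single, one_smul]

omit [Finite ι] [P.IsReduced] in
lemma rightOp_single (s x : ExtWeyl P) : rightOp b s (Finsupp.single x 1) =
    if len b x < len b (x * s) then Finsupp.single (x * s) 1
    else vpow 2 • Finsupp.single (x * s) 1 + (vpow 2 - 1) • Finsupp.single x 1 := by
  rw [rightOp, Finsupp.linearCombination_single, one_smul]

omit [Finite ι] [P.IsReduced] in
lemma leftTr_single (g x : ExtWeyl P) :
    leftTr g (Finsupp.single x (1 : A)) = Finsupp.single (g * x) 1 := by
  rw [leftTr, Finsupp.lmapDomain_apply, Finsupp.mapDomain_single]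

omit [Finite ι] [P.IsReduced] in
lemma rightTr_single (g x : ExtWeyl P) :
    rightTr g (Finsupp.single x (1 : A)) = Finsupp.single (x * g) 1 := by
  rw [rightTr, Finsupp.lmapDomain_apply, Finsupp.mapDomain_single]

omit [Finite ι] [P.IsReduced] in
lemma end_ext {f g : Module.End A (ExtWeyl P →₀ A)}
    (h : ∀ x, f (Finsupp.single x 1) = g (Finsupp.single x 1)) : f = g :=
  Finsupp.lhom_ext' fun x => LinearMap.ext_ring (h x)

/-- If s x = x t, the two operators agree on x and on x t. Otherwise the left descent at s and the
right descent at t do not influence each other, and four cases are compared. -/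
lemma leftOp_mul_rightOp {s t : ExtWeyl P} (hs : s ∈ affRefl b) (ht : t ∈ affRefl b) :
    leftOp b s * rightOp b t = rightOp b t * leftOp b s := by
  have hE := isExtCoxeter b
  refine end_ext fun x => ?_
  simp only [Module.End.mul_apply]
  by_cases hst : s * x = x * t
  · have h1 : ∀ y, s * y = y * t → leftOp b s (Finsupp.single y 1) =
        rightOp b t (Finsupp.single y 1) := by
      intro y hy
      rw [leftOp_single, rightOp_single, hy]
    have h2 : s * (x * t) = x * t * t := by rw [← mul_assoc, hst]
    rw [h1 x hst, rightOp_single]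
    split_ifs with h3
    · rw [h1 _ h2]
    · rw [map_add, map_add, map_smul, map_smul, map_smul, map_smul, h1 x hst, h1 _ h2]
  · have e1 : len b (x * t) < len b (s * (x * t)) ↔ len b x < len b (s * x) := by
      have h1 := hE.len_mul s hs x
      have h2 := hE.len_mul s hs (x * t)
      have h3 := hE.reflect s hs (x * t * x⁻¹) ⟨x, t, ht, rfl⟩
        (by rintro h; exact hst (by rw [← h]; group)) x
      have h4 := hE.len_mul_right ht x
      have h5 := hE.len_mul_right ht (s * x)
      rw [inv_mul_cancel_right, show s * (x * t * x⁻¹) * x = s * x * t by group] at h3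
      rw [mul_assoc s x t] at *
      lia
    have e2 : len b (s * x) < len b (s * x * t) ↔ len b x < len b (x * t) := by
      have h1 := hE.len_mul s hs x
      have h2 := hE.len_mul s hs (x * t)
      have h4 := hE.len_mul_right ht x
      have h5 := hE.len_mul_right ht (s * x)
      rw [mul_assoc s x t] at *
      lia
    rw [rightOp_single, leftOp_single]
    split_ifs with h1 h2 h2
    · rw [leftOp_single, rightOp_single, if_pos (e1.mpr h2), if_pos (e2.mpr h1), mul_assoc]
    · rw [leftOp_single, if_neg (fun h => h2 (e1.mp h)), map_add, map_smul, map_smul,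
        rightOp_single, rightOp_single, if_pos (e2.mpr h1), if_pos h1, mul_assoc]
    · rw [rightOp_single, if_neg (fun h => h1 (e2.mp h)), map_add, map_smul, map_smul,
        leftOp_single, leftOp_single, if_pos (e1.mpr h2), if_pos h2, mul_assoc]
    · rw [map_add, map_smul, map_smul, map_add, map_smul, map_smul, rightOp_single,
        rightOp_single, leftOp_single, leftOp_single, if_neg (fun h => h2 (e1.mp h)), if_neg h2,
        if_neg (fun h => h1 (e2.mp h)), if_neg h1, mul_assoc]
      module

lemma leftOp_mul_rightTr (s : ExtWeyl P) {g : ExtWeyl P} (hg : len b g = 0) :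
    leftOp b s * rightTr g = rightTr g * leftOp b s := by
  have hE := isExtCoxeter b
  refine end_ext fun x => ?_
  simp only [Module.End.mul_apply]
  rw [rightTr_single, leftOp_single, leftOp_single, ← mul_assoc, hE.len_mul_zero hg,
    hE.len_mul_zero hg]
  split_ifs
  · rw [rightTr_single]
  · rw [map_add, map_smul, map_smul, rightTr_single, rightTr_single]

lemma leftTr_mul_rightOp {g : ExtWeyl P} (hg : len b g = 0) (s : ExtWeyl P) :
    leftTr g * rightOp b s = rightOp b s * leftTr g := by
  have hE := isExtCoxeter b
  refine end_ext fun x => ?_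
  simp only [Module.End.mul_apply]
  rw [leftTr_single, rightOp_single, rightOp_single, mul_assoc, hE.len_zero_mul g hg,
    hE.len_zero_mul g hg]
  split_ifs
  · rw [leftTr_single]
  · rw [map_add, map_smul, map_smul, leftTr_single, leftTr_single]

omit [Finite ι] [P.IsReduced] in
lemma leftTr_mul_rightTr (g g' : ExtWeyl P) :
    leftTr g * rightTr g' = rightTr g' * leftTr g := by
  refine end_ext fun x => ?_
  simp only [Module.End.mul_apply]
  rw [rightTr_single, leftTr_single, leftTr_single, rightTr_single, mul_assoc]

/-- The commutant of the right action on the regular module. -/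
def commutant : Subalgebra A (Module.End A (ExtWeyl P →₀ A)) :=
  Subalgebra.centralizer A (rightOp b '' affRefl b ∪ rightTr '' {g | len b g = 0})

omit [Finite ι] [P.IsReduced] in
lemma mem_commutant_iff {f : Module.End A (ExtWeyl P →₀ A)} : f ∈ commutant b ↔
    (∀ s ∈ affRefl b, rightOp b s * f = f * rightOp b s) ∧
      ∀ g, len b g = 0 → rightTr g * f = f * rightTr g := by
  rw [commutant, Subalgebra.mem_centralizer_iff]
  constructor
  · exact fun h => ⟨fun s hs => h _ (Or.inl ⟨s, hs, rfl⟩), fun g hg => h _ (Or.inr ⟨g, hg, rfl⟩)⟩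
  · rintro ⟨h1, h2⟩ _ (⟨s, hs, rfl⟩ | ⟨g, hg, rfl⟩)
    · exact h1 s hs
    · exact h2 g hg

/-- An operator commuting with the right action is determined by its value at 1: right letters build
y up, and additivity of lengths keeps every step ascending. -/
lemma commutant_apply {f : Module.End A (ExtWeyl P →₀ A)} (hf : f ∈ commutant b)
    {x : ExtWeyl P} (hx : f (Finsupp.single 1 1) = Finsupp.single x 1) {y : ExtWeyl P}
    (hxy : len b (x * y) = len b x + len b y) :
    f (Finsupp.single y 1) = Finsupp.single (x * y) 1 := by
  have hE := isExtCoxeter b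
  obtain ⟨h1, h2⟩ := (mem_commutant_iff b).mp hf
  revert hxy
  refine T_right_induction b (p := fun y => len b (x * y) = len b x + len b y →
    f (Finsupp.single y 1) = Finsupp.single (x * y) 1) ?_ ?_ y
  · intro g hg _
    have h3 := LinearMap.congr_fun (h2 g hg) (Finsupp.single 1 1)
    rw [Module.End.mul_apply, Module.End.mul_apply, hx, rightTr_single, rightTr_single,
      one_mul] at h3
    exact h3.symm
  · intro s hs y hy ih hxy
    have h3 := LinearMap.congr_fun (h1 s hs) (Finsupp.single y 1)
    have h4 := hE.len_mul_le x y
    have h5 := hE.len_mul_right hs (x * y)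
    have h6 := hE.len_mul_right hs y
    rw [← mul_assoc] at hxy
    rw [Module.End.mul_apply, Module.End.mul_apply, ih (by lia), rightOp_single, rightOp_single,
      if_pos hy, if_pos (by lia)] at h3
    rw [← h3, mul_assoc]

lemma commutant_ext {f f' : Module.End A (ExtWeyl P →₀ A)} (hf : f ∈ commutant b)
    (hf' : f' ∈ commutant b) (h : f (Finsupp.single 1 1) = f' (Finsupp.single 1 1)) : f = f' := by
  obtain ⟨h1, h2⟩ := (mem_commutant_iff b).mp hf
  obtain ⟨h1', h2'⟩ := (mem_commutant_iff b).mp hf'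
  refine end_ext fun x => ?_
  refine T_right_induction b (p := fun x => f (Finsupp.single x 1) = f' (Finsupp.single x 1))
    ?_ ?_ x
  · intro g hg
    have h3 := LinearMap.congr_fun (h2 g hg) (Finsupp.single 1 1)
    have h3' := LinearMap.congr_fun (h2' g hg) (Finsupp.single 1 1)
    rw [Module.End.mul_apply, Module.End.mul_apply, rightTr_single, one_mul] at h3 h3'
    rw [← h3, ← h3', h]
  · intro s hs x hx ih
    have h3 := LinearMap.congr_fun (h1 s hs) (Finsupp.single x 1)
    have h3' := LinearMap.congr_fun (h1' s hs) (Finsupp.single x 1)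
    rw [Module.End.mul_apply, Module.End.mul_apply, rightOp_single, if_pos hx] at h3 h3'
    rw [← h3, ← h3', ih]

lemma leftOp_mem_commutant {s : ExtWeyl P} (hs : s ∈ affRefl b) : leftOp b s ∈ commutant b :=
  (mem_commutant_iff b).mpr ⟨fun _ ht => (leftOp_mul_rightOp b hs ht).symm,
    fun _ hg => (leftOp_mul_rightTr b s hg).symm⟩

lemma exists_mem_commutant (x : ExtWeyl P) :
    ∃ f ∈ commutant b, f (Finsupp.single 1 1) = Finsupp.single x 1 := by
  refine T_induction b (p := fun x => ∃ f ∈ commutant b, f (Finsupp.single 1 1) =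
    Finsupp.single x 1) (fun g hg => ⟨leftTr g, ?_, by rw [leftTr_single, mul_one]⟩) ?_ x
  · exact (mem_commutant_iff b).mpr ⟨fun s _ => (leftTr_mul_rightOp b hg s).symm,
      fun g' _ => (leftTr_mul_rightTr g g').symm⟩
  · rintro s hs x hx ⟨f, hf, hfx⟩
    exact ⟨leftOp b s * f, (commutant b).mul_mem (leftOp_mem_commutant b hs) hf, by
      rw [Module.End.mul_apply, hfx, leftOp_single, if_pos hx]⟩

/-- Send T_x to the operator in `commutant b` with value x at 1. Operators in the commutant agree
once they agree at 1, so each Hecke relation reduces to a computation on one vector. -/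
lemma exists_regular : ∃ F : Hecke b →ₗ[A] (ExtWeyl P →₀ A),
    ∀ x, F (T b x) = Finsupp.single x 1 := by
  have hE := isExtCoxeter b
  choose L hL hL1 using exists_mem_commutant b
  obtain ⟨F, hF, hFT⟩ := exists_lift (b := b)
    (algebraMap A (Module.End A (ExtWeyl P →₀ A))) (fun a r => Algebra.commutes a r) L
    (commutant_ext b (hL 1) (commutant b).one_mem (hL1 1))
    (fun x y hxy => commutant_ext b ((commutant b).mul_mem (hL x) (hL y)) (hL _) (by
      rw [Module.End.mul_apply, hL1, commutant_apply b (hL x) (hL1 x) hxy, hL1]))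
    (fun s hs => by
      have h1 : L s = leftOp b s := commutant_ext b (hL s) (leftOp_mem_commutant b hs) (by
        have := hE.len_simple hs
        have h1 := hE.len_one
        rw [hL1, leftOp_single, if_pos (by rw [mul_one]; lia), mul_one])
      refine commutant_ext b ((commutant b).mul_mem (hL s) (hL s))
        ((commutant b).add_mem ((commutant b).algebraMap_mem _)
        ((commutant b).mul_mem ((commutant b).algebraMap_mem _) (hL s))) ?_
      have h2 := hE.len_simple hs
      have h3 := hE.len_one
      rw [Module.End.mul_apply, hL1, h1, leftOp_single, hE.sq s hs, if_neg (by lia),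
        LinearMap.add_apply, Module.End.mul_apply, ← h1, hL1]
      rfl)
  refine ⟨{ toFun := fun h => F h (Finsupp.single 1 1), map_add' := fun h h' => by simp,
            map_smul' := fun a h => by rw [hF]; rfl }, fun x => ?_⟩
  change F (T b x) _ = _
  rw [hFT, hL1]

/-! ### The standard basis -/

lemma T_linearIndependent : LinearIndependent A (T b : ExtWeyl P → Hecke b) := by
  obtain ⟨F, hF⟩ := exists_regular b
  refine LinearIndependent.of_comp F ?_
  have h1 : F ∘ T b = fun x => Finsupp.single x (1 : A) := funext hF
  rw [h1]
  exact Finsupp.linearIndependent_single_one A _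

lemma T_mul_mem_span (x : ExtWeyl P) {h : Hecke b} (hh : h ∈ Submodule.span A (Set.range (T b))) :
    T b x * h ∈ Submodule.span A (Set.range (T b)) := by
  have hT : ∀ y, T b y ∈ Submodule.span A (Set.range (T b)) := fun y =>
    Submodule.subset_span ⟨y, rfl⟩
  refine T_induction b (p := fun x => ∀ h ∈ Submodule.span A (Set.range (T b)),
    T b x * h ∈ Submodule.span A (Set.range (T b))) ?_ ?_ x h hh
  · intro g hg h hh
    induction hh using Submodule.span_induction with
    | mem h hh =>
      obtain ⟨y, rfl⟩ := hh
      rw [T_zero_mul b hg]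
      exact hT _
    | zero => simp
    | add h h' _ _ hh hh' => rw [mul_add]; exact add_mem hh hh'
    | smul a h _ hh => rw [mul_smul_comm]; exact Submodule.smul_mem _ a hh
  · intro s hs x hx ih h hh
    rw [← T_simple_mul b hs hx, mul_assoc]
    have h1 := ih h hh
    generalize T b x * h = h at h1
    induction h1 using Submodule.span_induction with
    | mem h hh =>
      obtain ⟨y, rfl⟩ := hh
      rcases lt_or_ge (len b y) (len b (s * y)) with hy | hy
      · rw [T_simple_mul b hs hy]
        exact hT _
      · have h2 := (isExtCoxeter b).len_mul s hs y
        rw [T_simple_mul_of_lt b hs (by lia)]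
        exact add_mem (Submodule.smul_mem _ _ (hT _)) (Submodule.smul_mem _ _ (hT _))
    | zero => simp
    | add h h' _ _ hh hh' => rw [mul_add]; exact add_mem hh hh'
    | smul a h _ hh => rw [mul_smul_comm]; exact Submodule.smul_mem _ a hh

/-- The span contains 1 and is stable under left multiplication by the generators. -/
lemma T_span : Submodule.span A (Set.range (T b : ExtWeyl P → Hecke b)) = ⊤ := by
  refine eq_top_iff.mpr fun h htop => ?_
  clear htop
  obtain ⟨a, rfl⟩ := RingQuot.mkAlgHom_surjective A (HeckeRel b) h
  suffices ∀ h ∈ Submodule.span A (Set.range (T b)), RingQuot.mkAlgHom A (HeckeRel b) a * h ∈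
      Submodule.span A (Set.range (T b)) by
    have h1 := this 1 (by rw [← T_one]; exact Submodule.subset_span ⟨1, rfl⟩)
    rwa [mul_one] at h1
  induction a using FreeAlgebra.induction with
  | grade0 r =>
    intro h hh
    rw [AlgHom.commutes, ← Algebra.smul_def]
    exact Submodule.smul_mem _ r hh
  | grade1 x => exact fun h hh => T_mul_mem_span b x hh
  | mul x y hx hy =>
    intro h hh
    rw [map_mul, mul_assoc]
    exact hx _ (hy _ hh)
  | add x y hx hy =>
    intro h hh
    rw [map_add, add_mul]
    exact add_mem (hx _ hh) (hy _ hh)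

/-- The standard basis of the Hecke algebra. -/
def TBasis : Module.Basis (ExtWeyl P) A (Hecke b) :=
  Module.Basis.mk (T_linearIndependent b) (T_span b).ge

lemma TBasis_apply (x : ExtWeyl P) : TBasis b x = T b x := by
  rw [TBasis, Module.Basis.mk_apply]

/-- The coefficient of `T_y`. -/
def coef (y : ExtWeyl P) : Hecke b →ₗ[A] A := (TBasis b).coord y

open scoped Classical in
lemma coef_T (x y : ExtWeyl P) : coef b y (T b x) = if x = y then 1 else 0 := by
  rw [coef, Module.Basis.coord_apply, ← TBasis_apply, Module.Basis.repr_self,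
    Finsupp.single_apply]

variable {b}

lemma hecke_ext {h h' : Hecke b} (H : ∀ y, coef b y h = coef b y h') : h = h' :=
  (TBasis b).ext_elem H

lemma hecke_eq_sum (h : Hecke b) : h = ((TBasis b).repr h).sum fun y a => a • T b y := by
  conv_lhs => rw [← (TBasis b).linearCombination_repr h, Finsupp.linearCombination_apply]
  simp only [TBasis_apply]

lemma hecke_induction {p : Hecke b → Prop} (h : Hecke b) (smul_T : ∀ (a : A) (x : ExtWeyl P), p (a • T b x))
    (zero : p 0) (add : ∀ h h', p h → p h' → p (h + h')) : p h := by
  rw [hecke_eq_sum h, Finsupp.sum]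
  exact Finset.sum_induction _ p add zero fun y _ => smul_T _ y

end

end AffHecke

end

/-! ### The bar involution and two further symmetries. -/

noncomputable section

namespace AffHecke

variable {ι X Y : Type*} [AddCommGroup X] [AddCommGroup Y]
variable {P : RootPairing ι ℤ X Y} (b : P.Base)

open LaurentPolynomial (invert)

lemma vpow_mul (m n : ℤ) : vpow m * vpow n = vpow (m + n) := (LaurentPolynomial.T_add m n).symm

lemma vpow_zero : vpow 0 = 1 := LaurentPolynomial.T_zero

lemma invert_vpow (n : ℤ) : invert (vpow n) = vpow (-n) := LaurentPolynomial.invert_T n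

lemma invert_invert (a : A) : invert (invert a) = a :=
  LaurentPolynomial.involutive_invert a

lemma ringHom_ext_of_vpow {R : Type*} [Ring R] {f g : A →+* R} (h : f (vpow 1) = g (vpow 1)) :
    f = g := by
  have h1 : ∀ n : ℕ, f (vpow n) = g (vpow n) := by
    intro n
    have h2 : vpow (n : ℤ) = vpow 1 ^ n := by rw [LaurentPolynomial.T_pow, mul_one]
    rw [h2, map_pow, map_pow, h]
  have h2 : ∀ n : ℤ, f (vpow n) = g (vpow n) := by
    intro n
    rcases Int.le_total 0 n with hn | hn
    · lift n to ℕ using hn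
      exact h1 n
    · obtain ⟨m, rfl⟩ : ∃ m : ℕ, n = -(m : ℤ) := ⟨n.natAbs, by lia⟩
      have e1 : ∀ F : A →+* R, F (vpow (-(m : ℤ))) * F (vpow m) = 1 := fun F => by
        rw [← map_mul, vpow_mul, neg_add_cancel, vpow_zero, map_one]
      have e2 : f (vpow m) * f (vpow (-(m : ℤ))) = 1 := by
        rw [← map_mul, vpow_mul, add_neg_cancel, vpow_zero, map_one]
      rw [← mul_one (g _), ← e2, ← mul_assoc, h1, e1, one_mul]
  refine RingHom.ext fun a => ?_
  induction a using LaurentPolynomial.induction_on' with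
  | add p q hp hq => rw [map_add, map_add, hp, hq]
  | C_mul_T n a =>
    rw [map_mul, map_mul, h2]
    congr 1
    exact RingHom.congr_fun (RingHom.ext_int (f.comp LaurentPolynomial.C)
      (g.comp LaurentPolynomial.C)) a

section

variable [Finite ι] [P.IsReduced]

/-! ### The bar involution -/

omit [Finite ι] [P.IsReduced] in
-- Factoring out T_s exhibits its inverse, as v² is a unit.
lemma T_mul_T_add {s : ExtWeyl P} (hs : s ∈ affRefl b) :
    T b s * T b s + (1 - vpow 2) • T b s = vpow 2 • (1 : Hecke b) := by
  rw [T_sq b hs, add_assoc, ← add_smul, sub_add_sub_cancel, sub_self, zero_smul, add_zero]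

lemma isUnit_T (x : ExtWeyl P) : IsUnit (T b x) := by
  refine T_induction b (p := fun x => IsUnit (T b x)) ?_ ?_ x
  · intro g hg
    have hg' : len b g⁻¹ = 0 := by rwa [(isExtCoxeter b).len_inv]
    refine ⟨⟨T b g, T b g⁻¹, ?_, ?_⟩, rfl⟩
    · rw [T_zero_mul b hg, mul_inv_cancel, T_one]
    · rw [T_zero_mul b hg', inv_mul_cancel, T_one]
  · intro s hs x hx ih
    rw [← T_simple_mul b hs hx]
    refine IsUnit.mul ?_ ih
    have h1 : vpow (-2) * vpow 2 = 1 := by rw [vpow_mul]; exact vpow_zero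
    have h2 := T_mul_T_add b hs
    refine ⟨⟨T b s, vpow (-2) • (T b s + (1 - vpow 2) • 1), ?_, ?_⟩, rfl⟩
    · rw [mul_smul_comm, mul_add, mul_smul_comm, mul_one, h2, smul_smul, h1, one_smul]
    · rw [smul_mul_assoc, add_mul, smul_mul_assoc, one_mul, h2, smul_smul, h1, one_smul]

/-- The inverse of `T_x`. -/
def Tinv (x : ExtWeyl P) : Hecke b := ↑((isUnit_T b x).unit⁻¹)

lemma T_mul_Tinv (x : ExtWeyl P) : T b x * Tinv b x = 1 := (isUnit_T b x).mul_val_inv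

lemma Tinv_mul_T (x : ExtWeyl P) : Tinv b x * T b x = 1 := (isUnit_T b x).val_inv_mul

variable {b} in
lemma eq_Tinv_of_mul_eq_one {x : ExtWeyl P} {h : Hecke b} (hh : h * T b x = 1) : h = Tinv b x :=
  left_inv_eq_right_inv hh (T_mul_Tinv b x)

lemma Tinv_mul {x y : ExtWeyl P} (h : len b (x * y) = len b x + len b y) :
    Tinv b y * Tinv b x = Tinv b (x * y) := by
  refine eq_Tinv_of_mul_eq_one ?_
  rw [← T_mul b h, mul_assoc, ← mul_assoc _ (T b x), Tinv_mul_T, one_mul, Tinv_mul_T]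

lemma Tinv_sq {s : ExtWeyl P} (hs : s ∈ affRefl b) : Tinv b s * Tinv b s =
    vpow (-2) • (1 : Hecke b) + (vpow (-2) - 1) • Tinv b s := by
  have h1 : vpow (-2) * vpow 2 = 1 := by rw [vpow_mul]; exact vpow_zero
  calc Tinv b s * Tinv b s = vpow (-2) • (Tinv b s * (vpow 2 • (1 : Hecke b)) * Tinv b s) := by
        rw [mul_smul_comm, mul_one, smul_mul_assoc, smul_smul, h1, one_smul]
    _ = vpow (-2) • (1 + (1 - vpow 2) • Tinv b s) := by
        rw [← T_mul_T_add b hs, mul_add, add_mul, ← mul_assoc, Tinv_mul_T, one_mul, T_mul_Tinv, mul_smul_comm,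
          smul_mul_assoc, Tinv_mul_T, one_mul]
    _ = _ := by
        rw [smul_add, smul_smul, mul_sub, h1, mul_one]

/-- The inverses of the T_{x⁻¹} satisfy the defining relations with v inverted; the induced
endomorphism squares to the identity and is therefore bijective. -/
lemma exists_isBar : ∃ f, IsBar b f := by
  have hE := isExtCoxeter b
  obtain ⟨F, hF, hFT⟩ := exists_lift (b := b)
    ((algebraMap A (Hecke b)).comp (invert : A ≃ₐ[ℤ] A).toRingEquiv.toRingHom)
    (fun a r => Algebra.commutes (invert a) r)
    (fun x => Tinv b x⁻¹)
    (by
      refine (eq_Tinv_of_mul_eq_one ?_).symm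
      rw [inv_one, T_one, one_mul])
    (fun x y h => by
      rw [Tinv_mul, mul_inv_rev]
      rw [← mul_inv_rev, hE.len_inv, hE.len_inv, hE.len_inv, h, add_comm])
    (fun s hs => by
      rw [hE.inv_eq hs, Tinv_sq b hs, Algebra.smul_def, Algebra.smul_def, mul_one]
      change _ = algebraMap A _ (invert (vpow 2)) + algebraMap A _ (invert (vpow 2 - 1)) * _
      rw [map_sub (invert : A ≃ₐ[ℤ] A), map_one (invert : A ≃ₐ[ℤ] A), invert_vpow])
  have hF' : ∀ (a : A) h, F (a • h) = invert a • F h := fun a h => by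
    rw [hF, Algebra.smul_def]
    rfl
  have hFF : ∀ h, F (F h) = h := by
    intro h
    refine hecke_induction (p := fun h => F (F h) = h) h ?_ (by simp) ?_
    · intro a x
      rw [hF', hF', invert_invert, hFT]
      congr 1
      have h1 : F (T b x⁻¹) * F (Tinv b x⁻¹) = 1 := by rw [← map_mul, T_mul_Tinv, map_one]
      rw [hFT, inv_inv] at h1
      exact (left_inv_eq_right_inv (T_mul_Tinv b x) h1).symm
    · intro h h' h1 h2
      rw [map_add, map_add, h1, h2]
  refine ⟨RingEquiv.ofRingHom F F (RingHom.ext hFF) (RingHom.ext hFF), ?_, fun x => ⟨?_, ?_⟩⟩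
  · change F _ = _
    rw [Algebra.algebraMap_eq_smul_one, hF', map_one, invert_vpow, Algebra.algebraMap_eq_smul_one]
  · change F (T b x) * _ = 1
    rw [hFT, Tinv_mul_T]
  · change _ * F (T b x) = 1
    rw [hFT, T_mul_Tinv]

variable {b}

omit [Finite ι] [P.IsReduced] in
-- `IsBar` prescribes only the image of v, which determines a ring homomorphism out of ℤ[v, v⁻¹].
lemma IsBar.map_smul {f : Hecke b ≃+* Hecke b} (hf : IsBar b f) (a : A) (h : Hecke b) :
    f (a • h) = invert a • f h := by
  have h1 : f.toRingHom.comp (algebraMap A (Hecke b)) =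
      (algebraMap A (Hecke b)).comp (invert : A ≃ₐ[ℤ] A).toRingEquiv.toRingHom := by
    refine ringHom_ext_of_vpow (R := Hecke b) ?_
    change f (algebraMap A _ (vpow 1)) = algebraMap A _ (invert (vpow 1))
    rw [hf.1, invert_vpow]
  rw [Algebra.smul_def, map_mul, Algebra.smul_def]
  congr 1
  exact RingHom.congr_fun h1 a

lemma IsBar.map_T {f : Hecke b ≃+* Hecke b} (hf : IsBar b f) (x : ExtWeyl P) :
    f (T b x) = Tinv b x⁻¹ := eq_Tinv_of_mul_eq_one (hf.2 x).1

variable (b)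

theorem existsUnique_isBar : ∃! f, IsBar b f := by
  obtain ⟨f, hf⟩ := exists_isBar b
  refine ⟨f, hf, fun g hg => ?_⟩
  refine RingEquiv.ext fun h => ?_
  refine hecke_induction (p := fun h => g h = f h) h ?_ (by simp) ?_
  · intro a x
    rw [hf.map_smul, hg.map_smul, hf.map_T, hg.map_T]
  · intro h h' h1 h2
    rw [map_add, map_add, h1, h2]

lemma isBar_bar : IsBar b (bar b) := by
  rw [bar]
  exact Classical.epsilon_spec (p := IsBar b) (exists_isBar b)

variable {b}

lemma bar_smul (a : A) (h : Hecke b) : bar b (a • h) = invert a • bar b h :=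
  (isBar_bar b).map_smul a h

lemma bar_T (x : ExtWeyl P) : bar b (T b x) = Tinv b x⁻¹ := (isBar_bar b).map_T x

/-! ### The anti-involution `T_x ↦ T_{x⁻¹}` -/

variable (b)

/-- A lift to the opposite algebra; it transfers left-handed statements to the right. -/
lemma exists_rev : ∃ F : Hecke b →ₗ[A] Hecke b, (∀ h h', F (h * h') = F h' * F h) ∧
    ∀ x, F (T b x) = T b x⁻¹ := by
  have hE := isExtCoxeter b
  obtain ⟨F, hF, hFT⟩ := exists_lift (b := b) (algebraMap A (Hecke b)ᵐᵒᵖ)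
    (fun a r => Algebra.commutes _ r) (fun x => MulOpposite.op (T b x⁻¹))
    (by rw [inv_one, T_one]; rfl)
    (fun x y h => by
      rw [← MulOpposite.op_mul, T_mul, mul_inv_rev]
      rw [← mul_inv_rev, hE.len_inv, hE.len_inv, hE.len_inv, h, add_comm])
    (fun s hs => by
      rw [hE.inv_eq hs, ← MulOpposite.op_mul, T_sq b hs, ← Algebra.smul_def,
        Algebra.algebraMap_eq_smul_one]
      rfl)
  refine ⟨{ toFun := fun h => (F h).unop
            map_add' := fun h h' => by rw [map_add]; rfl
            map_smul' := fun a h => by rw [hF, ← Algebra.smul_def]; rfl },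
    fun h h' => ?_, fun x => ?_⟩
  · change (F (h * h')).unop = _
    rw [map_mul]
    rfl
  · change (F (T b x)).unop = _
    rw [hFT]
    rfl

/-- The anti-involution `T_x ↦ T_{x⁻¹}`. -/
def rev : Hecke b →ₗ[A] Hecke b := Classical.choose (exists_rev b)

variable {b}

lemma rev_mul (h h' : Hecke b) : rev b (h * h') = rev b h' * rev b h :=
  (Classical.choose_spec (exists_rev b)).1 h h'

lemma rev_T (x : ExtWeyl P) : rev b (T b x) = T b x⁻¹ :=
  (Classical.choose_spec (exists_rev b)).2 x

lemma rev_rev (h : Hecke b) : rev b (rev b h) = h := by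
  refine hecke_induction (p := fun h => rev b (rev b h) = h) h ?_ (by simp) ?_
  · intro a x
    rw [map_smul, map_smul, rev_T, rev_T, inv_inv]
  · intro h h' h1 h2
    rw [map_add, map_add, h1, h2]

lemma rev_one : rev b 1 = 1 := by rw [← T_one, rev_T, inv_one]

lemma rev_bar (h : Hecke b) : rev b (bar b h) = bar b (rev b h) := by
  refine hecke_induction (p := fun h => rev b (bar b h) = bar b (rev b h)) h ?_ (by simp) ?_
  · intro a x
    rw [bar_smul, map_smul, map_smul, bar_smul, rev_T, bar_T, bar_T, inv_inv]
    congr 1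
    refine eq_Tinv_of_mul_eq_one ?_
    have h1 := congrArg (rev b) (T_mul_Tinv b x⁻¹)
    rwa [rev_mul, rev_T, rev_one, inv_inv] at h1
  · intro h h' h1 h2
    rw [map_add, map_add, h1, h2, map_add, map_add]

lemma coef_rev (x : ExtWeyl P) (h : Hecke b) : coef b x (rev b h) = coef b x⁻¹ h := by
  classical
  refine hecke_induction (p := fun h => coef b x (rev b h) = coef b x⁻¹ h) h ?_ (by simp) ?_
  · intro a y
    rw [map_smul, map_smul, map_smul, rev_T, coef_T, coef_T]
    simp only [inv_eq_iff_eq_inv]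
  · intro h h' h1 h2
    rw [map_add, map_add, h1, h2, map_add]

/-! ### The twist `v ↦ v⁻¹`, `T_x ↦ (-1)^ℓ(x) v^(-2ℓ(x)) T_x` -/

variable (b)

/-- This involution commutes with the bar involution and exchanges C_x and C'_x up to sign, so only
C'_x has to be constructed. -/
lemma exists_twist : ∃ F : Hecke b →+* Hecke b, (∀ (a : A) h, F (a • h) = invert a • F h) ∧
    ∀ x, F (T b x) = ((-1) ^ len b x * vpow (-2 * len b x)) • T b x := by
  have hE := isExtCoxeter b
  obtain ⟨F, hF, hFT⟩ := exists_lift (b := b)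
    ((algebraMap A (Hecke b)).comp (invert : A ≃ₐ[ℤ] A).toRingEquiv.toRingHom)
    (fun a r => Algebra.commutes (invert a) r)
    (fun x => ((-1) ^ len b x * vpow (-2 * len b x)) • T b x)
    (by
      rw [hE.len_one, T_one, pow_zero, Nat.cast_zero, mul_zero, vpow_zero, mul_one, one_smul])
    (fun x y h => by
      rw [smul_mul_smul_comm, T_mul b h, h, mul_mul_mul_comm, vpow_mul, ← pow_add]
      congr 3
      push_cast
      ring)
    (fun s hs => by
      rw [hE.len_simple hs, smul_mul_smul_comm, T_sq b hs]
      change _ = algebraMap A _ (invert (vpow 2)) + algebraMap A _ (invert (vpow 2 - 1)) * _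
      rw [map_sub (invert : A ≃ₐ[ℤ] A), map_one (invert : A ≃ₐ[ℤ] A), invert_vpow,
        ← Algebra.smul_def, Algebra.algebraMap_eq_smul_one, smul_add, smul_smul, smul_smul,
        smul_smul]
      have h1 : vpow (-2) * vpow 2 = 1 := by rw [vpow_mul]; exact vpow_zero
      push_cast
      congr 2
      · linear_combination vpow (-2) * h1
      · linear_combination vpow (-2) * h1)
  refine ⟨F, fun a h => ?_, hFT⟩
  rw [hF, Algebra.smul_def]
  rfl

/-- The ring endomorphism with `v ↦ v⁻¹` and `T_x ↦ (-1)^ℓ(x) v^(-2ℓ(x)) T_x`. -/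
def twist : Hecke b →+* Hecke b := Classical.choose (exists_twist b)

variable {b}

lemma twist_smul (a : A) (h : Hecke b) : twist b (a • h) = invert a • twist b h :=
  (Classical.choose_spec (exists_twist b)).1 a h

lemma twist_T (x : ExtWeyl P) :
    twist b (T b x) = ((-1) ^ len b x * vpow (-2 * len b x)) • T b x :=
  (Classical.choose_spec (exists_twist b)).2 x

lemma invert_sign_mul_vpow (n : ℕ) (m : ℤ) :
    invert ((-1) ^ n * vpow m) = (-1) ^ n * vpow (-m) := by
  rw [map_mul, map_pow, map_neg, map_one, invert_vpow]

lemma sign_mul_vpow_mul (n : ℕ) (m : ℤ) :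
    ((-1) ^ n * vpow m) * ((-1) ^ n * vpow (-m)) = 1 := by
  rw [mul_mul_mul_comm, vpow_mul, ← pow_add, Even.neg_one_pow ⟨n, rfl⟩, add_neg_cancel, vpow_zero,
    one_mul]

lemma twist_twist (h : Hecke b) : twist b (twist b h) = h := by
  refine hecke_induction (p := fun h => twist b (twist b h) = h) h ?_ (by simp) ?_
  · intro a x
    rw [twist_smul, twist_smul, twist_T, twist_smul, twist_T, invert_invert,
      invert_sign_mul_vpow, smul_smul _ _ (T b x), mul_comm _ (_ * vpow (-2 * _)),
      sign_mul_vpow_mul, one_smul]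
  · intro h h' h1 h2
    rw [map_add, map_add, h1, h2]

lemma twist_bar (h : Hecke b) : twist b (bar b h) = bar b (twist b h) := by
  refine hecke_induction (p := fun h => twist b (bar b h) = bar b (twist b h)) h ?_ (by simp) ?_
  · intro a x
    rw [bar_smul, twist_smul, twist_smul, bar_smul, twist_T, bar_smul, bar_T]
    have h1 := congrArg (twist b) (Tinv_mul_T b x⁻¹)
    rw [map_mul, twist_T, map_one, mul_smul_comm, (isExtCoxeter b).len_inv,
      ← smul_mul_assoc] at h1
    congr 1
    conv_rhs => rw [← eq_Tinv_of_mul_eq_one h1]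
    rw [smul_smul, invert_sign_mul_vpow, mul_comm (_ * vpow (- _)), sign_mul_vpow_mul, one_smul]
  · intro h h' h1 h2
    rw [map_add, map_add, h1, h2, map_add, map_add]

lemma coef_twist (x : ExtWeyl P) (h : Hecke b) : coef b x (twist b h) =
    (-1) ^ len b x * vpow (-2 * len b x) * invert (coef b x h) := by
  classical
  refine hecke_induction (p := fun h => coef b x (twist b h) =
    (-1) ^ len b x * vpow (-2 * len b x) * invert (coef b x h)) h ?_ (by simp) ?_
  · intro a y
    rw [twist_smul, twist_T, map_smul, map_smul, map_smul, coef_T]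
    split_ifs with h1
    · subst h1
      rw [smul_eq_mul, smul_eq_mul, smul_eq_mul, mul_one, mul_one, mul_comm]
    · rw [smul_zero, smul_zero, smul_zero, map_zero, mul_zero]
  · intro h h' h1 h2
    rw [map_add, map_add, h1, h2, map_add, map_add, mul_add]

end

end AffHecke

end

/-! ### Exponent bounds and triangularity of the bar involution. -/

noncomputable section

namespace AffHecke

open LaurentPolynomial (invert)

/-! ### Exponents of Laurent polynomials -/

lemma coeff_vpow_mul (m n : ℤ) (a : A) : (vpow m * a).coeff n = a.coeff (n - m) := by
  rw [vpow, LaurentPolynomial.T, AddMonoidAlgebra.coeff_single_mul_eq_mul_coeff (n - m), one_mul]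
  intro k _
  lia

lemma coeff_C_mul (k n : ℤ) (a : A) : (LaurentPolynomial.C k * a).coeff n = k * a.coeff n := by
  rw [← LaurentPolynomial.smul_eq_C_mul]
  rfl

lemma coeff_trunc (n : ℕ) (a : A) : (LaurentPolynomial.trunc a).coeff n = a.coeff n := rfl

lemma coeff_toLaurent_natCast (p : Polynomial ℤ) (n : ℕ) :
    (Polynomial.toLaurent p).coeff n = p.coeff n := by
  rw [LaurentPolynomial.coeff_toLaurent]
  exact Finsupp.mapDomain_apply Nat.cast_injective _ _

lemma coeff_toLaurent_of_neg (p : Polynomial ℤ) {n : ℤ} (hn : n < 0) :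
    (Polynomial.toLaurent p).coeff n = 0 := by
  rw [LaurentPolynomial.coeff_toLaurent]
  refine Finsupp.mapDomain_of_notMem_range _ _ ?_
  rintro ⟨m, rfl⟩
  exact absurd hn (by simp)

/-- The Laurent polynomials with exponents in `[lo, hi)`. -/
def expIn (lo hi : ℤ) : AddSubgroup A where
  carrier := {a | ∀ n, a.coeff n ≠ 0 → lo ≤ n ∧ n < hi}
  zero_mem' n hn := absurd rfl hn
  add_mem' {a a'} h h' n hn := by
    by_contra h1
    have h2 : a.coeff n = 0 := by by_contra h3; exact h1 (h n h3)
    have h3 : a'.coeff n = 0 := by by_contra h3; exact h1 (h' n h3)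
    have h4 : (a + a').coeff n = a.coeff n + a'.coeff n := rfl
    exact hn (by rw [h4, h2, h3, add_zero])
  neg_mem' {a} h n hn := by
    have h1 : (-a).coeff n = -a.coeff n := rfl
    rw [h1, neg_ne_zero] at hn
    exact h n hn

lemma expIn_mono {lo lo' hi hi' : ℤ} (h1 : lo' ≤ lo) (h2 : hi ≤ hi') {a : A}
    (h : a ∈ expIn lo hi) : a ∈ expIn lo' hi' := fun n hn =>
  ⟨h1.trans (h n hn).1, (h n hn).2.trans_le h2⟩

lemma vpow_mul_mem_expIn {lo hi : ℤ} (m : ℤ) {a : A} (h : a ∈ expIn lo hi) :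
    vpow m * a ∈ expIn (lo + m) (hi + m) := fun n hn => by
  rw [coeff_vpow_mul] at hn
  have := h _ hn
  lia

lemma C_mul_mem_expIn {lo hi : ℤ} (k : ℤ) {a : A} (h : a ∈ expIn lo hi) :
    LaurentPolynomial.C k * a ∈ expIn lo hi := fun n hn => by
  rw [coeff_C_mul] at hn
  exact h n (right_ne_zero_of_mul hn)

lemma vpow_mem_expIn (m : ℤ) : vpow m ∈ expIn m (m + 1) := fun n hn => by
  rw [vpow, LaurentPolynomial.T_apply] at hn
  split_ifs at hn with h <;> simp at hn
  lia

/-- Cancelling the top power shortens the exponent window by one; this is the correction step of the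
Kazhdan-Lusztig recursion. -/
lemma add_C_neg_coeff_mem_expIn {lo m : ℤ} {a : A} (h : a ∈ expIn lo (m + 1)) :
    a + LaurentPolynomial.C (-a.coeff m) * vpow m ∈ expIn lo m := fun n hn => by
  have h1 : (a + LaurentPolynomial.C (-a.coeff m) * vpow m).coeff n =
    a.coeff n + (LaurentPolynomial.C (-a.coeff m) * vpow m).coeff n := rfl
  rw [h1, coeff_C_mul, vpow, LaurentPolynomial.T_apply] at hn
  split_ifs at hn with h2
  · subst h2
    simp at hn
  · rw [mul_zero, add_zero] at hn
    have := h n hn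
    lia

variable {ι X Y : Type*} [AddCommGroup X] [AddCommGroup Y]
variable {P : RootPairing ι ℤ X Y} (b : P.Base) [Finite ι] [P.IsReduced]

/-! ### Coefficients of products and of the bar involution -/

lemma coef_T_self (x : ExtWeyl P) : coef b x (T b x) = 1 := by
  classical rw [coef_T, if_pos rfl]

lemma coef_T_of_ne {x y : ExtWeyl P} (h : x ≠ y) : coef b y (T b x) = 0 := by
  classical rw [coef_T, if_neg h]

lemma coef_T_mul {s y : ExtWeyl P} (hs : s ∈ affRefl b) (hy : len b y < len b (s * y))
    (h : Hecke b) : coef b y (T b s * h) = vpow 2 * coef b (s * y) h ∧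
      coef b (s * y) (T b s * h) = coef b y h + (vpow 2 - 1) * coef b (s * y) h := by
  have hE := isExtCoxeter b
  have hne : s * y ≠ y := fun h1 => by rw [h1] at hy; exact lt_irrefl _ hy
  refine hecke_induction (p := fun h => coef b y (T b s * h) = vpow 2 * coef b (s * y) h ∧
      coef b (s * y) (T b s * h) = coef b y h + (vpow 2 - 1) * coef b (s * y) h) h ?_ (by simp) ?_
  · intro a x
    rw [mul_smul_comm]
    simp only [map_smul, smul_eq_mul]
    rcases eq_or_ne x y with rfl | h1
    · rw [T_simple_mul b hs hy, coef_T_self, coef_T_self, coef_T_of_ne b hne, coef_T_of_ne b hne.symm]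
      exact ⟨by ring, by ring⟩
    · rcases eq_or_ne x (s * y) with rfl | h2
      · rw [T_simple_mul_of_lt b hs (by rwa [hE.mul_mul_self hs]), hE.mul_mul_self hs]
        simp only [map_add, map_smul, smul_eq_mul]
        rw [coef_T_self, coef_T_self, coef_T_of_ne b hne, coef_T_of_ne b hne.symm]
        exact ⟨by ring, by ring⟩
      · have h3 : s * x ≠ y := by
          rintro rfl
          exact h2 (hE.mul_mul_self hs x).symm
        have h4 : s * x ≠ s * y := fun h5 => h1 (mul_left_cancel h5)
        rw [coef_T_of_ne b h1, coef_T_of_ne b h2]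
        rcases lt_or_ge (len b x) (len b (s * x)) with h5 | h5
        · rw [T_simple_mul b hs h5, coef_T_of_ne b h3, coef_T_of_ne b h4]
          exact ⟨by ring, by ring⟩
        · have h6 := hE.len_mul s hs x
          rw [T_simple_mul_of_lt b hs (by lia)]
          simp only [map_add, map_smul, smul_eq_mul]
          rw [coef_T_of_ne b h1, coef_T_of_ne b h2, coef_T_of_ne b h3, coef_T_of_ne b h4]
          exact ⟨by ring, by ring⟩
  · rintro h h' ⟨h1, h2⟩ ⟨h3, h4⟩
    rw [mul_add]
    simp only [map_add]
    rw [h1, h2, h3, h4]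
    exact ⟨by ring, by ring⟩

lemma Tinv_simple {s : ExtWeyl P} (hs : s ∈ affRefl b) :
    Tinv b s = vpow (-2) • T b s + (vpow (-2) - 1) • (1 : Hecke b) := by
  have h1 : vpow (-2) * vpow 2 = 1 := by rw [vpow_mul]; exact vpow_zero
  refine (eq_Tinv_of_mul_eq_one ?_).symm
  rw [add_mul, smul_mul_assoc, smul_mul_assoc, one_mul, T_sq b hs, smul_add, smul_smul, smul_smul,
    add_assoc, ← add_smul, h1, one_smul, mul_sub, h1, mul_one, sub_add_sub_cancel, sub_self,
    zero_smul, add_zero]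

/-- Triangularity with respect to length suffices for uniqueness; it follows letter by letter from
T_s⁻¹ = v⁻² T_s + (v⁻² - 1). -/
lemma coef_bar_T (x : ExtWeyl P) : coef b x (bar b (T b x)) = vpow (-2 * len b x) ∧
    ∀ z, coef b z (bar b (T b x)) ≠ 0 → z = x ∨ len b z < len b x := by
  have hE := isExtCoxeter b
  refine T_induction b (p := fun x => coef b x (bar b (T b x)) = vpow (-2 * len b x) ∧
    ∀ z, coef b z (bar b (T b x)) ≠ 0 → z = x ∨ len b z < len b x) ?_ ?_ x
  · intro g hg
    have h1 : bar b (T b g) = T b g := by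
      rw [bar_T]
      refine (eq_Tinv_of_mul_eq_one ?_).symm
      rw [T_zero_mul b hg, mul_inv_cancel, T_one]
    rw [h1, coef_T_self, hg]
    refine ⟨by simp, fun z hz => Or.inl ?_⟩
    by_contra h2
    exact hz (coef_T_of_ne b (Ne.symm h2))
  · rintro s hs x hx ⟨ih1, ih2⟩
    have h1 : ∀ z, coef b z (bar b (T b (s * x))) = vpow (-2) * coef b z (T b s * bar b (T b x)) +
        (vpow (-2) - 1) * coef b z (bar b (T b x)) := fun z => by
      rw [← T_simple_mul b hs hx, map_mul, bar_T s, hE.inv_eq hs, Tinv_simple b hs, add_mul,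
        smul_mul_assoc, smul_mul_assoc, one_mul, map_add, map_smul, map_smul, smul_eq_mul,
        smul_eq_mul]
    have hlen := hE.len_mul s hs x
    constructor
    · have h2 : coef b (s * x) (bar b (T b x)) = 0 := by
        by_contra h3
        rcases ih2 _ h3 with h4 | h4
        · rw [h4] at hx
          exact lt_irrefl _ hx
        · lia
      rw [h1, (coef_T_mul b hs hx _).2, h2, ih1, mul_zero, mul_zero, add_zero, add_zero, vpow_mul]
      congr 1
      push_cast [show len b (s * x) = len b x + 1 by lia]
      ring
    · intro z hz
      by_contra h2
      push Not at h2
      have h3 : coef b z (bar b (T b x)) = 0 := by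
        by_contra h4
        rcases ih2 _ h4 with rfl | h5 <;> lia
      have h4 : coef b (s * z) (bar b (T b x)) = 0 := by
        by_contra h4
        have := hE.len_mul s hs z
        rcases ih2 _ h4 with h5 | h5
        · exact h2.1 (by rw [← h5, hE.mul_mul_self hs])
        · lia
      refine hz ?_
      rw [h1, h3]
      rcases lt_or_ge (len b z) (len b (s * z)) with h5 | h5
      · rw [(coef_T_mul b hs h5 _).1, h4]
        ring
      · have h6 := hE.len_mul s hs z
        have h7 := (coef_T_mul b hs (y := s * z) (by rw [hE.mul_mul_self hs]; lia)
          (bar b (T b x))).2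
        rw [hE.mul_mul_self hs, h3, h4] at h7
        rw [h7]
        ring

variable {b}

lemma coef_finset_sum {κ : Type*} (s : Finset κ) (f : κ → Hecke b) (y : ExtWeyl P) :
    coef b y (∑ i ∈ s, f i) = ∑ i ∈ s, coef b y (f i) := map_sum _ _ _

/-- At a longest y in the support the coefficient a satisfies a(v) = v^(-2ℓ(y)) a(v⁻¹). Its
exponents are symmetric about -ℓ(y), so they cannot all lie below -ℓ(y). -/
lemma eq_zero_of_bar_eq {h : Hecke b} (hbar : bar b h = h)
    (hneg : ∀ y n, (coef b y h).coeff n ≠ 0 → n < -len b y) : h = 0 := by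
  classical
  by_contra h0
  have h1 : ((TBasis b).repr h).support.Nonempty := by
    rw [Finsupp.support_nonempty_iff, Ne, LinearEquiv.map_eq_zero_iff]
    exact h0
  obtain ⟨y, hy, hmax⟩ := Finset.exists_max_image _ (len b) h1
  have h2 : coef b y (bar b h) = invert (coef b y h) * vpow (-2 * len b y) := by
    conv_lhs => rw [hecke_eq_sum h, Finsupp.sum, map_sum, map_sum]
    rw [Finset.sum_eq_single y]
    · rw [bar_smul, map_smul, (coef_bar_T b y).1]
      rfl
    · intro z hz hzy
      rw [bar_smul, map_smul]
      by_contra h3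
      rcases (coef_bar_T b z).2 y (right_ne_zero_of_smul h3) with h4 | h4
      · exact hzy h4.symm
      · exact absurd (hmax z hz) (by lia)
    · exact fun h3 => absurd hy h3
  rw [hbar] at h2
  have h3 : coef b y h ≠ 0 := Finsupp.mem_support_iff.mp hy
  obtain ⟨n, hn⟩ : ∃ n, (coef b y h).coeff n ≠ 0 := by
    by_contra! h4
    exact h3 (LaurentPolynomial.ext h4)
  have h4 := hneg y n hn
  rw [h2, mul_comm, coeff_vpow_mul, LaurentPolynomial.invert_apply] at hn
  have h5 := hneg y _ hn
  lia

end AffHecke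

end

/-! ### Existence, uniqueness and descent properties of the Kazhdan-Lusztig bases. -/

noncomputable section

namespace AffHecke

open LaurentPolynomial (invert)

variable {ι X Y : Type*} [AddCommGroup X] [AddCommGroup Y]
variable {P : RootPairing ι ℤ X Y} (b : P.Base) [Finite ι] [P.IsReduced]

/-! ### Kazhdan-Lusztig elements -/

/-- The characterization of `C'_x` through its coefficients. -/
structure IsKL (x : ExtWeyl P) (c : Hecke b) : Prop where
  bar_eq : bar b c = c
  coef_self : coef b x c = vpow (-len b x)
  -- This window encodes v^(-ℓ(x)) P with P a polynomial of degree at most ℓ(x) - ℓ(y) - 1.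
  coef_mem : ∀ y, y ≠ x → coef b y c ∈ expIn (-len b x) (-len b y)
  lt : ∀ y, y ≠ x → coef b y c ≠ 0 → BruhatLT b y x

variable {b}

/-- The difference is self-dual with exponents at y below -ℓ(y), so `eq_zero_of_bar_eq` applies. -/
lemma IsKL.eq {x : ExtWeyl P} {c c' : Hecke b} (h : IsKL b x c) (h' : IsKL b x c') : c = c' := by
  have h1 : c + (-1 : A) • c' = 0 := by
    refine eq_zero_of_bar_eq ?_ ?_
    · rw [map_add, bar_smul, h.bar_eq, h'.bar_eq, map_neg, map_one]
    · intro y n hn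
      rw [map_add, map_smul, smul_eq_mul, neg_one_mul] at hn
      rcases eq_or_ne y x with rfl | hy
      · rw [h.coef_self, h'.coef_self, add_neg_cancel] at hn
        exact absurd rfl hn
      · exact (((expIn _ _).add_mem (h.coef_mem y hy)
          ((expIn _ _).neg_mem (h'.coef_mem y hy))) n hn).2
  calc c = (c + (-1 : A) • c') + c' := by
        rw [add_assoc]
        nth_rewrite 2 [← one_smul A c']
        rw [← add_smul, neg_add_cancel, zero_smul, add_zero]
    _ = c' := by rw [h1, zero_add]

lemma IsKL.coef_mem' {x : ExtWeyl P} {c : Hecke b} (h : IsKL b x c) (y : ExtWeyl P) :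
    coef b y c ∈ expIn (-len b x) (-len b y + 1) := by
  rcases eq_or_ne y x with rfl | hy
  · rw [h.coef_self]
    exact vpow_mem_expIn _
  · exact expIn_mono le_rfl (by lia) (h.coef_mem y hy)

lemma IsKL.eq_or_lt {x : ExtWeyl P} {c : Hecke b} (h : IsKL b x c) {y : ExtWeyl P}
    (hy : coef b y c ≠ 0) : y = x ∨ BruhatLT b y x := by
  rcases eq_or_ne y x with h1 | h1
  · exact Or.inl h1
  · exact Or.inr (h.lt y h1 hy)

lemma IsKL.coef_eq_zero {x : ExtWeyl P} {c : Hecke b} (h : IsKL b x c) {y : ExtWeyl P}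
    (hy : y ≠ x) (hlen : len b x ≤ len b y) : coef b y c = 0 := by
  by_contra h1
  have := (h.lt y hy h1).len_lt
  lia

lemma isKL_of_len_eq_zero {g : ExtWeyl P} (hg : len b g = 0) : IsKL b g (T b g) where
  bar_eq := by
    rw [bar_T]
    refine (eq_Tinv_of_mul_eq_one ?_).symm
    rw [T_zero_mul b hg, mul_inv_cancel, T_one]
  coef_self := by
    rw [coef_T_self, hg, Nat.cast_zero, neg_zero, vpow_zero]
  coef_mem y hy := by
    rw [coef_T_of_ne b hy.symm]
    exact (expIn _ _).zero_mem
  lt y hy h := absurd (coef_T_of_ne b hy.symm) h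

/-- Left multiplication by the Kazhdan-Lusztig element of a simple reflection. -/
lemma exists_pre_isKL {s w : ExtWeyl P} (hs : s ∈ affRefl b) (hw : len b w < len b (s * w))
    {c : Hecke b} (hc : IsKL b w c) :
    ∃ d : Hecke b, bar b d = d ∧ T b s * d = vpow 2 • d ∧
      coef b (s * w) d = vpow (-len b (s * w)) ∧
      (∀ y, y ≠ s * w → coef b y d ≠ 0 → BruhatLT b y (s * w)) ∧
      (∀ y, y ≠ s * w → coef b y d ∈ expIn (-len b (s * w)) (-len b y + 1)) ∧
      ∀ y, y ≠ s * w → (coef b y d).coeff (-len b y) ≠ 0 → len b (s * y) < len b y := by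
  have hE := isExtCoxeter b
  have hlen : len b (s * w) = len b w + 1 := by
    have := hE.len_mul s hs w
    lia
  have hwx : BruhatLT b w (s * w) := bruhatLT_simple_mul hs hw
  have hup : ∀ y, len b y < len b (s * y) →
      coef b y (vpow (-1) • (T b s * c + c)) =
        vpow 1 * coef b (s * y) c + vpow (-1) * coef b y c := fun y hy => by
    rw [map_smul, map_add, (coef_T_mul b hs hy c).1, smul_eq_mul, mul_add, ← mul_assoc, vpow_mul]
    rfl
  have hdown : ∀ y, len b (s * y) < len b y →
      coef b y (vpow (-1) • (T b s * c + c)) =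
        vpow (-1) * coef b (s * y) c + vpow 1 * coef b y c := fun y hy => by
    have h1 := (coef_T_mul b hs (y := s * y) (by rwa [hE.mul_mul_self hs]) c).2
    have h2 : vpow (-1) * vpow 2 = vpow 1 := vpow_mul _ _
    rw [hE.mul_mul_self hs] at h1
    rw [map_smul, map_add, h1, smul_eq_mul, ← h2]
    ring
  -- The factor v⁻¹ (T_s + 1) is self-dual, and (T_s - v²)(T_s + 1) = 0 gives the eigenvector
  -- property.
  refine ⟨vpow (-1) • (T b s * c + c), ?_, ?_, ?_, ?_, ?_, ?_⟩
  · have h1 : invert (vpow (-1)) = vpow (-1) * vpow 2 := by rw [invert_vpow, vpow_mul]; rfl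
    have h2 : vpow 2 * vpow (-2) = 1 := by rw [vpow_mul]; exact vpow_zero
    rw [bar_smul, map_add, map_mul, hc.bar_eq, bar_T, hE.inv_eq hs, Tinv_simple b hs, add_mul,
      smul_mul_assoc, smul_mul_assoc, one_mul, h1, mul_smul, add_assoc]
    congr 1
    nth_rewrite 3 [← one_smul A c]
    rw [← add_smul, sub_add_cancel, ← smul_add, smul_smul, h2, one_smul]
  · rw [mul_smul_comm, smul_comm]
    congr 1
    rw [mul_add, ← mul_assoc, T_sq b hs, add_mul, smul_mul_assoc, smul_mul_assoc, one_mul,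
      add_assoc]
    nth_rewrite 2 [← one_smul A (T b s * c)]
    rw [← add_smul, sub_add_cancel, smul_add, add_comm]
  · rw [hdown _ (by rwa [hE.mul_mul_self hs]), hE.mul_mul_self hs, hc.coef_self,
      hc.coef_eq_zero (y := s * w) (fun h => by rw [h] at hw; exact lt_irrefl _ hw) hw.le, vpow_mul,
      mul_zero, add_zero, hlen]
    congr 1
    push_cast
    ring
  · intro y hy h1
    have h2 : coef b (s * y) c ≠ 0 ∨ coef b y c ≠ 0 := by
      by_contra! h2
      rcases lt_or_ge (len b y) (len b (s * y)) with h3 | h3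
      · exact h1 (by rw [hup y h3, h2.1, h2.2, mul_zero, mul_zero, add_zero])
      · have := hE.len_mul s hs y
        exact h1 (by rw [hdown y (by lia), h2.1, h2.2, mul_zero, mul_zero, add_zero])
    rcases h2 with h2 | h2
    · rcases hc.eq_or_lt h2 with h3 | h3
      · exact absurd (by rw [← h3, hE.mul_mul_self hs]) hy
      · rcases lt_or_ge (len b y) (len b (s * y)) with h4 | h4
        · exact ((bruhatLT_simple_mul hs h4).trans h3).trans hwx
        · have := h3.simple_mul hs hw
          rwa [hE.mul_mul_self hs] at this
    · rcases hc.eq_or_lt h2 with rfl | h3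
      · exact hwx
      · exact h3.trans hwx
  · intro y hy
    rcases lt_or_ge (len b y) (len b (s * y)) with h3 | h3
    · have h4 := hE.len_mul s hs y
      rw [hup y h3]
      exact (expIn _ _).add_mem
        (expIn_mono (by lia) (by lia) (vpow_mul_mem_expIn 1 (hc.coef_mem' (s * y))))
        (expIn_mono (by lia) (by lia) (vpow_mul_mem_expIn (-1) (hc.coef_mem' y)))
    · have h4 := hE.len_mul s hs y
      have h5 : s * y ≠ w := fun h => hy (by rw [← h, hE.mul_mul_self hs])
      have h6 : y ≠ w := by rintro rfl; lia
      rw [hdown y (by lia)]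
      exact (expIn _ _).add_mem
        (expIn_mono (by lia) (by lia) (vpow_mul_mem_expIn (-1) (hc.coef_mem (s * y) h5)))
        (expIn_mono (by lia) (by lia) (vpow_mul_mem_expIn 1 (hc.coef_mem y h6)))
  -- If s y > y, both terms v · coef(s y) and v⁻¹ · coef(y) have exponents below -ℓ(y), so the
  -- forbidden power v^(-ℓ(y)) occurs only at y with s y < y.
  · intro y hy h1
    by_contra h2
    have h4 := hE.len_mul s hs y
    have h3 : len b y < len b (s * y) := by lia
    have h5 : s * y ≠ w := fun h => hy (by rw [← h, hE.mul_mul_self hs])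
    have h7 : coef b y (vpow (-1) • (T b s * c + c)) ∈ expIn (-len b (s * w)) (-len b y) := by
      rw [hup y h3]
      exact (expIn _ _).add_mem
        (expIn_mono (by lia) (by lia) (vpow_mul_mem_expIn 1 (hc.coef_mem (s * y) h5)))
        (expIn_mono (by lia) (by lia) (vpow_mul_mem_expIn (-1) (hc.coef_mem' y)))
    exact lt_irrefl _ (h7 _ h1).2

/-- The forbidden powers of v are removed by subtracting integer multiples of shorter C_z. Only z
with s z < z are needed, so the result is still an eigenvector of T_s. -/
lemma exists_isKL_simple_mul {s w : ExtWeyl P} (hs : s ∈ affRefl b) (hw : len b w < len b (s * w))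
    {C : ExtWeyl P → Hecke b} (hC : ∀ z, len b z < len b (s * w) → IsKL b z (C z))
    (hC' : ∀ z, len b z < len b (s * w) → len b (s * z) < len b z →
      T b s * C z = vpow 2 • C z) :
    ∃ c, IsKL b (s * w) c ∧ T b s * c = vpow 2 • c := by
  classical
  obtain ⟨d, hbar, hT, hself, hlt, hmem, hdes⟩ := exists_pre_isKL hs hw (hC w hw)
  set x := s * w with hx
  let F : Finset (ExtWeyl P) := ((TBasis b).repr d).support.erase x
  let m : ExtWeyl P → ℤ := fun z => (coef b z d).coeff (-len b z)
  have hF : ∀ z, z ∈ F ↔ z ≠ x ∧ coef b z d ≠ 0 := fun z => by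
    rw [Finset.mem_erase, Finsupp.mem_support_iff]
    rfl
  have hFlt : ∀ z ∈ F, BruhatLT b z x := fun z hz => hlt z ((hF z).mp hz).1 ((hF z).mp hz).2
  have hcoef : ∀ y, coef b y (d + ∑ z ∈ F, LaurentPolynomial.C (-m z) • C z) =
      coef b y d + ∑ z ∈ F, LaurentPolynomial.C (-m z) * coef b y (C z) := fun y => by
    rw [map_add, coef_finset_sum]
    simp only [map_smul, smul_eq_mul]
  refine ⟨d + ∑ z ∈ F, LaurentPolynomial.C (-m z) • C z, ⟨?_, ?_, ?_, ?_⟩, ?_⟩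
  · rw [map_add, hbar, map_sum]
    congr 1
    refine Finset.sum_congr rfl fun z hz => ?_
    rw [bar_smul, LaurentPolynomial.invert_C, (hC z (hFlt z hz).len_lt).bar_eq]
  · rw [hcoef, hself, Finset.sum_eq_zero, add_zero]
    intro z hz
    have h1 := (hFlt z hz).len_lt
    rw [(hC z h1).coef_eq_zero (((hF z).mp hz).1).symm h1.le, mul_zero]
  · intro y hy
    rw [hcoef]
    -- The summand z = y contributes exactly v^(-ℓ(y)) and cancels the forbidden power; the other
    -- summands stay in the window.
    have h1 : coef b y d + ∑ z ∈ F, LaurentPolynomial.C (-m z) * coef b y (C z) =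
        (coef b y d + LaurentPolynomial.C (-m y) * vpow (-len b y)) +
          ∑ z ∈ F.erase y, LaurentPolynomial.C (-m z) * coef b y (C z) := by
      by_cases h2 : y ∈ F
      · rw [← Finset.add_sum_erase F _ h2, (hC y (hFlt y h2).len_lt).coef_self, add_assoc]
      · have h3 : coef b y d = 0 := by
          by_contra h3
          exact h2 ((hF y).mpr ⟨hy, h3⟩)
        have h4 : m y = 0 := by
          simp only [m, h3]
          rfl
        rw [Finset.erase_eq_of_notMem h2, h4, neg_zero, map_zero, zero_mul, add_zero]
    rw [h1]
    refine (expIn _ _).add_mem (add_C_neg_coeff_mem_expIn (hmem y hy))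
      ((expIn _ _).sum_mem fun z hz => C_mul_mem_expIn _ ?_)
    have h5 := (hFlt z (Finset.mem_of_mem_erase hz)).len_lt
    exact expIn_mono (by lia) le_rfl ((hC z h5).coef_mem y (Finset.ne_of_mem_erase hz).symm)
  · intro y hy h1
    rw [hcoef] at h1
    by_cases h2 : coef b y d = 0
    · rw [h2, zero_add] at h1
      obtain ⟨z, hz, h3⟩ := Finset.exists_ne_zero_of_sum_ne_zero h1
      have h4 := hFlt z hz
      rcases (hC z h4.len_lt).eq_or_lt (right_ne_zero_of_mul h3) with rfl | h5
      · exact h4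
      · exact h5.trans h4
    · exact hlt y hy h2
  · rw [mul_add, hT, Finset.mul_sum, smul_add, Finset.smul_sum]
    congr 1
    refine Finset.sum_congr rfl fun z hz => ?_
    rw [mul_smul_comm]
    by_cases h1 : m z = 0
    · rw [h1, neg_zero, map_zero, zero_smul, zero_smul, smul_zero]
    · rw [hC' z (hFlt z hz).len_lt (hdes z ((hF z).mp hz).1 h1), smul_comm]

/-- Each descent s of x yields a candidate that is an eigenvector of T_s; by uniqueness all
candidates coincide, so one element serves every descent. -/
lemma exists_isKL_aux (n : ℕ) : ∀ x : ExtWeyl P, len b x < n → ∃ c, IsKL b x c ∧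
    ∀ s ∈ affRefl b, len b (s * x) < len b x → T b s * c = vpow 2 • c := by
  induction n with
  | zero => exact fun x hx => absurd hx (Nat.not_lt_zero _)
  | succ n ih =>
    intro x hx
    classical
    let C : ExtWeyl P → Hecke b := fun z =>
      if h : len b z < n then Classical.choose (ih z h) else 0
    have hC : ∀ z, len b z < n → IsKL b z (C z) ∧
        ∀ s ∈ affRefl b, len b (s * z) < len b z → T b s * C z = vpow 2 • C z := fun z hz => by
      simp only [C, dif_pos hz]
      exact Classical.choose_spec (ih z hz)
    have key : ∀ s ∈ affRefl b, len b (s * x) < len b x →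
        ∃ c, IsKL b x c ∧ T b s * c = vpow 2 • c := fun s hs hlt => by
      have h1 : s * (s * x) = x := (isExtCoxeter b).mul_mul_self hs x
      have h2 := exists_isKL_simple_mul (w := s * x) hs (by rwa [h1]) (C := C)
        (fun z hz => (hC z (by rw [h1] at hz; lia)).1)
        (fun z hz => (hC z (by rw [h1] at hz; lia)).2 s hs)
      rwa [h1] at h2
    rcases Nat.eq_zero_or_pos (len b x) with h0 | h0
    · exact ⟨T b x, isKL_of_len_eq_zero h0, fun s _ h => absurd h (by lia)⟩
    · obtain ⟨s, hs, hlt⟩ := (isExtCoxeter b).exists_descent x h0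
      obtain ⟨c, hc, -⟩ := key s hs hlt
      refine ⟨c, hc, fun s' hs' hlt' => ?_⟩
      obtain ⟨c', hc', h⟩ := key s' hs' hlt'
      rwa [hc.eq hc']

variable (b) in
lemma exists_isKL (x : ExtWeyl P) : ∃ c, IsKL b x c ∧
    ∀ s ∈ affRefl b, len b (s * x) < len b x → T b s * c = vpow 2 • c :=
  exists_isKL_aux (len b x + 1) x (Nat.lt_succ_self _)

/-! ### Comparison of the characterizations -/

variable (b) in
lemma coef_klSum (x y : ExtWeyl P) (p : ExtWeyl P →₀ Polynomial ℤ) :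
    coef b y (vpow (-(len b x : ℤ)) • T b x + p.sum fun y q =>
      (vpow (-(len b x : ℤ)) * Polynomial.toLaurent q) • T b y) =
    vpow (-(len b x : ℤ)) * coef b y (T b x) +
      vpow (-(len b x : ℤ)) * Polynomial.toLaurent (p y) := by
  rw [map_add, map_smul, Finsupp.sum, coef_finset_sum, smul_eq_mul]
  congr 1
  simp only [map_smul, smul_eq_mul]
  rw [Finset.sum_eq_single y]
  · rw [coef_T_self, mul_one]
  · intro z _ hz
    rw [coef_T_of_ne b hz, mul_zero]
  · intro hy
    rw [Finsupp.notMem_support_iff.mp hy, map_zero, mul_zero, zero_mul]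

/-- Multiplying by v^(ℓ(x)) turns the exponent window into nonnegativity plus the degree bound, so
`LaurentPolynomial.trunc` loses nothing. -/
lemma isKLC'_iff {x : ExtWeyl P} {c : Hecke b} : IsKLC' b x c ↔ IsKL b x c := by
  constructor
  · rintro ⟨hbar, p, hp, hc⟩
    have hpx : p x = 0 := by
      by_contra h
      exact lt_irrefl _ (hp x (Finsupp.mem_support_iff.mpr h)).1.len_lt
    have h1 : ∀ y, y ≠ x → coef b y c = vpow (-(len b x : ℤ)) * Polynomial.toLaurent (p y) :=
      fun y hy => by rw [hc, coef_klSum, coef_T_of_ne b hy.symm, mul_zero, zero_add]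
    refine ⟨hbar, ?_, ?_, ?_⟩
    · rw [hc, coef_klSum, coef_T_self, hpx, map_zero, mul_zero, add_zero, mul_one]
    · intro y hy n hn
      rw [h1 y hy, coeff_vpow_mul] at hn
      have h2 : 0 ≤ n - -(len b x : ℤ) := by
        by_contra h2
        exact hn (coeff_toLaurent_of_neg _ (not_le.mp h2))
      obtain ⟨k, hk⟩ := Int.eq_ofNat_of_zero_le h2
      rw [hk, coeff_toLaurent_natCast] at hn
      have h3 : p y ≠ 0 := by
        intro h3
        rw [h3, Polynomial.coeff_zero] at hn
        exact hn rfl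
      have h4 := (hp y (Finsupp.mem_support_iff.mpr h3)).2
      have h5 := Polynomial.le_natDegree_of_ne_zero hn
      lia
    · intro y hy hn
      refine (hp y (Finsupp.mem_support_iff.mpr fun h3 => hn ?_)).1
      rw [h1 y hy, h3, map_zero, mul_zero]
  · intro h
    classical
    let p : ExtWeyl P →₀ Polynomial ℤ := Finsupp.onFinset ((TBasis b).repr c).support
      (fun y => if y = x then 0 else LaurentPolynomial.trunc (vpow (len b x) * coef b y c))
      (fun y hy => by
        rw [Finsupp.mem_support_iff]
        intro h1
        have h2 : coef b y c = 0 := h1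
        rw [h2, mul_zero, map_zero, ite_self] at hy
        exact hy rfl)
    have hpx : p x = 0 := if_pos rfl
    have hp : ∀ y, y ≠ x → p y = LaurentPolynomial.trunc (vpow (len b x) * coef b y c) :=
      fun y hy => if_neg hy
    refine ⟨h.bar_eq, p, fun y hy => ?_, hecke_ext fun y => ?_⟩
    · rw [Finsupp.mem_support_iff] at hy
      have hyx : y ≠ x := by
        rintro rfl
        exact hy hpx
      rw [hp y hyx] at hy ⊢
      refine ⟨h.lt y hyx fun h1 => hy (by rw [h1, mul_zero, map_zero]), ?_⟩
      have h1 : (LaurentPolynomial.trunc (vpow (len b x) * coef b y c)).leadingCoeff ≠ 0 :=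
        Polynomial.leadingCoeff_ne_zero.mpr hy
      rw [Polynomial.leadingCoeff, coeff_trunc, coeff_vpow_mul] at h1
      have h2 := h.coef_mem y hyx _ h1
      lia
    · rw [coef_klSum]
      rcases eq_or_ne y x with rfl | hy
      · rw [hpx, coef_T_self, h.coef_self, map_zero, mul_zero, add_zero, mul_one]
      · rw [coef_T_of_ne b hy.symm, mul_zero, zero_add, hp y hy]
        have h1 : Polynomial.toLaurent (LaurentPolynomial.trunc (vpow (len b x) * coef b y c)) =
            vpow (len b x) * coef b y c := by
          refine LaurentPolynomial.ext fun n => ?_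
          rcases lt_or_ge n 0 with hn | hn
          · rw [coeff_toLaurent_of_neg _ hn, coeff_vpow_mul]
            by_contra h1
            have := h.coef_mem y hy _ (Ne.symm h1)
            lia
          · obtain ⟨k, rfl⟩ := Int.eq_ofNat_of_zero_le hn
            rw [coeff_toLaurent_natCast, coeff_trunc]
        rw [h1, ← mul_assoc, vpow_mul, neg_add_cancel, vpow_zero, one_mul]

variable (b) in
lemma twist_klSum (x : ExtWeyl P) (p : ExtWeyl P →₀ Polynomial ℤ) :
    twist b (vpow (-(len b x : ℤ)) • T b x + p.sum fun y q =>
      ((-1) ^ (len b y + len b x) * vpow ((len b x : ℤ) - 2 * (len b y : ℤ)) *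
        LaurentPolynomial.invert (Polynomial.toLaurent q)) • T b y) =
    ((-1) ^ len b x : A) • (vpow (-(len b x : ℤ)) • T b x + p.sum fun y q =>
      (vpow (-(len b x : ℤ)) * Polynomial.toLaurent q) • T b y) := by
  rw [map_add, smul_add, Finsupp.sum, Finsupp.sum, map_sum, Finset.smul_sum]
  congr 1
  · rw [twist_smul, twist_T, smul_smul, smul_smul, invert_vpow, mul_left_comm, vpow_mul]
    congr 3
    ring
  · refine Finset.sum_congr rfl fun y _ => ?_
    rw [twist_smul, twist_T, smul_smul, smul_smul, map_mul, invert_invert, invert_sign_mul_vpow]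
    congr 1
    have h1 : vpow (-(len b x : ℤ)) =
        vpow (-((len b x : ℤ) - 2 * (len b y : ℤ))) * vpow (-2 * (len b y : ℤ)) := by
      rw [vpow_mul]
      congr 1
      ring
    have h2 : ((-1 : A) ^ len b y) * (-1) ^ len b y = 1 := by
      rw [← pow_add, Even.neg_one_pow ⟨_, rfl⟩]
    rw [h1, pow_add]
    linear_combination ((-1) ^ len b x * vpow (-((len b x : ℤ) - 2 * (len b y : ℤ))) *
      vpow (-2 * (len b y : ℤ)) * Polynomial.toLaurent (p y)) * h2

omit [Finite ι] [P.IsReduced] in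
lemma sign_smul_sign_smul (n : ℕ) (h : Hecke b) : ((-1) ^ n : A) • ((-1) ^ n : A) • h = h := by
  rw [smul_smul, ← pow_add, Even.neg_one_pow ⟨_, rfl⟩, one_smul]

lemma invert_sign (n : ℕ) : invert ((-1) ^ n : A) = (-1) ^ n := by
  rw [map_pow, map_neg, map_one]

/-- The twist carries the expansion of C_x to (-1)^ℓ(x) times that of C'_x with the same
polynomials. -/
lemma isKLC_iff {x : ExtWeyl P} {c : Hecke b} :
    IsKLC b x c ↔ IsKL b x (((-1) ^ len b x : A) • twist b c) := by
  rw [← isKLC'_iff]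
  refine and_congr ?_ (exists_congr fun p => and_congr_right fun _ => ?_)
  · rw [bar_smul, invert_sign, ← twist_bar]
    constructor
    · exact fun h => by rw [h]
    · intro h
      have h1 := congrArg (fun h => twist b (((-1) ^ len b x : A) • h)) h
      simpa only [sign_smul_sign_smul, twist_twist] using h1
  · constructor
    · rintro rfl
      rw [twist_klSum, sign_smul_sign_smul]
    · intro h
      have h1 := congrArg (fun h => twist b (((-1) ^ len b x : A) • h)) h
      simp only [sign_smul_sign_smul, twist_twist] at h1
      rw [h1, ← twist_klSum, twist_twist]

variable (b)

theorem existsUnique_isKLC' (x : ExtWeyl P) : ∃! c, IsKLC' b x c := by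
  obtain ⟨c, hc, -⟩ := exists_isKL b x
  exact ⟨c, isKLC'_iff.mpr hc, fun c' hc' => (isKLC'_iff.mp hc').eq hc⟩

lemma isKL_klC' (x : ExtWeyl P) : IsKL b x (klC' b x) :=
  isKLC'_iff.mp (Classical.epsilon_spec (p := IsKLC' b x) (existsUnique_isKLC' b x).exists)

theorem existsUnique_isKLC (x : ExtWeyl P) : ∃! c, IsKLC b x c := by
  refine ⟨twist b (((-1) ^ len b x : A) • klC' b x), ?_, fun c hc => ?_⟩
  · beta_reduce
    rw [isKLC_iff, twist_twist, sign_smul_sign_smul]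
    exact isKL_klC' b x
  · rw [← (isKLC_iff.mp hc).eq (isKL_klC' b x), sign_smul_sign_smul, twist_twist]

lemma isKLC_klC (x : ExtWeyl P) : IsKLC b x (klC b x) :=
  Classical.epsilon_spec (p := IsKLC b x) (existsUnique_isKLC b x).exists

lemma klC_eq (x : ExtWeyl P) : klC b x = ((-1) ^ len b x : A) • twist b (klC' b x) := by
  rw [← (isKLC_iff.mp (isKLC_klC b x)).eq (isKL_klC' b x), twist_smul, invert_sign,
    sign_smul_sign_smul, twist_twist]

lemma bar_klC' (x : ExtWeyl P) : bar b (klC' b x) = klC' b x := (isKL_klC' b x).bar_eq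

lemma bar_klC (x : ExtWeyl P) : bar b (klC b x) = klC b x := (isKLC_klC b x).1

variable {b}

lemma T_mul_klC' {s x : ExtWeyl P} (hs : s ∈ affRefl b) (h : len b (s * x) < len b x) :
    T b s * klC' b x = vpow 2 • klC' b x := by
  obtain ⟨c, hc, hT⟩ := exists_isKL b x
  rw [(isKL_klC' b x).eq hc]
  exact hT s hs h

/-- Length and Bruhat order are invariant under inversion, so the image satisfies the
characterization at x⁻¹. -/
lemma rev_klC' (x : ExtWeyl P) : rev b (klC' b x) = klC' b x⁻¹ := by
  have hE := isExtCoxeter b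
  have hc := isKL_klC' b x
  refine IsKL.eq (x := x⁻¹) ⟨?_, ?_, ?_, ?_⟩ (isKL_klC' b x⁻¹)
  · rw [← rev_bar, hc.bar_eq]
  · rw [coef_rev, inv_inv, hc.coef_self, hE.len_inv]
  · intro y hy
    rw [coef_rev, hE.len_inv, ← hE.len_inv y]
    exact hc.coef_mem _ fun h => hy (by rw [← h, inv_inv])
  · intro y hy h
    rw [coef_rev] at h
    have h1 := (hc.lt _ (fun h => hy (by rw [← h, inv_inv])) h).inv
    rwa [inv_inv] at h1

lemma klC'_mul_T {s x : ExtWeyl P} (hs : s ∈ affRefl b) (h : len b (x * s) < len b x) :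
    klC' b x * T b s = vpow 2 • klC' b x := by
  have hE := isExtCoxeter b
  have h1 := congrArg (rev b) (T_mul_klC' (x := x⁻¹) hs (by
    rwa [hE.len_inv x, ← hE.len_inv, mul_inv_rev, inv_inv, hE.inv_eq hs]))
  rwa [rev_mul, map_smul, rev_klC', inv_inv, rev_T, hE.inv_eq hs] at h1

lemma twist_T_simple {s : ExtWeyl P} (hs : s ∈ affRefl b) :
    twist b (T b s) = (-vpow (-2)) • T b s := by
  rw [twist_T, (isExtCoxeter b).len_simple hs, pow_one, neg_one_mul]
  rfl

/-- The twist of T_s C'_x = v² C'_x reads -v⁻² T_s C_x = v⁻² C_x. -/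
lemma T_mul_klC {s x : ExtWeyl P} (hs : s ∈ affRefl b) (h : len b (s * x) < len b x) :
    T b s * klC b x = (-1 : A) • klC b x := by
  have h1 := congrArg (twist b) (T_mul_klC' hs h)
  have h2 : -vpow 2 * -vpow (-2) = 1 := by rw [neg_mul_neg, vpow_mul]; exact vpow_zero
  rw [map_mul, twist_smul, invert_vpow, twist_T_simple hs, smul_mul_assoc] at h1
  have h3 := congrArg (fun h => (-vpow 2) • h) h1
  simp only [smul_smul, h2, one_smul] at h3
  rw [klC_eq, mul_smul_comm, h3, smul_comm, neg_mul, vpow_mul, add_neg_cancel, vpow_zero]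

lemma klC_mul_T {s x : ExtWeyl P} (hs : s ∈ affRefl b) (h : len b (x * s) < len b x) :
    klC b x * T b s = (-1 : A) • klC b x := by
  have h1 := congrArg (twist b) (klC'_mul_T hs h)
  have h2 : -vpow 2 * -vpow (-2) = 1 := by rw [neg_mul_neg, vpow_mul]; exact vpow_zero
  rw [map_mul, twist_smul, invert_vpow, twist_T_simple hs, mul_smul_comm] at h1
  have h3 := congrArg (fun h => (-vpow 2) • h) h1
  simp only [smul_smul, h2, one_smul] at h3
  rw [klC_eq, smul_mul_assoc, h3, smul_comm, neg_mul, vpow_mul, add_neg_cancel, vpow_zero]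

end AffHecke

end

/-! ### The map χ^{IJ}: vanishing, independence and splitting. -/

noncomputable section

namespace AffHecke

open LaurentPolynomial (invert)

variable {ι X Y : Type*} [AddCommGroup X] [AddCommGroup Y]
variable {P : RootPairing ι ℤ X Y} {b : P.Base} [Finite ι] [P.IsReduced]

/-! ### The Kazhdan-Lusztig basis spans -/

/-- C'_x is a unit multiple of T_x plus shorter terms, so T_x is recovered by induction on length.
-/
lemma span_klC' : Submodule.span A (Set.range (klC' b)) = ⊤ := by
  have key : ∀ x, T b x ∈ Submodule.span A (Set.range (klC' b)) := by
    intro x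
    induction hn : len b x using Nat.strong_induction_on generalizing x with
    | _ n ih =>
      classical
      have hc := isKL_klC' b x
      have h1 : klC' b x = vpow (-len b x) • T b x +
          ∑ y ∈ ((TBasis b).repr (klC' b x)).support.erase x, coef b y (klC' b x) • T b y := by
        conv_lhs => rw [hecke_eq_sum (klC' b x), Finsupp.sum]
        rw [← hc.coef_self]
        refine (Finset.add_sum_erase _ _ ?_).symm
        rw [Finsupp.mem_support_iff]
        change coef b x (klC' b x) ≠ 0
        rw [hc.coef_self]
        exact (LaurentPolynomial.isUnit_T _).ne_zero
      have h2 : ∑ y ∈ ((TBasis b).repr (klC' b x)).support.erase x, coef b y (klC' b x) • T b y ∈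
          Submodule.span A (Set.range (klC' b)) := by
        refine Submodule.sum_mem _ fun y hy => Submodule.smul_mem _ _ (ih _ ?_ y rfl)
        rw [Finset.mem_erase, Finsupp.mem_support_iff] at hy
        have := (hc.lt y hy.1 hy.2).len_lt
        lia
      have h3 : klC' b x ∈ Submodule.span A (Set.range (klC' b)) := Submodule.subset_span ⟨x, rfl⟩
      rw [h1] at h3
      have h4 := Submodule.smul_mem _ (vpow (len b x))
        (Submodule.add_mem _ h3 (Submodule.smul_mem _ (-1) h2))
      generalize ∑ y ∈ ((TBasis b).repr (klC' b x)).support.erase x,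
        coef b y (klC' b x) • T b y = r at h4
      nth_rewrite 1 [← one_smul A r] at h4
      rwa [add_assoc, ← add_smul, add_neg_cancel, zero_smul, add_zero, smul_smul, vpow_mul,
        add_neg_cancel, vpow_zero, one_smul] at h4
  rw [eq_top_iff, ← T_span b, Submodule.span_le]
  rintro _ ⟨x, rfl⟩
  exact key x

/-! ### Vanishing -/

lemma eq_zero_of_smul_eq {h : Hecke b} (H : vpow 2 • h = (-1 : A) • h) : h = 0 := by
  have h1 : vpow 2 + 1 ≠ 0 := by
    intro h1
    have h2 := congrArg (fun a : A => a.coeff 0) h1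
    change (vpow 2).coeff 0 + (1 : A).coeff 0 = 0 at h2
    rw [← vpow_zero, vpow, vpow, LaurentPolynomial.T_apply, LaurentPolynomial.T_apply] at h2
    norm_num at h2
  refine hecke_ext fun y => ?_
  have h2 := congrArg (coef b y) H
  rw [map_smul, map_smul, smul_eq_mul, smul_eq_mul] at h2
  have h3 : (vpow 2 + 1) * coef b y h = 0 := by linear_combination h2
  rw [(mul_eq_zero.mp h3).resolve_left h1, map_zero]

variable {I J : Set (ExtWeyl P)}

lemma isLongest_longest (hI : I ⊆ simpleRefl b) : IsLongest b I (longest b I) :=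
  Classical.epsilon_spec (p := IsLongest b I) (existsUnique_isLongest hI).exists

lemma T_mul_klC_longest (hI : I ⊆ simpleRefl b) {s : ExtWeyl P} (hs : s ∈ I) :
    T b s * klC b (longest b I) = (-1 : A) • klC b (longest b I) := by
  have hw := isLongest_longest hI
  have hsS := simpleRefl_subset (hI hs)
  refine T_mul_klC hsS ?_
  have h1 := hw.2 _ (mul_mem (Subgroup.subset_closure hs) hw.1)
  have h2 := (isExtCoxeter b).len_mul s hsS (longest b I)
  lia

lemma klC_longest_mul_T (hI : I ⊆ simpleRefl b) {s : ExtWeyl P} (hs : s ∈ I) :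
    klC b (longest b I) * T b s = (-1 : A) • klC b (longest b I) := by
  have hw := isLongest_longest hI
  have hsS := simpleRefl_subset (hI hs)
  refine klC_mul_T hsS ?_
  have h1 := hw.2 _ (mul_mem hw.1 (Subgroup.subset_closure hs))
  have h2 := (isExtCoxeter b).len_mul_right hsS (longest b I)
  lia

omit [Finite ι] [P.IsReduced] in
lemma chi_apply (h : Hecke b) :
    chi b I J h = klC b (longest b I) * h * klC b (longest b J) := (mul_assoc _ _ _).symm

/-- In C_{w_I} T_s C'_x the letter s acts by -1 on the left factor and by v² on the right one. -/
lemma chi_klC'_of_left (hI : I ⊆ simpleRefl b) {s x : ExtWeyl P} (hs : s ∈ I)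
    (hx : len b (s * x) < len b x) : chi b I J (klC' b x) = 0 := by
  rw [chi_apply]
  suffices klC b (longest b I) * klC' b x = 0 by rw [this, zero_mul]
  refine eq_zero_of_smul_eq ?_
  rw [← mul_smul_comm, ← T_mul_klC' (simpleRefl_subset (hI hs)) hx, ← mul_assoc,
    klC_longest_mul_T hI hs, smul_mul_assoc]

lemma chi_klC'_of_right (hJ : J ⊆ simpleRefl b) {s x : ExtWeyl P} (hs : s ∈ J)
    (hx : len b (x * s) < len b x) : chi b I J (klC' b x) = 0 := by
  rw [chi_apply, mul_assoc]
  suffices klC' b x * klC b (longest b J) = 0 by rw [this, mul_zero]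
  refine eq_zero_of_smul_eq ?_
  rw [← smul_mul_assoc, ← klC'_mul_T (simpleRefl_subset (hJ hs)) hx, mul_assoc,
    T_mul_klC_longest hJ hs, mul_smul_comm]

lemma chi_klC'_eq_zero (hI : I ⊆ simpleRefl b) (hJ : J ⊆ simpleRefl b) {x : ExtWeyl P}
    (hx : ∀ p, x ≠ minElt b I J p) : chi b I J (klC' b x) = 0 := by
  by_contra h
  have h1 : ∃ p : Idx b I J, x = minElt b I J p := by
    refine exists_eq_minElt hI hJ (fun s hs => ?_) (fun s hs => ?_)
    · by_contra h1
      have h2 := (isExtCoxeter b).len_mul s (simpleRefl_subset (hI hs)) x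
      exact h (chi_klC'_of_left hI hs (by lia))
    · by_contra h1
      have h2 := (isExtCoxeter b).len_mul_right (simpleRefl_subset (hJ hs)) x
      exact h (chi_klC'_of_right hJ hs (by lia))
  obtain ⟨p, hp⟩ := h1
  exact hx p hp

/-! ### Supports -/

variable (b) in
/-- The elements of the Hecke algebra supported on `Z`. -/
def suppIn (Z : Set (ExtWeyl P)) : Submodule A (Hecke b) where
  carrier := {h | ∀ y, coef b y h ≠ 0 → y ∈ Z}
  zero_mem' y hy := absurd (map_zero _) hy
  add_mem' {h h'} H H' y hy := by
    by_contra h1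
    have h2 : coef b y h = 0 := by by_contra h3; exact h1 (H y h3)
    have h3 : coef b y h' = 0 := by by_contra h3; exact h1 (H' y h3)
    exact hy (by rw [map_add, h2, h3, add_zero])
  smul_mem' a h H y hy := by
    rw [map_smul] at hy
    exact H y (right_ne_zero_of_smul hy)

lemma mem_suppIn {Z : Set (ExtWeyl P)} {h : Hecke b} :
    h ∈ suppIn b Z ↔ ∀ y, coef b y h ≠ 0 → y ∈ Z := Iff.rfl

lemma T_simple_mul_mem_suppIn {Z : Set (ExtWeyl P)} {s : ExtWeyl P} (hs : s ∈ affRefl b)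
    (hZ : ∀ z ∈ Z, s * z ∈ Z) {h : Hecke b} (hh : h ∈ suppIn b Z) : T b s * h ∈ suppIn b Z := by
  have hE := isExtCoxeter b
  intro y hy
  by_contra h1
  have h2 : coef b y h = 0 := by by_contra h3; exact h1 (hh y h3)
  have h3 : coef b (s * y) h = 0 := by
    by_contra h3
    have h4 := hZ _ (hh _ h3)
    rw [hE.mul_mul_self hs] at h4
    exact h1 h4
  refine hy ?_
  rcases lt_or_ge (len b y) (len b (s * y)) with h4 | h4
  · rw [(coef_T_mul b hs h4 h).1, h3, mul_zero]
  · have h5 := hE.len_mul s hs y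
    have h6 := (coef_T_mul b hs (y := s * y) (by rw [hE.mul_mul_self hs]; lia) h).2
    rw [hE.mul_mul_self hs] at h6
    rw [h6, h2, h3, mul_zero, add_zero]

lemma T_mul_mem_suppIn (hI : I ⊆ affRefl b) {Z : Set (ExtWeyl P)}
    (hZ : ∀ s ∈ I, ∀ z ∈ Z, s * z ∈ Z) {u : ExtWeyl P} (hu : u ∈ para I) {h : Hecke b}
    (hh : h ∈ suppIn b Z) : T b u * h ∈ suppIn b Z := by
  have hE := isExtCoxeter b
  induction hn : len b u using Nat.strong_induction_on generalizing u with
  | _ n ih =>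
    by_cases h1 : u = 1
    · rw [h1, T_one, one_mul]
      exact hh
    · obtain ⟨s, hs, hlt⟩ := hE.exists_descent_mem hI hu h1
      have h2 := ih _ (by lia) (mul_mem (Subgroup.subset_closure hs) hu) rfl
      have h3 := T_simple_mul_mem_suppIn (hI hs) (hZ s hs) h2
      rwa [← mul_assoc, T_simple_mul b (hI hs) (by rwa [hE.mul_mul_self (hI hs)]),
        hE.mul_mul_self (hI hs)] at h3

lemma mul_mem_suppIn (hI : I ⊆ affRefl b) {Z : Set (ExtWeyl P)}
    (hZ : ∀ s ∈ I, ∀ z ∈ Z, s * z ∈ Z) {a h : Hecke b} (ha : a ∈ suppIn b (para I))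
    (hh : h ∈ suppIn b Z) : a * h ∈ suppIn b Z := by
  rw [hecke_eq_sum a, Finsupp.sum, Finset.sum_mul]
  refine Submodule.sum_mem _ fun u hu => ?_
  rw [smul_mul_assoc]
  exact Submodule.smul_mem _ _ (T_mul_mem_suppIn hI hZ (ha u (Finsupp.mem_support_iff.mp hu)) hh)

lemma rev_mem_suppIn {Z : Set (ExtWeyl P)} {h : Hecke b} :
    rev b h ∈ suppIn b Z ↔ h ∈ suppIn b Z⁻¹ := by
  simp only [mem_suppIn, coef_rev, Set.mem_inv]
  exact ⟨fun H y hy => H y⁻¹ (by rwa [inv_inv]), fun H y hy => by simpa using H y⁻¹ hy⟩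

lemma mul_mem_suppIn_right (hJ : J ⊆ affRefl b) {Z : Set (ExtWeyl P)}
    (hZ : ∀ s ∈ J, ∀ z ∈ Z, z * s ∈ Z) {a h : Hecke b} (ha : a ∈ suppIn b (para J))
    (hh : h ∈ suppIn b Z) : h * a ∈ suppIn b Z := by
  rw [← rev_rev (h * a), rev_mem_suppIn, rev_mul]
  refine mul_mem_suppIn hJ ?_ ?_ ?_
  · intro s hs z hz
    have h1 := hZ s hs _ hz
    rwa [Set.mem_inv, mul_inv_rev, (isExtCoxeter b).inv_eq (hJ hs)]
  · rw [rev_mem_suppIn]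
    intro y hy
    exact inv_mem (ha y hy)
  · rwa [rev_mem_suppIn, inv_inv]

/-- C'_{w_I} is supported below w_I, hence on W_I, and the twist creates no new support. -/
lemma klC_longest_mem_suppIn (hI : I ⊆ simpleRefl b) :
    klC b (longest b I) ∈ suppIn b (para I) := by
  intro y hy
  have hw := isLongest_longest hI
  rw [klC_eq, map_smul, coef_twist] at hy
  have h1 : coef b y (klC' b (longest b I)) ≠ 0 := by
    intro h1
    rw [h1, map_zero, mul_zero, smul_zero] at hy
    exact hy rfl
  rcases (isKL_klC' b _).eq_or_lt h1 with rfl | h2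
  · exact hw.1
  · exact h2.mem_para (hI.trans simpleRefl_subset) hw.1

/-! ### Specialization at `v = 1` -/

/-- The specialization `v ↦ 1`. -/
def eps : A →+* ℤ := LaurentPolynomial.eval₂ (RingHom.id ℤ) 1

lemma eps_vpow (n : ℤ) : eps (vpow n) = 1 := by
  rw [eps, LaurentPolynomial.eval₂_T, one_zpow, Units.val_one]

/-- At v = 1 the quadratic relation becomes s² = 1, and the algebra maps to the integral group ring.
-/
lemma eps_coef_T_mul_T_mul_T (x y w z : ExtWeyl P) [Decidable (x * y * w = z)] :
    eps (coef b z (T b x * T b y * T b w)) = if x * y * w = z then 1 else 0 := by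
  classical
  have hE := isExtCoxeter b
  obtain ⟨F, hF, hFT⟩ := exists_lift (b := b)
    ((algebraMap ℤ (MonoidAlgebra ℤ (ExtWeyl P))).comp eps) (fun a r => Algebra.commutes (eps a) r)
    (MonoidAlgebra.of ℤ (ExtWeyl P)) (map_one _) (fun x y _ => (map_mul _ x y).symm)
    (fun s hs => by
      rw [← map_mul, hE.sq s hs, RingHom.comp_apply, RingHom.comp_apply, map_sub eps, map_one eps,
        eps_vpow, sub_self, map_zero, zero_mul, add_zero, map_one, map_one])
  have key : ∀ h, (F h).coeff z = eps (coef b z h) := fun h => by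
    refine hecke_induction (p := fun h => (F h).coeff z = eps (coef b z h)) h ?_ ?_ ?_
    · intro a x
      rw [hF, hFT, RingHom.comp_apply, ← Algebra.smul_def, map_smul, coef_T]
      change eps a • (Finsupp.single x (1 : ℤ)) z = _
      rw [Finsupp.single_apply, smul_eq_mul, smul_eq_mul, map_mul]
      split_ifs <;> simp
    · rw [map_zero, map_zero, map_zero]
      rfl
    · intro h h' h1 h2
      rw [map_add, map_add, map_add, ← h1, ← h2]
      rfl
  rw [← key, map_mul, map_mul, hFT, hFT, hFT, ← map_mul, ← map_mul]
  change (Finsupp.single (x * y * w) (1 : ℤ)) z = _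
  rw [Finsupp.single_apply]

/-- The relation T_s C_{w_I} = -C_{w_I} at v = 1 makes coefficients alternate along each letter. -/
lemma eps_coef_klC_longest (hI : I ⊆ simpleRefl b) {u : ExtWeyl P} (hu : u ∈ para I) :
    eps (coef b u (klC b (longest b I))) =
      (-1) ^ len b u * eps (coef b 1 (klC b (longest b I))) := by
  have hE := isExtCoxeter b
  induction hn : len b u using Nat.strong_induction_on generalizing u with
  | _ n ih =>
    by_cases h1 : u = 1
    · rw [← hn, h1, hE.len_one, pow_zero, one_mul]
    · have hIS := hI.trans simpleRefl_subset
      obtain ⟨s, hs, hlt⟩ := hE.exists_descent_mem hIS hu h1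
      have h2 := ih _ (by lia) (mul_mem (Subgroup.subset_closure hs) hu) rfl
      have h3 := (coef_T_mul b (hIS hs) (y := s * u) (by rwa [hE.mul_mul_self (hIS hs)])
        (klC b (longest b I))).1
      rw [T_mul_klC_longest hI hs, hE.mul_mul_self (hIS hs), map_smul, smul_eq_mul] at h3
      have h4 := congrArg eps h3
      rw [map_mul, map_mul, eps_vpow, map_neg, map_one, one_mul, h2] at h4
      have h5 := hE.len_mul s (hIS hs) u
      rw [← h4, ← hn, show len b u = len b (s * u) + 1 by lia, pow_succ]
      ring

/-- If it vanished, so would the coefficient at w_I, which is v^(-ℓ(w_I)) and specializes to 1. -/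
lemma eps_coef_one_klC_longest_ne_zero (hI : I ⊆ simpleRefl b) :
    eps (coef b 1 (klC b (longest b I))) ≠ 0 := by
  intro h
  have h1 := eps_coef_klC_longest hI (isLongest_longest hI).1
  rw [h, mul_zero, klC_eq, map_smul, coef_twist, (isKL_klC' b _).coef_self, invert_vpow, smul_eq_mul,
    map_mul, map_mul, map_mul, eps_vpow, eps_vpow, mul_one, mul_one, ← map_mul, ← pow_add,
    Even.neg_one_pow ⟨_, rfl⟩, map_one] at h1
  exact one_ne_zero h1

/-! ### Linear independence -/

/-- At v = 1 the coefficient is a sum over u m w = m of a fixed nonzero integer times (-1)^(ℓ(u) +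
ℓ(w)). Parity of length makes every such sign +1, so the sum is that integer times the number of
solutions. -/
lemma coef_klC_mul_T_mul_klC_ne_zero (hI : I ⊆ simpleRefl b) (hJ : J ⊆ simpleRefl b)
    (m : ExtWeyl P) :
    coef b m (klC b (longest b I) * T b m * klC b (longest b J)) ≠ 0 := by
  classical
  have hE := isExtCoxeter b
  set a := klC b (longest b I) with ha
  set c := klC b (longest b J) with hc
  set e := eps (coef b 1 a) * eps (coef b 1 c) with he
  have he0 : e ≠ 0 := mul_ne_zero (eps_coef_one_klC_longest_ne_zero hI)
    (eps_coef_one_klC_longest_ne_zero hJ)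
  set U := ((TBasis b).repr a).support with hU
  set V := ((TBasis b).repr c).support with hV
  have h1 : eps (coef b m (a * T b m * c)) =
      ∑ u ∈ U, ∑ w ∈ V, if u * m * w = m then e else 0 := by
    conv_lhs => rw [hecke_eq_sum a, hecke_eq_sum c, Finsupp.sum, Finsupp.sum, Finset.sum_mul,
      Finset.sum_mul_sum]
    rw [coef_finset_sum, map_sum]
    refine Finset.sum_congr rfl fun u hu => ?_
    rw [coef_finset_sum, map_sum]
    refine Finset.sum_congr rfl fun w hw => ?_
    rw [smul_mul_assoc, smul_mul_smul_comm, map_smul, smul_eq_mul, map_mul,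
      eps_coef_T_mul_T_mul_T]
    split_ifs with h1
    · have hu' : u ∈ para I := klC_longest_mem_suppIn hI u (Finsupp.mem_support_iff.mp hu)
      have hw' : w ∈ para J := klC_longest_mem_suppIn hJ w (Finsupp.mem_support_iff.mp hw)
      have h2 : ((-1 : ℤ) ^ len b u) * (-1) ^ len b w = 1 := by
        have h3 := hE.neg_one_pow_len_mul (R := ℤ) (u * m) w
        rw [h1, hE.neg_one_pow_len_mul (R := ℤ) u m] at h3
        have h4 : ((-1 : ℤ) ^ len b m) * (-1) ^ len b m = 1 := by
          rw [← pow_add, Even.neg_one_pow ⟨_, rfl⟩]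
        linear_combination h4 - (-1) ^ len b m * h3 -
          ((-1 : ℤ) ^ len b u) * (-1) ^ len b w * h4
      rw [mul_one, map_mul]
      change eps (coef b u a) * eps (coef b w c) = e
      rw [eps_coef_klC_longest hI hu', eps_coef_klC_longest hJ hw', he]
      linear_combination (eps (coef b 1 a) * eps (coef b 1 c)) * h2
    · rw [mul_zero]
  have h2 : ∑ u ∈ U, ∑ w ∈ V, (if u * m * w = m then e else 0) =
      ((U ×ˢ V).filter fun q => q.1 * m * q.2 = m).card * e := by
    rw [← Finset.sum_product', ← Finset.sum_filter, Finset.sum_const, nsmul_eq_mul]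
  intro h3
  rw [h3, map_zero, h2] at h1
  have h4 : ((U ×ˢ V).filter fun q => q.1 * m * q.2 = m).card = 0 := by
    exact_mod_cast (mul_eq_zero.mp h1.symm).resolve_right he0
  rw [Finset.card_eq_zero] at h4
  -- The pair (1, 1) is always a solution, so the count is positive.
  have h5 : ((1 : ExtWeyl P), (1 : ExtWeyl P)) ∈ (U ×ˢ V).filter fun q => q.1 * m * q.2 = m := by
    rw [Finset.mem_filter, Finset.mem_product, Finsupp.mem_support_iff, Finsupp.mem_support_iff]
    refine ⟨⟨fun h => ?_, fun h => ?_⟩, by simp⟩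
    · exact eps_coef_one_klC_longest_ne_zero hI (by
        change eps ((TBasis b).repr a 1) = 0
        rw [h, map_zero])
    · exact eps_coef_one_klC_longest_ne_zero hJ (by
        change eps ((TBasis b).repr c 1) = 0
        rw [h, map_zero])
  rw [h4] at h5
  exact absurd h5 (Finset.notMem_empty _)

lemma chi_mem_suppIn (hI : I ⊆ simpleRefl b) (hJ : J ⊆ simpleRefl b) {h : Hecke b}
    {Z : Set (ExtWeyl P)} (hh : h ∈ suppIn b Z) :
    chi b I J h ∈ suppIn b {x | ∃ u ∈ para I, ∃ w ∈ para J, u * x * w ∈ Z} := by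
  rw [chi_apply]
  refine mul_mem_suppIn_right (hJ.trans simpleRefl_subset) ?_ (klC_longest_mem_suppIn hJ)
    (mul_mem_suppIn (hI.trans simpleRefl_subset) ?_ (klC_longest_mem_suppIn hI) ?_)
  · rintro s hs z ⟨u, hu, w, hw, hz⟩
    refine ⟨u, hu, s⁻¹ * w, mul_mem (inv_mem (Subgroup.subset_closure hs)) hw, ?_⟩
    rwa [show u * (z * s) * (s⁻¹ * w) = u * z * w by group]
  · rintro s hs z ⟨u, hu, w, hw, hz⟩
    refine ⟨u * s⁻¹, mul_mem hu (inv_mem (Subgroup.subset_closure hs)), w, hw, ?_⟩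
    rwa [show u * s⁻¹ * (s * z) * w = u * z * w by group]
  · exact fun y hy => ⟨1, one_mem _, 1, one_mem _, by simpa using hh y hy⟩

omit [Finite ι] [P.IsReduced] in
lemma klIJ_eq (p : Idx b I J) : klIJ b I J p = chi b I J (klC' b (minElt b I J p)) :=
  (chi_apply _).symm

/-- All terms of C'_m other than T_m are shorter than m, so they lie outside the double coset of m
and cannot reach T_m. -/
lemma coef_klIJ_self_ne_zero (hI : I ⊆ simpleRefl b) (hJ : J ⊆ simpleRefl b) (p : Idx b I J) :
    coef b (minElt b I J p) (klIJ b I J p) ≠ 0 := by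
  set m := minElt b I J p with hm
  have hmin := isMinIn_minElt hI hJ p
  have hc := isKL_klC' b m
  have h1 : klC' b m + (-vpow (-len b m)) • T b m ∈ suppIn b {y | len b y < len b m} := by
    intro y hy
    rw [map_add, map_smul, smul_eq_mul] at hy
    rcases eq_or_ne y m with rfl | hym
    · rw [hc.coef_self, coef_T_self, mul_one, add_neg_cancel] at hy
      exact absurd rfl hy
    · rw [coef_T_of_ne b hym.symm, mul_zero, add_zero] at hy
      exact (hc.lt y hym hy).len_lt
  have h2 : coef b m (chi b I J (klC' b m + (-vpow (-len b m)) • T b m)) = 0 := by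
    by_contra h2
    obtain ⟨u, hu, w, hw, h3⟩ := chi_mem_suppIn hI hJ h1 m h2
    have h4 := (eq_of_min hI hJ (fun s hs => hmin.left hI hs) (fun t ht => hmin.right hJ ht)
      hu hw).1
    exact absurd h3 (not_lt.mpr h4)
  rw [map_add, map_add, map_smul, map_smul, smul_eq_mul, ← klIJ_eq, neg_mul,
    add_neg_eq_zero] at h2
  rw [h2, chi_apply]
  exact mul_ne_zero (LaurentPolynomial.isUnit_T _).ne_zero
    (coef_klC_mul_T_mul_klC_ne_zero hI hJ m)

/-- A contributing term would lie in the double coset of m_p and be m_q or shorter than m_q;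
minimality of m_p then forces m_p = m_q. -/
lemma coef_klIJ_eq_zero (hI : I ⊆ simpleRefl b) (hJ : J ⊆ simpleRefl b) {p q : Idx b I J}
    (hpq : p ≠ q) (hlen : len b (minElt b I J q) ≤ len b (minElt b I J p)) :
    coef b (minElt b I J p) (klIJ b I J q) = 0 := by
  by_contra h1
  have hp := isMinIn_minElt hI hJ p
  have hc := isKL_klC' b (minElt b I J q)
  have h2 : klC' b (minElt b I J q) ∈
      suppIn b {y | y = minElt b I J q ∨ len b y < len b (minElt b I J q)} := fun y hy =>
    (hc.eq_or_lt hy).imp_right fun h => h.len_lt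
  rw [klIJ_eq] at h1
  obtain ⟨u, hu, w, hw, h3⟩ := chi_mem_suppIn hI hJ h2 _ h1
  have h4 := eq_of_min hI hJ (fun s hs => hp.left hI hs) (fun t ht => hp.right hJ ht) hu hw
  rcases h3 with h3 | h3
  · have h5 := h4.2 (by rw [h3]; exact hlen)
    rw [h5] at h3
    exact hpq (minElt_injective hI hJ h3)
  · lia

/-- In a vanishing combination, the coefficient of T_m for a longest occurring m isolates a single
term. -/
lemma linearIndependent_klIJ (hI : I ⊆ simpleRefl b) (hJ : J ⊆ simpleRefl b) :
    LinearIndependent A (klIJ b I J) := by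
  refine LinearIndependent.of_comp (TBasis b).repr.toLinearMap (linearIndependent_iff.mpr ?_)
  intro f hf
  by_contra hne
  obtain ⟨p, hp, hmax⟩ := Finset.exists_max_image f.support (fun p => len b (minElt b I J p))
    (Finsupp.support_nonempty_iff.mpr hne)
  have h1 := DFunLike.congr_fun hf (minElt b I J p)
  rw [Finsupp.linearCombination_apply, Finsupp.sum, Finsupp.finsetSum_apply,
    Finset.sum_eq_single p] at h1
  · exact mul_ne_zero (Finsupp.mem_support_iff.mp hp) (coef_klIJ_self_ne_zero hI hJ p) h1
  · intro q hq hqp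
    change f q * coef b (minElt b I J p) (klIJ b I J q) = 0
    rw [coef_klIJ_eq_zero hI hJ hqp.symm (hmax q hq), mul_zero]
  · exact fun h => absurd hp h

lemma chi_klC'_mem_span (hI : I ⊆ simpleRefl b) (hJ : J ⊆ simpleRefl b) (x : ExtWeyl P) :
    chi b I J (klC' b x) ∈ Submodule.span A (Set.range (klIJ b I J)) := by
  by_cases hx : ∃ p, x = minElt b I J p
  · obtain ⟨p, rfl⟩ := hx
    rw [← klIJ_eq]
    exact Submodule.subset_span ⟨p, rfl⟩
  · rw [chi_klC'_eq_zero hI hJ fun p hp => hx ⟨p, hp⟩]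
    exact Submodule.zero_mem _

lemma span_klIJ (hI : I ⊆ simpleRefl b) (hJ : J ⊆ simpleRefl b) :
    Submodule.span A (Set.range (klIJ b I J)) = HIJ b I J := by
  refine le_antisymm (Submodule.span_le.mpr ?_) ?_
  · rintro _ ⟨p, rfl⟩
    exact ⟨_, (klIJ_eq p).symm⟩
  · rw [HIJ, LinearMap.range_eq_map, ← span_klC', Submodule.map_span, Submodule.span_le]
    rintro _ ⟨_, ⟨x, rfl⟩, rfl⟩
    exact chi_klC'_mem_span hI hJ x

/-- Basis elements C'_x are either sent to independent vectors or to zero, which gives both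
disjointness and spanning. -/
lemma isCompl_span_ker (hI : I ⊆ simpleRefl b) (hJ : J ⊆ simpleRefl b) :
    IsCompl (Submodule.span A (Set.range fun p => klC' b (minElt b I J p)))
      (LinearMap.ker (chi b I J)) := by
  refine ⟨?_, ?_⟩
  · rw [Submodule.disjoint_def]
    intro h hh hker
    rw [Finsupp.mem_span_range_iff_exists_finsupp] at hh
    obtain ⟨f, rfl⟩ := hh
    rw [LinearMap.mem_ker, Finsupp.sum, map_sum] at hker
    simp only [map_smul, ← klIJ_eq] at hker
    have hf : f = 0 := linearIndependent_klIJ hI hJ (a₁ := f) (a₂ := 0) (by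
      rw [map_zero, Finsupp.linearCombination_apply]
      exact hker)
    rw [hf, Finsupp.sum_zero_index]
  · rw [codisjoint_iff, eq_top_iff, ← span_klC', Submodule.span_le]
    rintro _ ⟨x, rfl⟩
    by_cases hx : ∃ p, x = minElt b I J p
    · obtain ⟨p, rfl⟩ := hx
      exact Submodule.mem_sup_left (Submodule.subset_span ⟨p, rfl⟩)
    · exact Submodule.mem_sup_right (chi_klC'_eq_zero hI hJ fun p hp => hx ⟨p, hp⟩)

lemma bar_klIJ (p : Idx b I J) : bar b (klIJ b I J p) = klIJ b I J p := by
  rw [klIJ, map_mul, map_mul, bar_klC, bar_klC, bar_klC']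

end AffHecke

end

theorem mainTheorem9 {ι X Y : Type*} [Finite ι] [AddCommGroup X] [AddCommGroup Y]
    [Module.Finite ℤ X] (P : RootPairing ι ℤ X Y) [P.IsReduced] (b : P.Base)
    (I J : Set (AffHecke.ExtWeyl P))
    (hI : I ⊆ AffHecke.simpleRefl b) (hJ : J ⊆ AffHecke.simpleRefl b) :
    -- the objects in the statement are well defined
    ((∃! f, AffHecke.IsBar b f) ∧
      (∀ x, ∃! c, AffHecke.IsKLC b x c) ∧ (∀ x, ∃! c, AffHecke.IsKLC' b x c) ∧
      (∃! w, AffHecke.IsLongest b I w) ∧ (∃! w, AffHecke.IsLongest b J w) ∧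
      (∀ p : AffHecke.Idx b I J,
        ∃! m, AffHecke.IsMinIn b I J (AffHecke.transl P p.1.1 * p.1.2) m)) ∧
    -- the elements `C'_{lam, z}` are self-dual and form a basis of `H^{IJ}`
    ((∀ p, AffHecke.bar b (AffHecke.klIJ b I J p) = AffHecke.klIJ b I J p) ∧
      LinearIndependent AffHecke.A (AffHecke.klIJ b I J) ∧
      Submodule.span AffHecke.A (Set.range (AffHecke.klIJ b I J)) = AffHecke.HIJ b I J) ∧
    -- the values of `χ^{IJ}` on the basis `C'_x`
    ((∀ x p, x = AffHecke.minElt b I J p →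
        AffHecke.chi b I J (AffHecke.klC' b x) = AffHecke.klIJ b I J p) ∧
      (∀ x, (∀ p, x ≠ AffHecke.minElt b I J p) →
        AffHecke.chi b I J (AffHecke.klC' b x) = 0)) ∧
    -- `χ^{IJ}` is a projection onto the span of the `C'_{m_{lam, z}}`
    IsCompl (Submodule.span AffHecke.A
        (Set.range fun p => AffHecke.klC' b (AffHecke.minElt b I J p)))
      (LinearMap.ker (AffHecke.chi b I J)) := by
  exact ⟨⟨AffHecke.existsUnique_isBar b, AffHecke.existsUnique_isKLC b,
      AffHecke.existsUnique_isKLC' b, AffHecke.existsUnique_isLongest hI,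
      AffHecke.existsUnique_isLongest hJ, fun _ => AffHecke.existsUnique_isMinIn hI hJ _⟩,
    ⟨AffHecke.bar_klIJ, AffHecke.linearIndependent_klIJ hI hJ, AffHecke.span_klIJ hI hJ⟩,
    ⟨fun x p hx => by rw [hx, AffHecke.klIJ_eq], fun x hx => AffHecke.chi_klC'_eq_zero hI hJ hx⟩,
    AffHecke.isCompl_span_ker hI hJ⟩
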